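/- **Lemma 3.1 (asymptotic Poincaré inequality).** Let $n\ge 3$, let $\overline M$ be a compact smooth $n$-dimensional manifold with boundary $\partial M$, and let $M=\overline M\setminus\partial M$ be its interior. Let $l\ge 2$ be an integer, $\beta\in[0,1)$, and let $g$ be a $C^{l,\beta}$-asymptotically hyperbolic metric on $M$; that is, there is a smooth function $\rho\ge 0$ on $\overline M$ with $\rho^{-1}(0)=\partial M$ and $d\rho\ne 0$ on $\partial M$ such that $\rho^2 g$ extends to a Riemannian metric $\overline g$ of class $C^{l,\beta}$ on $\overline M$ with $|d\rho|^2_{\overline g}=1$ on $\partial M$. Denote by $\mathrm{Scal}$ and $\mu^g$ the scalar curvature and the Riemannian measure of $g$, and by $W^{1,2}_0(M,\mathbb R)$ the space of functions $u\in W^{1,2}_{loc}(M,\mathbb R)$ for which $u$ and $|du|_g$ are square integrable with respect to $\mu^g$ (the subscript $0$ is a weight, not a boundary condition). Then there is a continuous function $\epsilon:M\to\mathbb R$, tending to zero at infinity in $M$ (for every $\eta>0$ there is a compact set $K\subset M$ with $|\epsilon|<\eta$ on $M\setminus K$), such that for every $u\in W^{1,2}_0(M,\mathbb R)$ both integrals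 below converge absolutely and $$\int_M\left[\frac{4(n-1)}{n-2}|du|_g^2+\mathrm{Scal}\,u^2\right]d\mu^g\ \ge\ \int_M\left(\frac{n-1}{n-2}+\epsilon\right)u^2\,d\mu^g .$$ -/

import Mathlib

open MeasureTheory Set Filter Topology
open scoped Manifold ContDiff NNReal

noncomputable section

namespace AH

/-- The model space `ℝⁿ` with its Euclidean norm. -/
abbrev E (n : ℕ) : Type := EuclideanSpace ℝ (Fin n)

/-- The `i`-th standard basis vector of `ℝⁿ`. -/
def stdVec {n : ℕ} (i : Fin n) : E n := EuclideanSpace.single i (1 : ℝ)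

/-! ### Linear algebra -/

/-- The Gram matrix `b(e_i, e_j)` of a bilinear form on `ℝⁿ` in the standard basis. -/
def gram {n : ℕ} (b : E n →L[ℝ] E n →L[ℝ] ℝ) : Matrix (Fin n) (Fin n) ℝ :=
  Matrix.of fun i j => b (stdVec i) (stdVec j)

/-- The squared norm `b^{ij} θ_i θ_j` of a covector `θ` with respect to an inner product `b`. -/
def covectorNormSq {n : ℕ} (b : E n →L[ℝ] E n →L[ℝ] ℝ) (θ : E n →L[ℝ] ℝ) : ℝ :=
  ∑ i, ∑ j, (gram b)⁻¹ i j * θ (stdVec i) * θ (stdVec j)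

/-! ### Curvature in coordinates -/

/-- The partial derivative `∂_i f` of a function on (an open subset of) `ℝⁿ`. -/
def pderiv {n : ℕ} (i : Fin n) (f : E n → ℝ) (y : E n) : ℝ := fderiv ℝ f y (stdVec i)

/-- The Christoffel symbol
`Γ^k_{ij} = ½ g^{kl} (∂_i g_{jl} + ∂_j g_{il} - ∂_l g_{ij})`. -/
def christoffel {n : ℕ} (G : E n → Matrix (Fin n) (Fin n) ℝ) (k i j : Fin n) (y : E n) : ℝ :=
  (1 / 2 : ℝ) * ∑ l, (G y)⁻¹ k l *
    (pderiv i (fun z => G z j l) y + pderiv j (fun z => G z i l) y - pderiv l (fun z => G z i j) y)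

/-- The Ricci curvature
`R_{jk} = ∂_i Γ^i_{jk} - ∂_k Γ^i_{ij} + Γ^i_{il} Γ^l_{jk} - Γ^i_{kl} Γ^l_{ij}`. -/
def ricci {n : ℕ} (G : E n → Matrix (Fin n) (Fin n) ℝ) (j k : Fin n) (y : E n) : ℝ :=
  ∑ i, (pderiv i (christoffel G i j k) y - pderiv k (christoffel G i i j) y
    + ∑ l, (christoffel G i i l y * christoffel G l j k y
      - christoffel G i k l y * christoffel G l i j y))

/-- The scalar curvature `g^{jk} R_{jk}` of the metric with coefficients `G`. -/
def coordScal {n : ℕ} (G : E n → Matrix (Fin n) (Fin n) ℝ) (y : E n) : ℝ :=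
  ∑ j, ∑ k, (G y)⁻¹ j k * ricci G j k y

/-! ### Tensor fields on a manifold with boundary

Throughout `X` is the manifold with boundary and `M` is its interior `(𝓡∂ n).interior X`. -/

section Manifold

variable {n : ℕ} [NeZero n] {X : Type*} [TopologicalSpace X] [ChartedSpace (EuclideanHalfSpace n) X]

variable (n X) in
/-- Fields of bilinear forms on the tangent spaces of `X`. -/
abbrev BilinField : Type _ :=
  ∀ x : X, TangentSpace (𝓡∂ n) x →L[ℝ] TangentSpace (𝓡∂ n) x →L[ℝ] ℝ

variable (n X) in
/-- Fields of covectors (differential 1-forms, without any regularity). -/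
abbrev CovectorField : Type _ := ∀ x : X, TangentSpace (𝓡∂ n) x →L[ℝ] ℝ

variable (n X) in
/-- The smooth charts of `X`. -/
abbrev smoothCharts : Set (OpenPartialHomeomorph X (EuclideanHalfSpace n)) :=
  IsManifold.maximalAtlas (𝓡∂ n) ∞ X

/-- The coordinate frame: the differential at `y` of the inverse of the chart `e`; its values on
the standard basis are the coordinate vectors `∂_1, …, ∂_n`. It takes values in the tangent space
at the point with coordinates `y`, which Mathlib represents by a copy of `ℝⁿ`. -/
def frame (e : OpenPartialHomeomorph X (EuclideanHalfSpace n)) (y : E n) : E n →L[ℝ] E n :=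
  mfderivWithin 𝓘(ℝ, E n) (𝓡∂ n) (e.extend (𝓡∂ n)).symm (range (𝓡∂ n)) y

/-- The expression of a field of bilinear forms in the chart `e`. -/
def coordBilin (b : BilinField n X) (e : OpenPartialHomeomorph X (EuclideanHalfSpace n))
    (y : E n) : E n →L[ℝ] E n →L[ℝ] ℝ :=
  ContinuousLinearMap.bilinearComp
    (b ((e.extend (𝓡∂ n)).symm y) : E n →L[ℝ] E n →L[ℝ] ℝ) (frame e y) (frame e y)

/-- The expression of a field of covectors in the chart `e`. -/
def coordCovector (θ : CovectorField n X) (e : OpenPartialHomeomorph X (EuclideanHalfSpace n))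
    (y : E n) : E n →L[ℝ] ℝ :=
  ContinuousLinearMap.comp (θ ((e.extend (𝓡∂ n)).symm y) : E n →L[ℝ] ℝ) (frame e y)

/-- The coefficients `g_{ij}` of a field of bilinear forms in the chart `e`. -/
def coordMatrix (b : BilinField n X) (e : OpenPartialHomeomorph X (EuclideanHalfSpace n))
    (y : E n) : Matrix (Fin n) (Fin n) ℝ :=
  gram (coordBilin b e y)

/-- The open subset of `ℝⁿ` onto which the chart `e` maps the interior points of its domain. -/
def chartDomain (e : OpenPartialHomeomorph X (EuclideanHalfSpace n)) : Set (E n) :=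
  interior (e.extend (𝓡∂ n)).target

/-- The scalar curvature of `g` at `x`. -/
def scal (g : BilinField n X) (x : X) : ℝ :=
  coordScal (coordMatrix g (chartAt (EuclideanHalfSpace n) x)) (extChartAt (𝓡∂ n) x x)

/-- `|θ|²_g` at the point `x`. -/
def normSqAt (g : BilinField n X) (θ : CovectorField n X) (x : X) : ℝ :=
  covectorNormSq (n := n) (g x) (θ x)

/-! ### The Riemannian measure -/

/-- The Riemannian measure of the interior part of the domain of the chart `e`: the image of
`√(det g_{ij}) dy` under the inverse of the chart. -/
def chartVolume [MeasurableSpace X] (g : BilinField n X)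
    (e : OpenPartialHomeomorph X (EuclideanHalfSpace n)) : Measure X :=
  (((volume : Measure (E n)).restrict (chartDomain e)).withDensity
    fun y => ENNReal.ofReal (Real.sqrt (coordMatrix g e y).det)).map (e.extend (𝓡∂ n)).symm

/-- The Riemannian measure `μ^g` of the interior `M`, as a measure on `X` that does not charge the
boundary. The measures of the single charts are the restrictions of `μ^g` to their domains, which
cover `M`; hence `μ^g` is their supremum (in the complete lattice of measures). -/
def riemVolume [MeasurableSpace X] (g : BilinField n X) : Measure X :=
  ⨆ e ∈ smoothCharts n X, chartVolume g e

/-! ### Sobolev functions -/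

/-- `θ` is a weak differential of `u` on the interior `M`: in every smooth chart both are locally
integrable and `θ_v = ∂_v u` in the sense of distributions, for every direction `v`. -/
def IsWeakDifferential (u : X → ℝ) (θ : CovectorField n X) : Prop :=
  ∀ e ∈ smoothCharts n X,
    LocallyIntegrableOn (fun y => u ((e.extend (𝓡∂ n)).symm y)) (chartDomain e) ∧
    LocallyIntegrableOn (coordCovector θ e) (chartDomain e) ∧
    ∀ φ : E n → ℝ, ContDiff ℝ ∞ φ → HasCompactSupport φ → tsupport φ ⊆ chartDomain e →
      ∀ v : E n,
        ∫ y, u ((e.extend (𝓡∂ n)).symm y) * fderiv ℝ φ y v = - ∫ y, coordCovector θ e y v * φ y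

open Classical in
/-- The weak differential `du` (unique up to a null set), `0` if there is none. -/
def weakDifferential (u : X → ℝ) : CovectorField n X :=
  if h : ∃ θ : CovectorField n X, IsWeakDifferential u θ then h.choose else fun _ => 0

/-- The functions in the Sobolev space `W^{1,2}_0(M, ℝ)` (the subscript `0` is the weight): `u` has
a weak differential on `M`, and `u` and `|du|_g` are square integrable for `μ^g`.
Only the values of `u` on `M` matter. -/
structure MemW12 [MeasurableSpace X] (g : BilinField n X) (u : X → ℝ) : Prop where
  exists_weakDifferential : ∃ θ : CovectorField n X, IsWeakDifferential u θ
  memLp : MemLp u 2 (riemVolume g)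
  integrable_normSq : Integrable (normSqAt g (weakDifferential u)) (riemVolume g)

/-- The integrand `4(n-1)/(n-2) |du|² + Scal u²` of the functional `G_g`. -/
def energyDensity (g : BilinField n X) (u : X → ℝ) (x : X) : ℝ :=
  4 * ((n : ℝ) - 1) / ((n : ℝ) - 2) * normSqAt g (weakDifferential u) x + scal g x * u x ^ 2

/-- The functional `G_g(u) = ∫_M [4(n-1)/(n-2) |du|² + Scal u²] dμ^g`. -/
def energy [MeasurableSpace X] (g : BilinField n X) (u : X → ℝ) : ℝ :=
  ∫ x, energyDensity g u x ∂(riemVolume g)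

/-! ### Asymptotically hyperbolic metrics -/

/-- `b` is a Riemannian metric of class `C^{l,β}` on `X`, up to the boundary: in every smooth chart
its coefficients are of class `C^l`, with `l`-th derivatives locally Hölder of exponent `β`. -/
structure IsHolderMetric (l : ℕ) (β : ℝ≥0) (b : BilinField n X) : Prop where
  symm : ∀ (x : X) (v w : TangentSpace (𝓡∂ n) x), b x v w = b x w v
  pos : ∀ (x : X) (v : TangentSpace (𝓡∂ n) x), v ≠ 0 → 0 < b x v v
  contDiffOn : ∀ e ∈ smoothCharts n X,
    ContDiffOn ℝ l (coordBilin b e) (e.extend (𝓡∂ n)).target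
  holder : ∀ e ∈ smoothCharts n X, ∀ y ∈ (e.extend (𝓡∂ n)).target,
    ∃ C : ℝ≥0, ∃ s ∈ 𝓝[(e.extend (𝓡∂ n)).target] y,
      HolderOnWith C β
        (iteratedFDerivWithin ℝ l (coordBilin b e) (e.extend (𝓡∂ n)).target) s

/-- The differential of a function on `X`. -/
def differential (f : X → ℝ) : CovectorField n X :=
  fun x => mfderiv (𝓡∂ n) 𝓘(ℝ, ℝ) f x

variable (n) in
/-- `ρ` is a defining function for the boundary of `X`. -/
structure IsDefiningFunction (ρ : X → ℝ) : Prop where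
  smooth : ContMDiff (𝓡∂ n) 𝓘(ℝ, ℝ) ∞ ρ
  nonneg : ∀ x, 0 ≤ ρ x
  eq_zero_iff : ∀ x, ρ x = 0 ↔ x ∈ (𝓡∂ n).boundary X
  differential_ne_zero : ∀ x ∈ (𝓡∂ n).boundary X, differential (n := n) ρ x ≠ 0

/-- The metric `g` on the interior `M` of `X` is `C^{l,β}`-asymptotically hyperbolic: for some
defining function `ρ`, the metric `ρ² g` extends to a `C^{l,β}` metric `gbar` on `X` with
`|dρ|²_{gbar} = 1` along the boundary. The values of `g` at boundary points are irrelevant. -/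
def IsAsymptoticallyHyperbolic (l : ℕ) (β : ℝ≥0) (g : BilinField n X) : Prop :=
  ∃ (ρ : X → ℝ) (gbar : BilinField n X),
    IsDefiningFunction n ρ ∧ IsHolderMetric l β gbar ∧
    (∀ x ∈ (𝓡∂ n).interior X, ∀ v w : TangentSpace (𝓡∂ n) x,
      gbar x v w = ρ x ^ 2 * g x v w) ∧
    ∀ x ∈ (𝓡∂ n).boundary X, normSqAt gbar (differential ρ) x = 1

end Manifold

end AH

end

/-! Write g = ρ⁻²ḡ on the interior, and let V = ρ∇ρ, the gradient being taken in ḡ. The g-length of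
V is |dρ|_ḡ, and its g-divergence is (1 - n)|dρ|²_ḡ + ρ div_ḡ(∇ρ). Both are continuous up to the
boundary, where they equal 1 and 1 - n.

For u in W^{1,2}, integration by parts gives ∫ 2u·V(u) = -∫ u² div V, and completing a square gives
|du|²_g ≥ 2s·u·V(u) - s²u²|dρ|²_ḡ for every real s. Hence ∫ |du|² ≥ -∫ u²(s div V + s²|dρ|²). On the
boundary the coefficient of u² on the right is s(n-1) - s², which is largest, equal to (n-1)²/4, for
s = (n-1)/2.

The scalar curvature of g also extends continuously to the compact manifold, with boundary value
-n(n-1). Since 4(n-1)/(n-2) · (n-1)²/4 - n(n-1) = (n-1)/(n-2), the difference between the resulting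
coefficient and this constant is a continuous function on a compact space that vanishes on the
boundary. This is ε.

The curvature limit is `continuous_scalExt`: the formula for the scalar curvature of r⁻²G is
rewritten without negative powers of r (`coordScal_conformal`), and coordinate invariance
(`coordScal_transform`) makes one chart usable on a whole neighbourhood. The integration by parts is
`integral_sq_mul_fderiv` in ℝⁿ, `integral_chart_parts` in a chart, `exists_divergence` for compactly
supported test functions, and `integral_radial` after removing the cutoff. The pointwise square is
`radial_le`. -/

noncomputable section

set_option maxSynthPendingDepth 3
set_option linter.unusedSectionVars false

namespace AH

/-! ### Inner products on ℝⁿ, contractions and changes of basis. -/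

section LinearAlgebra

variable {n : ℕ}

@[simp] lemma stdVec_apply (i j : Fin n) : (stdVec i : E n) j = if j = i then 1 else 0 := by
  simp [stdVec]

lemma sum_smul_stdVec (v : E n) : ∑ i, v i • (stdVec i : E n) = v := by
  ext j
  simp [stdVec_apply]

/-- The matrix of a linear map in the standard basis. -/
def mat (L : E n →L[ℝ] E n) : Matrix (Fin n) (Fin n) ℝ :=
  LinearMap.toMatrix (EuclideanSpace.basisFun (Fin n) ℝ).toBasis
    (EuclideanSpace.basisFun (Fin n) ℝ).toBasis L.toLinearMap

lemma mat_apply (L : E n →L[ℝ] E n) (i j : Fin n) : mat L i j = L (stdVec j) i := by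
  simp [mat, LinearMap.toMatrix_apply, stdVec]

lemma det_mat (L : E n →L[ℝ] E n) : (mat L).det = L.det := by
  simp [mat, ContinuousLinearMap.det]

lemma apply_stdVec_eq (L : E n →L[ℝ] E n) (j : Fin n) :
    L (stdVec j) = ∑ i, mat L i j • (stdVec i : E n) := by
  simp only [mat_apply]
  exact (sum_smul_stdVec _).symm

/-- The matrix of a bilinear form in the standard basis. -/
def bmat (r : E n →ₗ[ℝ] E n →ₗ[ℝ] ℝ) : Matrix (Fin n) (Fin n) ℝ :=
  Matrix.of fun i j => r (stdVec i) (stdVec j)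

lemma bmat_comp (r r' : E n →ₗ[ℝ] E n →ₗ[ℝ] ℝ) (L : E n →L[ℝ] E n)
    (h : ∀ u v, r' u v = r (L u) (L v)) :
    bmat r' = (mat L).transpose * bmat r * mat L := by
  ext i j
  simp only [bmat, Matrix.of_apply, h, apply_stdVec_eq, map_sum, map_smul, LinearMap.sum_apply,
    LinearMap.smul_apply, smul_eq_mul, Matrix.mul_apply, Matrix.transpose_apply, Finset.sum_mul,
    Finset.mul_sum]
  refine Finset.sum_congr rfl fun p _ => Finset.sum_congr rfl fun q _ => by ring

/-- A continuous bilinear form as a plain bilinear form. -/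
def toBilin (b : E n →L[ℝ] E n →L[ℝ] ℝ) : E n →ₗ[ℝ] E n →ₗ[ℝ] ℝ :=
  LinearMap.mk₂ ℝ (fun u v => b u v) (by simp) (by simp) (by simp) (by simp)

lemma gram_eq_bmat (b : E n →L[ℝ] E n →L[ℝ] ℝ) : gram b = bmat (toBilin b) := rfl

lemma gram_comp (b : E n →L[ℝ] E n →L[ℝ] ℝ) (L : E n →L[ℝ] E n) :
    gram (b.bilinearComp L L) = (mat L).transpose * gram b * mat L := by
  rw [gram_eq_bmat, gram_eq_bmat]
  exact bmat_comp _ _ L fun u v => rfl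

lemma det_gram_comp (b : E n →L[ℝ] E n →L[ℝ] ℝ) (L : E n →L[ℝ] E n) :
    (gram (b.bilinearComp L L)).det = L.det ^ 2 * (gram b).det := by
  rw [gram_comp, Matrix.det_mul, Matrix.det_mul, Matrix.det_transpose, det_mat]
  ring

/-- The contraction `b^{ij} r_{ij}`. -/
def contr (b : E n →L[ℝ] E n →L[ℝ] ℝ) (r : E n →ₗ[ℝ] E n →ₗ[ℝ] ℝ) : ℝ :=
  ∑ i, ∑ j, (gram b)⁻¹ i j * r (stdVec i) (stdVec j)

lemma contr_eq_trace (b : E n →L[ℝ] E n →L[ℝ] ℝ) (r : E n →ₗ[ℝ] E n →ₗ[ℝ] ℝ) :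
    contr b r = ((gram b)⁻¹ * (bmat r).transpose).trace := by
  simp [contr, Matrix.trace, Matrix.mul_apply, bmat]

/-- The contraction is the trace of b⁻¹rᵀ. Under a change of basis this matrix is conjugated, so its
trace is unchanged. -/
lemma contr_comp (b : E n →L[ℝ] E n →L[ℝ] ℝ) (r r' : E n →ₗ[ℝ] E n →ₗ[ℝ] ℝ) (L : E n →L[ℝ] E n)
    (hL : L.det ≠ 0) (h : ∀ u v, r' u v = r (L u) (L v)) :
    contr (b.bilinearComp L L) r' = contr b r := by
  rw [contr_eq_trace, contr_eq_trace, bmat_comp r r' L h, gram_comp]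
  have hu : IsUnit (mat L).det := by rw [det_mat]; exact hL.isUnit
  have h2 : IsUnit (mat L).transpose.det := by rw [Matrix.det_transpose]; exact hu
  rw [Matrix.mul_inv_rev, Matrix.mul_inv_rev, Matrix.transpose_mul, Matrix.transpose_mul,
    Matrix.transpose_transpose]
  have : (mat L)⁻¹ * ((gram b)⁻¹ * (mat L).transpose⁻¹) *
      ((mat L).transpose * ((bmat r).transpose * mat L)) =
      (mat L)⁻¹ * ((gram b)⁻¹ * ((mat L).transpose⁻¹ *
      (mat L).transpose) * ((bmat r).transpose * mat L)) := by
    simp only [Matrix.mul_assoc]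
  rw [this, Matrix.nonsing_inv_mul _ h2, Matrix.trace_mul_comm]
  simp only [Matrix.mul_assoc, Matrix.mul_nonsing_inv _ hu, Matrix.mul_one]

/-- The inner product `b^{ij} θ_i η_j` of covectors. -/
def coPair (b : E n →L[ℝ] E n →L[ℝ] ℝ) (θ η : E n →L[ℝ] ℝ) : ℝ :=
  ∑ i, ∑ j, (gram b)⁻¹ i j * θ (stdVec i) * η (stdVec j)

lemma covectorNormSq_eq_coPair (b : E n →L[ℝ] E n →L[ℝ] ℝ) (θ : E n →L[ℝ] ℝ) :
    covectorNormSq b θ = coPair b θ θ := rfl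

lemma coPair_comp (b : E n →L[ℝ] E n →L[ℝ] ℝ) (θ η : E n →L[ℝ] ℝ) (L : E n →L[ℝ] E n)
    (hL : L.det ≠ 0) :
    coPair (b.bilinearComp L L) (θ.comp L) (η.comp L) = coPair b θ η := by
  have key : ∀ (b : E n →L[ℝ] E n →L[ℝ] ℝ) (θ η : E n →L[ℝ] ℝ), coPair b θ η =
      contr b (LinearMap.mk₂ ℝ (fun u v => θ u * η v) (by intros; simp; ring) (by intros; simp; ring)
        (by intros; simp; ring) (by intros; simp; ring)) := by
    intro b θ η
    simp [coPair, contr, mul_assoc]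
  rw [key, key]
  exact contr_comp _ _ _ L hL fun u v => rfl

/-- The vector dual to a covector. -/
def sharp (b : E n →L[ℝ] E n →L[ℝ] ℝ) (θ : E n →L[ℝ] ℝ) : E n :=
  ∑ i, (∑ j, (gram b)⁻¹ i j * θ (stdVec j)) • stdVec i

lemma coPair_eq_apply_sharp (b : E n →L[ℝ] E n →L[ℝ] ℝ) (θ η : E n →L[ℝ] ℝ) :
    coPair b θ η = θ (sharp b η) := by
  simp only [coPair, sharp, map_sum, map_smul, smul_eq_mul, Finset.sum_mul]
  refine Finset.sum_congr rfl fun p _ => Finset.sum_congr rfl fun q _ => by ring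

lemma coPair_add_left (b : E n →L[ℝ] E n →L[ℝ] ℝ) (θ θ' η : E n →L[ℝ] ℝ) :
    coPair b (θ + θ') η = coPair b θ η + coPair b θ' η := by
  simp [coPair_eq_apply_sharp]

lemma coPair_smul_left (b : E n →L[ℝ] E n →L[ℝ] ℝ) (c : ℝ) (θ η : E n →L[ℝ] ℝ) :
    coPair b (c • θ) η = c * coPair b θ η := by
  simp [coPair_eq_apply_sharp]

/-- `b` is an inner product. -/
structure IsInner (b : E n →L[ℝ] E n →L[ℝ] ℝ) : Prop where
  symm : ∀ v w, b v w = b w v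
  pos : ∀ v, v ≠ 0 → 0 < b v v

namespace IsInner

variable {b : E n →L[ℝ] E n →L[ℝ] ℝ} (hb : IsInner b)
include hb

lemma comp {L : E n →L[ℝ] E n} (hL : Function.Injective L) : IsInner (b.bilinearComp L L) where
  symm v w := hb.symm _ _
  pos v hv := hb.pos _ (by simpa using hL.ne hv)

lemma smul {c : ℝ} (hc : 0 < c) : IsInner (c • b) where
  symm v w := by simp [hb.symm v w]
  pos v hv := by simpa using mul_pos hc (hb.pos v hv)

lemma posDef : (gram b).PosDef := by
  refine Matrix.PosDef.of_dotProduct_mulVec_pos ?_ ?_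
  · ext i j
    simp [gram, hb.symm (stdVec i)]
  · intro x hx
    have : (star x ⬝ᵥ Matrix.mulVec (gram b) x) = b (WithLp.toLp 2 x) (WithLp.toLp 2 x) := by
      conv_rhs => rw [← sum_smul_stdVec (WithLp.toLp 2 x : E n)]
      simp only [dotProduct, Matrix.mulVec, gram, Matrix.of_apply, map_sum, map_smul,
        _root_.sum_apply, _root_.smul_apply, smul_eq_mul,
        Finset.mul_sum, Pi.star_apply, star_trivial]
      rw [Finset.sum_comm]
      refine Finset.sum_congr rfl fun p _ => Finset.sum_congr rfl fun q _ => by ring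
    rw [this]
    apply hb.pos
    intro h
    apply hx
    simpa using congrArg WithLp.ofLp h

lemma isUnit_det : IsUnit (gram b).det := hb.posDef.det_pos.ne'.isUnit

lemma apply_sharp (θ : E n →L[ℝ] ℝ) (v : E n) : b v (sharp b θ) = θ v := by
  have h1 : ∀ k, b (stdVec k) (sharp b θ) = θ (stdVec k) := by
    intro k
    have h2 : (gram b).mulVec ((gram b)⁻¹.mulVec fun j => θ (stdVec j)) k = θ (stdVec k) := by
      rw [Matrix.mulVec_mulVec, Matrix.mul_nonsing_inv _ hb.isUnit_det, Matrix.one_mulVec]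
    rw [← h2]
    simp only [sharp, map_sum, map_smul, smul_eq_mul, Matrix.mulVec, dotProduct, gram,
      Matrix.of_apply]
    refine Finset.sum_congr rfl fun p _ => by ring
  conv_lhs => rw [← sum_smul_stdVec v]
  conv_rhs => rw [← sum_smul_stdVec v]
  simp [map_sum, h1]

lemma coPair_eq (θ η : E n →L[ℝ] ℝ) : coPair b θ η = b (sharp b θ) (sharp b η) := by
  rw [coPair_eq_apply_sharp, hb.symm, hb.apply_sharp]

lemma nonneg (v : E n) : 0 ≤ b v v := by
  rcases eq_or_ne v 0 with rfl | h
  · simp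
  · exact (hb.pos v h).le

lemma sq_apply_le (v w : E n) : b v w ^ 2 ≤ b v v * b w w := by
  have h : ∀ t : ℝ, 0 ≤ b w w * (t * t) + (2 * b v w) * t + b v v := by
    intro t
    have := hb.nonneg (v + t • w)
    simp only [map_add, map_smul, _root_.add_apply, _root_.smul_apply,
      smul_eq_mul, hb.symm w v] at this
    linarith
  have := discrim_le_zero h
  rw [discrim] at this
  nlinarith

/-- Cauchy–Schwarz for v and the dual vector of θ. It bounds the components of a weak differential
by its norm, and so makes them locally square integrable. -/
lemma sq_covector_le (θ : E n →L[ℝ] ℝ) (v : E n) : θ v ^ 2 ≤ b v v * covectorNormSq b θ := by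
  rw [covectorNormSq_eq_coPair, hb.coPair_eq, ← hb.apply_sharp θ v]
  exact hb.sq_apply_le _ _

lemma sq_coPair_le (θ η : E n →L[ℝ] ℝ) :
    coPair b θ η ^ 2 ≤ covectorNormSq b θ * covectorNormSq b η := by
  rw [covectorNormSq_eq_coPair, covectorNormSq_eq_coPair, hb.coPair_eq, hb.coPair_eq, hb.coPair_eq]
  exact hb.sq_apply_le _ _

/-- Nonnegativity of |θ - cη|². With η = dρ and c = su/ρ this becomes the pointwise inequality
behind the theorem. -/
lemma two_mul_coPair_le (θ η : E n →L[ℝ] ℝ) (c : ℝ) :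
    2 * c * coPair b θ η ≤ covectorNormSq b θ + c ^ 2 * covectorNormSq b η := by
  rw [covectorNormSq_eq_coPair, covectorNormSq_eq_coPair, hb.coPair_eq, hb.coPair_eq, hb.coPair_eq]
  have := hb.nonneg (sharp b θ - c • sharp b η)
  simp only [map_sub, map_smul, _root_.sub_apply, _root_.smul_apply,
      smul_eq_mul, hb.symm (sharp b η) (sharp b θ)] at this
  nlinarith

end IsInner

lemma gram_smul (c : ℝ) (b : E n →L[ℝ] E n →L[ℝ] ℝ) : gram (c • b) = c • gram b := by
  ext i j; simp [gram]

lemma coPair_smul_form {c : ℝ} (hc : c ≠ 0) {b : E n →L[ℝ] E n →L[ℝ] ℝ} (hb : IsInner b)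
    (θ η : E n →L[ℝ] ℝ) : coPair (c • b) θ η = c⁻¹ * coPair b θ η := by
  have : (c • gram b)⁻¹ = c⁻¹ • (gram b)⁻¹ := by
    apply Matrix.inv_eq_left_inv
    rw [Matrix.smul_mul, Matrix.mul_smul, smul_smul, inv_mul_cancel₀ hc, one_smul,
      Matrix.nonsing_inv_mul _ hb.isUnit_det]
  simp only [coPair, gram_smul, this, Matrix.smul_apply, smul_eq_mul, Finset.mul_sum, mul_assoc]

end LinearAlgebra

/-! ### Weak derivatives in ℝⁿ: the product rule for u² by means of translations in L². -/

section Sobolev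

variable {n : ℕ}

/-- Since w is only locally integrable, the derivative has to fall on f; it is taken under the
integral sign. -/
lemma hasDerivAt_integral_translate {w : E n → ℝ} (hw : LocallyIntegrable w) {f : E n → ℝ}
    (hf : ContDiff ℝ 1 f) (hc : HasCompactSupport f) (v : E n) (t : ℝ) :
    HasDerivAt (fun t : ℝ => ∫ y, w y * f (y - t • v))
      (-∫ y, w y * fderiv ℝ f (y - t • v) v) t := by
  have hf' : Continuous fun y => fderiv ℝ f y v :=
    (hf.continuous_fderiv one_ne_zero).clm_apply continuous_const
  have hc' : HasCompactSupport fun y => fderiv ℝ f y v := hc.fderiv_apply ℝ v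
  obtain ⟨C, hC⟩ := hc'.exists_bound_of_continuous hf'
  have hcont : Continuous fun p : ℝ × E n => p.2 + p.1 • v := by fun_prop
  -- K is swept out by the support of f during all translations with parameter within 1 of t.
  -- Outside K every integrand vanishes, so a bound supported on the compact set K dominates.
  set K : Set (E n) := (fun p : ℝ × E n => p.2 + p.1 • v) '' (Metric.closedBall t 1 ×ˢ tsupport f)
  have hK : IsCompact K := ((isCompact_closedBall t 1).prod hc).image hcont
  have hzero : ∀ s ∈ Metric.ball t 1, ∀ y, y ∉ K → y - s • v ∉ tsupport f := by
    intro s hs y hy h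
    exact hy ⟨(s, y - s • v), ⟨Metric.ball_subset_closedBall hs, h⟩, by simp⟩
  rw [← integral_neg]
  have hmeas : ∀ s : ℝ, AEStronglyMeasurable (fun y => w y * f (y - s • v)) := fun s =>
    hw.aestronglyMeasurable.mul (hf.continuous.comp (by fun_prop)).aestronglyMeasurable
  refine (hasDerivAt_integral_of_dominated_loc_of_deriv_le (F := fun s y => w y * f (y - s • v))
    (F' := fun s y => -(w y * fderiv ℝ f (y - s • v) v))
    (bound := fun y => K.indicator (fun y => ‖w y‖ * C) y)
    (s := Metric.ball t 1) (Metric.ball_mem_nhds t one_pos)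
    (Eventually.of_forall hmeas) ?_ ?_ ?_ ?_ ?_).2
  · obtain ⟨C', hC'⟩ := hc.exists_bound_of_continuous hf.continuous
    have hi : Integrable (fun y => K.indicator (fun y => ‖w y‖ * C') y) :=
      (integrable_indicator_iff hK.measurableSet).2
        ((hw.integrableOn_isCompact hK).norm.mul_const C')
    refine hi.mono' (hmeas t) (Eventually.of_forall fun y => ?_)
    by_cases hy : y ∈ K
    · rw [indicator_of_mem hy, norm_mul]
      exact mul_le_mul_of_nonneg_left (hC' _) (norm_nonneg _)
    · rw [indicator_of_notMem hy,
        image_eq_zero_of_notMem_tsupport (hzero t (Metric.mem_ball_self one_pos) y hy)]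
      simp
  · exact (hw.aestronglyMeasurable.mul (hf'.comp (by fun_prop)).aestronglyMeasurable).neg
  · refine Eventually.of_forall fun y s hs => ?_
    by_cases hy : y ∈ K
    · rw [indicator_of_mem hy, norm_neg, norm_mul]
      exact mul_le_mul_of_nonneg_left (hC _) (norm_nonneg _)
    · have : y - s • v ∉ tsupport fun y => fderiv ℝ f y v := fun h =>
        hzero s hs y hy (tsupport_fderiv_apply_subset ℝ v h)
      rw [indicator_of_notMem hy, norm_neg, norm_mul]
      have h0 := image_eq_zero_of_notMem_tsupport this
      simp [h0]
  · exact (integrable_indicator_iff hK.measurableSet).2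
      ((hw.integrableOn_isCompact hK).norm.mul_const C)
  · refine Eventually.of_forall fun y s hs => ?_
    have h1 : HasDerivAt (fun s : ℝ => y - s • v) (-v) s := by
      simpa using ((hasDerivAt_id s).smul_const v).const_sub y
    have h2 := ((hf.differentiable one_ne_zero) (y - s • v)).hasFDerivAt.comp_hasDerivAt s h1
    simpa using h2.const_mul (w y)

/-- Translation `f ↦ f (· + c)` on `L²`. -/
def translate (c : E n) (a : Lp ℝ 2 (volume : Measure (E n))) : Lp ℝ 2 (volume : Measure (E n)) :=
  (DomAddAct.mk c) +ᵥ a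

lemma translate_ae (c : E n) (a : Lp ℝ 2 (volume : Measure (E n))) :
    translate c a =ᵐ[volume] fun y => a (y + c) := by
  filter_upwards [DomAddAct.vadd_Lp_ae_eq (DomAddAct.mk c) a] with y hy
  rw [translate, hy]
  simp [add_comm]

lemma translate_zero (a : Lp ℝ 2 (volume : Measure (E n))) : translate 0 a = a := by
  apply Lp.ext
  filter_upwards [translate_ae 0 a] with y hy
  simpa using hy

lemma continuous_translate (v : E n) (a : Lp ℝ 2 (volume : Measure (E n))) :
    Continuous fun t : ℝ => translate (t • v) a := by
  have : Fact ((2 : ENNReal) ≠ ⊤) := ⟨by simp⟩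
  have h : Continuous fun t : ℝ => DomAddAct.mk (t • v) :=
    DomAddAct.continuous_mk.comp (by fun_prop)
  exact h.vadd continuous_const

lemma inner_translate {φ : E n → ℝ} {p a : Lp ℝ 2 (volume : Measure (E n))} (hp : p =ᵐ[volume] φ)
    (c : E n) : inner ℝ p (translate c a) = ∫ y, a y * φ (y - c) := by
  rw [L2.inner_def, ← integral_add_right_eq_self (fun y => a y * φ (y - c)) c]
  refine integral_congr_ae ?_
  filter_upwards [hp, translate_ae c a] with y h1 h2
  simp [h1, h2]

variable {a b : Lp ℝ 2 (volume : Measure (E n))} {v : E n}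

/-- Against a smooth compactly supported function, both sides have the same derivative in t, by the
weak derivative hypothesis, and agree at t = 0. Such functions are dense in L². -/
lemma translate_eq_integral
    (h : ∀ φ : E n → ℝ, ContDiff ℝ ∞ φ → HasCompactSupport φ →
      ∫ y, a y * fderiv ℝ φ y v = -∫ y, b y * φ y) (t : ℝ) :
    translate (t • v) a = a + ∫ s in (0 : ℝ)..t, translate (s • v) b := by
  have hloc : ∀ p : Lp ℝ 2 (volume : Measure (E n)), LocallyIntegrable p := fun p =>
    (Lp.memLp p).locallyIntegrable (by norm_num)
  refine ext_inner_left ℝ fun q => ?_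
  revert q
  rw [← funext_iff]
  refine Continuous.ext_on (Lp.dense_hasCompactSupport_contDiff (F := ℝ) (p := 2)
    (μ := (volume : Measure (E n))) (by simp))
    (by fun_prop) (by fun_prop) ?_
  rintro p ⟨φ, hp, hc, hφ⟩
  simp only
  have hcB := continuous_translate v b
  have hder1 : ∀ t : ℝ, HasDerivAt (fun t : ℝ => inner ℝ p (translate (t • v) a))
      (inner ℝ p (translate (t • v) b)) t := by
    intro t
    simp only [inner_translate hp]
    have h1 := hasDerivAt_integral_translate (hloc a) (hφ.of_le (by simp)) hc v t
    have h2 := h (fun y => φ (y - t • v)) (hφ.comp (by fun_prop))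
      (hc.comp_homeomorph (Homeomorph.subRight (t • v)))
    simp only [fderiv_comp_sub] at h2
    rw [h2, neg_neg] at h1
    exact h1
  have hder2 : ∀ t : ℝ, HasDerivAt
      (fun t : ℝ => inner ℝ p (a + ∫ s in (0 : ℝ)..t, translate (s • v) b))
      (inner ℝ p (translate (t • v) b)) t := by
    intro t
    have h1 : HasDerivAt (fun t : ℝ => a + ∫ s in (0 : ℝ)..t, translate (s • v) b)
        (translate (t • v) b) t :=
      (intervalIntegral.integral_hasDerivAt_right (hcB.intervalIntegrable _ _)
        (hcB.stronglyMeasurableAtFilter _ _) hcB.continuousAt).const_add a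
    exact ((innerSL ℝ p).hasFDerivAt.comp_hasDerivAt t h1)
  have hd : ∀ t : ℝ, HasDerivAt (fun t : ℝ => inner ℝ p (translate (t • v) a) -
      inner ℝ p (a + ∫ s in (0 : ℝ)..t, translate (s • v) b)) 0 t := fun t => by
    simpa only [sub_self] using! (hder1 t).sub (hder2 t)
  have hconst := is_const_of_deriv_eq_zero (fun t => (hd t).differentiableAt)
    (fun t => (hd t).deriv) t 0
  simp only [zero_smul, translate_zero, intervalIntegral.integral_same, add_zero, sub_self] at hconst
  linarith

/-- A weak derivative in L² is thus a strong derivative of the orbit of a under translations, and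
the product rule becomes calculus in a Hilbert space. -/
lemma hasDerivAt_translate
    (h : ∀ φ : E n → ℝ, ContDiff ℝ ∞ φ → HasCompactSupport φ →
      ∫ y, a y * fderiv ℝ φ y v = -∫ y, b y * φ y) :
    HasDerivAt (fun t : ℝ => translate (t • v) a) b 0 := by
  have hcB := continuous_translate v b
  have h1 : HasDerivAt (fun t : ℝ => a + ∫ s in (0 : ℝ)..t, translate (s • v) b)
      (translate ((0 : ℝ) • v) b) 0 :=
    (intervalIntegral.integral_hasDerivAt_right (hcB.intervalIntegrable _ _)
      (hcB.stronglyMeasurableAtFilter _ _) hcB.continuousAt).const_add a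
  rw [zero_smul, translate_zero] at h1
  exact h1.congr_of_eventuallyEq (Eventually.of_forall (translate_eq_integral h))

/-- The integral of a(y + tv)² f(y) is differentiated at t = 0 in two ways: as an inner product of
two differentiable curves in L², and, after a substitution, with the translation acting on f. -/
lemma integral_sq_mul_fderiv_Lp
    (h : ∀ φ : E n → ℝ, ContDiff ℝ ∞ φ → HasCompactSupport φ →
      ∫ y, a y * fderiv ℝ φ y v = -∫ y, b y * φ y)
    {f : E n → ℝ} (hf : ContDiff ℝ 1 f) (hc : HasCompactSupport f) :
    -- Multiplication by f is the bounded operator `M` below, so it preserves differentiability of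
    -- curves in L².
    ∫ y, a y ^ 2 * fderiv ℝ f y v = -∫ y, 2 * (a y * b y * f y) := by
  have hfm : MemLp f ⊤ (volume : Measure (E n)) := hf.continuous.memLp_top_of_hasCompactSupport hc _
  let M := (ContinuousLinearMap.mul ℝ ℝ).holderL (volume : Measure (E n)) ⊤ 2 2 hfm.toLp
  have hM : ∀ q : Lp ℝ 2 (volume : Measure (E n)), M q =ᵐ[volume] fun y => f y * q y := by
    intro q
    filter_upwards [(ContinuousLinearMap.mul ℝ ℝ).coeFn_holder (r := 2) hfm.toLp q,
      hfm.coeFn_toLp] with y h1 h2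
    simp only [M, ContinuousLinearMap.holderL_apply_apply]
    rw [h1, h2]; rfl
  have hA := hasDerivAt_translate h
  have hr : HasDerivAt (fun t : ℝ => inner ℝ (translate (t • v) a) (M (translate (t • v) a)))
      (inner ℝ a (M b) + inner ℝ b (M a)) 0 := by
    have := hA.inner ℝ (M.hasFDerivAt.comp_hasDerivAt (0 : ℝ) hA)
    simpa [translate_zero] using this
  have hsq : LocallyIntegrable (fun y => a y ^ 2) :=
    ((Lp.memLp a).integrable_sq).locallyIntegrable
  have hr2 := hasDerivAt_integral_translate hsq hf hc v 0
  have heq : (fun t : ℝ => inner ℝ (translate (t • v) a) (M (translate (t • v) a))) =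
      fun t : ℝ => ∫ y, a y ^ 2 * f (y - t • v) := by
    funext t
    rw [L2.inner_def, ← integral_add_right_eq_self (fun y => a y ^ 2 * f (y - t • v)) (t • v)]
    refine integral_congr_ae ?_
    filter_upwards [hM (translate (t • v) a), translate_ae (t • v) a] with y h1 h2
    simp [h1, h2]
    ring
  rw [heq] at hr
  have := hr.unique hr2
  simp only [zero_smul, sub_zero] at this
  rw [eq_comm, neg_eq_iff_eq_neg] at this
  rw [this, ← integral_neg, L2.inner_def, L2.inner_def, ← integral_add, ← integral_neg]
  · refine integral_congr_ae ?_
    filter_upwards [hM a, hM b] with y h1 h2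
    simp [h1, h2]
    ring
  · exact L2.integrable_inner _ _
  · exact L2.integrable_inner _ _

/-- The product rule `∂_v (u²) = 2 u ∂_v u` for weak derivatives in `L²_loc`, tested against `C¹`
functions with compact support. -/
theorem integral_sq_mul_fderiv {U : Set (E n)} (hU : IsOpen U) {a b : E n → ℝ} {v : E n}
    (ha : ∀ K ⊆ U, IsCompact K → MemLp a 2 (volume.restrict K))
    (hb : ∀ K ⊆ U, IsCompact K → MemLp b 2 (volume.restrict K))
    (h : ∀ φ : E n → ℝ, ContDiff ℝ ∞ φ → HasCompactSupport φ → tsupport φ ⊆ U →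
      ∫ y, a y * fderiv ℝ φ y v = -∫ y, b y * φ y)
    {f : E n → ℝ} (hf : ContDiff ℝ 1 f) (hc : HasCompactSupport f) (hfU : tsupport f ⊆ U) :
    ∫ y, a y ^ 2 * fderiv ℝ f y v = -∫ y, 2 * (a y * b y * f y) := by
  -- The cutoff χ equals 1 on K, whose interior contains the support of f, and is supported in K' ⊆
  -- U. Then χa lies in L²(ℝⁿ), and replacing a by χa changes nothing where f lives.
  obtain ⟨K, hK, hfK, hKU⟩ := exists_compact_between hc hU hfU
  obtain ⟨K', hK', hKK', hK'U⟩ := exists_compact_between hK hU hKU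
  obtain ⟨χ, hχ, -, hχs, hχ1⟩ := exists_contMDiff_support_eq_eq_one_iff 𝓘(ℝ, E n)
    (n := ⊤) (isOpen_interior (s := K')) hK.isClosed hKK'
  replace hχ : ContDiff ℝ ∞ χ := hχ.contDiff
  have hts : tsupport χ ⊆ K' := by
    rw [tsupport, hχs]
    exact closure_minimal interior_subset hK'.isClosed
  have hχc : HasCompactSupport χ := hK'.of_isClosed_subset (isClosed_tsupport χ) hts
  have hχd : Continuous fun y => fderiv ℝ χ y v :=
    (hχ.continuous_fderiv (by simp)).clm_apply continuous_const
  have hind : ∀ p : E n → ℝ, MemLp p 2 (volume.restrict K') → ∀ χ : E n → ℝ, Continuous χ →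
      HasCompactSupport χ → tsupport χ ⊆ K' → MemLp (fun y => χ y * p y) 2 volume := by
    intro p hp χ hχ hχc hχK
    have h1 : MemLp (K'.indicator p) 2 volume := (memLp_indicator_iff_restrict hK'.measurableSet).2 hp
    have h2 := MemLp.mul (r := 2) h1 (hχ.memLp_top_of_hasCompactSupport hχc volume)
    refine h2.congr_norm (by
      have := h2.aestronglyMeasurable
      refine this.congr (Eventually.of_forall fun y => ?_)
      by_cases hy : y ∈ K'
      · simp [hy]
      · simp [hy, image_eq_zero_of_notMem_tsupport fun h => hy (hχK h)])
      (Eventually.of_forall fun y => ?_)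
    by_cases hy : y ∈ K'
    · simp [hy]
    · simp [hy, image_eq_zero_of_notMem_tsupport fun h => hy (hχK h)]
  have hint : ∀ p : E n → ℝ, MemLp p 2 (volume.restrict K') → ∀ χ : E n → ℝ, Continuous χ →
      tsupport χ ⊆ K' → Integrable fun y => p y * χ y := by
    intro p hp χ hχ hχK
    have hχc : HasCompactSupport χ := hK'.of_isClosed_subset (isClosed_tsupport χ) hχK
    have h1 : IntegrableOn p K' := by
      have : IsFiniteMeasure (volume.restrict K') := ⟨by simpa using hK'.measure_lt_top⟩
      exact hp.integrable (by norm_num)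
    obtain ⟨C, hC⟩ := hχc.exists_bound_of_continuous hχ
    have h2 : IntegrableOn (fun y => p y * χ y) K' :=
      Integrable.mul_bdd (c := C) h1 hχ.aestronglyMeasurable (Eventually.of_forall hC)
    refine (integrableOn_iff_integrable_of_support_subset fun y hy => ?_).1 h2
    by_contra hyK
    exact hy (by simp [image_eq_zero_of_notMem_tsupport fun h => hyK (hχK h)])
  have ha' := ha K' hK'U hK'
  have hb' := hb K' hK'U hK'
  have hdχs : tsupport (fun y => fderiv ℝ χ y v) ⊆ K' := (tsupport_fderiv_apply_subset ℝ v).trans hts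
  have hA := hind a ha' χ hχ.continuous hχc hts
  -- The weak derivative of χa is χb + a ∂_vχ, and on the support of f this is b.
  have hB := (hind b hb' χ hχ.continuous hχc hts).add
    (hind a ha' _ hχd (hχc.fderiv_apply ℝ v) hdχs)
  have key := integral_sq_mul_fderiv_Lp (a := hA.toLp) (b := hB.toLp) (v := v) ?_ hf hc
  · have hone : ∀ y ∈ tsupport f, χ y = 1 ∧ fderiv ℝ χ y v = 0 := by
      intro y hy
      refine ⟨(hχ1 y).1 (interior_subset (hfK hy)), ?_⟩
      have : χ =ᶠ[𝓝 y] fun _ => 1 := by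
        filter_upwards [isOpen_interior.mem_nhds (hfK hy)] with z hz
        exact (hχ1 z).1 (interior_subset hz)
      rw [this.fderiv_eq]
      simp
    have e1 : ∫ y, a y ^ 2 * fderiv ℝ f y v = ∫ y, (hA.toLp : E n → ℝ) y ^ 2 * fderiv ℝ f y v := by
      refine integral_congr_ae ?_
      filter_upwards [hA.coeFn_toLp] with y hy
      rw [hy]
      by_cases hyf : y ∈ tsupport f
      · simp [(hone y hyf).1]
      · have : y ∉ tsupport fun y => fderiv ℝ f y v := fun h =>
          hyf (tsupport_fderiv_apply_subset ℝ v h)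
        have := image_eq_zero_of_notMem_tsupport this
        simp [this]
    rw [e1, key]
    congr 1
    refine integral_congr_ae ?_
    filter_upwards [hA.coeFn_toLp, hB.coeFn_toLp] with y hy hy2
    rw [hy, hy2]
    by_cases hyf : y ∈ tsupport f
    · simp [(hone y hyf).1, (hone y hyf).2]
    · simp [image_eq_zero_of_notMem_tsupport hyf]
  · intro φ hφ hφc
    have hφd : Continuous fun y => fderiv ℝ φ y v :=
      (hφ.continuous_fderiv (by simp)).clm_apply continuous_const
    have hder : ∀ y, fderiv ℝ (fun y => χ y * φ y) y v =
        χ y * fderiv ℝ φ y v + φ y * fderiv ℝ χ y v := by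
      intro y
      rw [fderiv_fun_mul (hχ.differentiable (by simp) y) (hφ.differentiable (by simp) y)]
      simp
    have hw := h (fun y => χ y * φ y) (hχ.mul hφ) hχc.mul_right
      ((tsupport_mul_subset_left).trans (hts.trans hK'U))
    simp only [hder] at hw
    have i1 : Integrable fun y => a y * (χ y * fderiv ℝ φ y v) :=
      hint a ha' _ (hχ.continuous.mul hφd) (tsupport_mul_subset_left.trans hts)
    have i2 : Integrable fun y => a y * (φ y * fderiv ℝ χ y v) :=
      hint a ha' _ (hφ.continuous.mul hχd) (tsupport_mul_subset_right.trans hdχs)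
    have i3 : Integrable fun y => b y * (χ y * φ y) :=
      hint b hb' _ (hχ.continuous.mul hφ.continuous) (tsupport_mul_subset_left.trans hts)
    simp only [mul_add] at hw
    rw [integral_add i1 i2] at hw
    have e1 : ∫ y, (hA.toLp : E n → ℝ) y * fderiv ℝ φ y v = ∫ y, a y * (χ y * fderiv ℝ φ y v) := by
      refine integral_congr_ae ?_
      filter_upwards [hA.coeFn_toLp] with y hy
      rw [hy]; ring
    have e2 : ∫ y, (hB.toLp : E n → ℝ) y * φ y =
        ∫ y, (b y * (χ y * φ y) + a y * (φ y * fderiv ℝ χ y v)) := by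
      refine integral_congr_ae ?_
      filter_upwards [hB.coeFn_toLp] with y hy
      rw [hy]; simp; ring
    rw [e1, e2, integral_add i3 i2]
    linarith

end Sobolev

/-! ### Christoffel symbols and Ricci curvature as multilinear maps. -/

section Curvature

variable {n : ℕ}

lemma contDiffWithinAt_det {k : ℕ∞ω} {m : Type*} [Fintype m] [DecidableEq m]
    {M : E n → Matrix m m ℝ} {s : Set (E n)} {y : E n}
    (h : ∀ i j, ContDiffWithinAt ℝ k (fun z => M z i j) s y) :
    ContDiffWithinAt ℝ k (fun z => (M z).det) s y := by
  simp only [Matrix.det_apply']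
  exact ContDiffWithinAt.sum fun σ _ => contDiffWithinAt_const.mul
    (contDiffWithinAt_prod fun i _ => h _ _)

lemma contDiffWithinAt_inv {k : ℕ∞ω} {m : Type*} [Fintype m] [DecidableEq m]
    {M : E n → Matrix m m ℝ} {s : Set (E n)} {y : E n}
    (h : ∀ i j, ContDiffWithinAt ℝ k (fun z => M z i j) s y) (hy : (M y).det ≠ 0) (i j : m) :
    ContDiffWithinAt ℝ k (fun z => (M z)⁻¹ i j) s y := by
  simp only [Matrix.inv_def, Ring.inverse_eq_inv', Matrix.smul_apply, smul_eq_mul]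
  refine ((contDiffWithinAt_det h).inv hy).mul ?_
  simp only [Matrix.adjugate_apply]
  refine contDiffWithinAt_det fun p q => ?_
  by_cases hp : p = j
  · subst hp
    simp only [Matrix.updateRow_self]
    exact contDiffWithinAt_const
  · simp only [Matrix.updateRow_ne hp]
    exact h p q

lemma contDiffWithinAt_gram {k : ℕ∞ω} {B : E n → E n →L[ℝ] E n →L[ℝ] ℝ} {s : Set (E n)} {y : E n}
    (h : ContDiffWithinAt ℝ k B s y) (i j : Fin n) :
    ContDiffWithinAt ℝ k (fun z => gram (B z) i j) s y := by
  simp only [gram, Matrix.of_apply]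
  exact (h.clm_apply contDiffWithinAt_const).clm_apply contDiffWithinAt_const

variable {B : E n → E n →L[ℝ] E n →L[ℝ] ℝ} {y : E n}

/-- The lowered Christoffel symbols, in the form of Koszul's formula. -/
def koszul (D : E n →L[ℝ] E n →L[ℝ] E n →L[ℝ] ℝ) (u v w : E n) : ℝ :=
  (1 / 2 : ℝ) * (D u v w + D v u w - D w u v)

/-- The Christoffel symbols as a field of bilinear maps. -/
def chr (B : E n → E n →L[ℝ] E n →L[ℝ] ℝ) (y : E n) : E n →L[ℝ] E n →L[ℝ] E n :=
  ∑ k, ∑ i, ∑ j, christoffel (fun z => gram (B z)) k i j y •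
    (EuclideanSpace.proj i : E n →L[ℝ] ℝ).smulRight
      ((EuclideanSpace.proj j : E n →L[ℝ] ℝ).smulRight (stdVec k : E n))

lemma chr_stdVec (i j k : Fin n) :
    chr B y (stdVec i) (stdVec j) k = christoffel (fun z => gram (B z)) k i j y := by
  simp [chr, _root_.sum_apply, stdVec_apply]

lemma pderiv_gram (h : DifferentiableAt ℝ B y) (i j l : Fin n) :
    pderiv i (fun z => gram (B z) j l) y = fderiv ℝ B y (stdVec i) (stdVec j) (stdVec l) := by
  have h1 := (h.hasFDerivAt.clm_apply (hasFDerivAt_const (stdVec j : E n) y)).clm_apply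
    (hasFDerivAt_const (stdVec l : E n) y)
  simp only [pderiv, gram, Matrix.of_apply]
  rw [h1.fderiv]
  simp

lemma christoffel_gram (h : DifferentiableAt ℝ B y) (i j k : Fin n) :
    christoffel (fun z => gram (B z)) k i j y =
      ∑ l, (gram (B y))⁻¹ k l * koszul (fderiv ℝ B y) (stdVec i) (stdVec j) (stdVec l) := by
  simp only [christoffel, pderiv_gram h, koszul, Finset.mul_sum]
  refine Finset.sum_congr rfl fun l _ => by ring

lemma ext_stdVec {F : Type*} [AddCommGroup F] [Module ℝ F] {f g : E n →ₗ[ℝ] F}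
    (h : ∀ i, f (stdVec i) = g (stdVec i)) : f = g := by
  refine (EuclideanSpace.basisFun (Fin n) ℝ).toBasis.ext fun i => ?_
  simpa [stdVec] using h i

/-- Koszul's formula characterises the Christoffel map without reference to a basis, which is what
makes its transformation law accessible. -/
lemma apply_chr (h : DifferentiableAt ℝ B y) (hB : IsInner (B y)) (u v w : E n) :
    B y (chr B y u v) w = koszul (fderiv ℝ B y) u v w := by
  let D := fderiv ℝ B y
  let f : E n →ₗ[ℝ] E n →ₗ[ℝ] ℝ := LinearMap.mk₂ ℝ (fun u v => B y (chr B y u v) w)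
    (by simp) (by simp) (by simp) (by simp)
  let g : E n →ₗ[ℝ] E n →ₗ[ℝ] ℝ := LinearMap.mk₂ ℝ (fun u v => koszul D u v w)
    (by intros; simp [koszul]; ring) (by intros; simp [koszul]; ring)
    (by intros; simp [koszul]; ring) (by intros; simp [koszul]; ring)
  suffices f = g from LinearMap.congr_fun₂ this u v
  refine ext_stdVec fun i => ext_stdVec fun j => ?_
  let θ : E n →L[ℝ] ℝ := LinearMap.toContinuousLinearMap
    { toFun := fun w => koszul D (stdVec i) (stdVec j) w
      map_add' := by intros; simp [koszul]; ring
      map_smul' := by intros; simp [koszul]; ring }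
  have : chr B y (stdVec i) (stdVec j) = sharp (B y) θ := by
    ext k
    rw [chr_stdVec, christoffel_gram h]
    simp [sharp, stdVec_apply, θ, D]
  change B y (chr B y (stdVec i) (stdVec j)) w = θ w
  rw [this, hB.symm, hB.apply_sharp]

lemma contDiffAt_chr (h : ContDiffAt ℝ 2 B y) (hB : IsInner (B y)) : ContDiffAt ℝ 1 (chr B) y := by
  have hd : ∀ᶠ z in 𝓝 y, DifferentiableAt ℝ B z :=
    (h.eventually (by simp)).mono fun z hz => hz.differentiableAt (by simp)
  have hD : ContDiffAt ℝ 1 (fderiv ℝ B) y := h.fderiv_right (by norm_num)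
  refine ContDiffAt.sum fun k _ => ContDiffAt.sum fun i _ => ContDiffAt.sum fun j _ =>
    ContDiffAt.fun_smul ?_ contDiffAt_const
  have : (fun z => christoffel (fun z => gram (B z)) k i j z) =ᶠ[𝓝 y] fun z =>
      ∑ l, (gram (B z))⁻¹ k l * koszul (fderiv ℝ B z) (stdVec i) (stdVec j) (stdVec l) := by
    filter_upwards [hd] with z hz
    exact christoffel_gram hz i j k
  refine ContDiffAt.congr_of_eventuallyEq (ContDiffAt.sum fun l _ => ContDiffAt.mul ?_ ?_) this
  · rw [← contDiffWithinAt_univ]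
    exact contDiffWithinAt_inv (fun i j => contDiffWithinAt_gram (h.of_le (by norm_num)) i j)
      hB.isUnit_det.ne_zero k l
  · simp only [koszul]
    fun_prop

/-- The curvature as a trilinear vector-valued expression in the Christoffel symbols. -/
def curv (Γ : E n →L[ℝ] E n →L[ℝ] E n) (D : E n →L[ℝ] E n →L[ℝ] E n →L[ℝ] E n) (u v w : E n) :
    E n :=
  D u v w - D w u v + Γ u (Γ v w) - Γ w (Γ u v)

/-- The Ricci form of a field of inner products. -/
def ric (Γ : E n →L[ℝ] E n →L[ℝ] E n) (D : E n →L[ℝ] E n →L[ℝ] E n →L[ℝ] E n) :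
    E n →ₗ[ℝ] E n →ₗ[ℝ] ℝ :=
  LinearMap.mk₂ ℝ (fun v w => ∑ i, curv Γ D (stdVec i) v w i)
    (by intros; rw [← Finset.sum_add_distrib]; refine Finset.sum_congr rfl fun i _ => ?_
        simp [curv]; ring)
    (by intros; rw [smul_eq_mul, Finset.mul_sum]; refine Finset.sum_congr rfl fun i _ => ?_
        simp [curv]; ring)
    (by intros; rw [← Finset.sum_add_distrib]; refine Finset.sum_congr rfl fun i _ => ?_
        simp [curv]; ring)
    (by intros; rw [smul_eq_mul, Finset.mul_sum]; refine Finset.sum_congr rfl fun i _ => ?_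
        simp [curv]; ring)

lemma ricci_gram (h : ContDiffAt ℝ 2 B y) (hB : IsInner (B y)) (j k : Fin n) :
    ricci (fun z => gram (B z)) j k y = ric (chr B y) (fderiv ℝ (chr B) y) (stdVec j) (stdVec k) := by
  have hd := (contDiffAt_chr h hB).differentiableAt one_ne_zero
  have hp : ∀ i j k l, pderiv i (christoffel (fun z => gram (B z)) k j l) y =
      fderiv ℝ (chr B) y (stdVec i) (stdVec j) (stdVec l) k := by
    intro i j k l
    have h1 := (EuclideanSpace.proj k : E n →L[ℝ] ℝ).hasFDerivAt.comp y
      ((hd.hasFDerivAt.clm_apply (hasFDerivAt_const (stdVec j : E n) y)).clm_apply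
      (hasFDerivAt_const (stdVec l : E n) y))
    have h2 : christoffel (fun z => gram (B z)) k j l = (EuclideanSpace.proj k : E n →L[ℝ] ℝ) ∘
        fun z => chr B z (stdVec j) (stdVec l) := by
      funext z
      simp [chr_stdVec]
    rw [pderiv, h2, h1.fderiv]
    simp
  have hc : ∀ i v k, chr B y (stdVec i) v k =
      ∑ l, christoffel (fun z => gram (B z)) k i l y * v l := by
    intro i v k
    conv_lhs => rw [← sum_smul_stdVec v]
    simp [chr_stdVec, mul_comm]
  simp only [ricci, ric, LinearMap.mk₂_apply]
  refine Finset.sum_congr rfl fun i _ => ?_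
  simp only [curv, PiLp.add_apply, PiLp.sub_apply, hp, Finset.sum_sub_distrib]
  rw [hc i (chr B y _ _), hc k (chr B y _ _)]
  simp only [chr_stdVec]
  ring

lemma coordScal_gram (h : ContDiffAt ℝ 2 B y) (hB : IsInner (B y)) :
    coordScal (fun z => gram (B z)) y =
      contr (B y) (ric (chr B y) (fderiv ℝ (chr B) y)) := by
  simp only [coordScal, contr, ricci_gram h hB]

/-- The Ricci form is the trace of u ↦ curv(u, v, w). By hypothesis L intertwines the two
curvatures, so these endomorphisms are conjugate. -/
lemma ric_comp {Γ Γ' : E n →L[ℝ] E n →L[ℝ] E n} {D D' : E n →L[ℝ] E n →L[ℝ] E n →L[ℝ] E n}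
    {L : E n →L[ℝ] E n} (hL : L.det ≠ 0)
    (h : ∀ u v w, L (curv Γ' D' u v w) = curv Γ D (L u) (L v) (L w)) (v w : E n) :
    ric Γ' D' v w = ric Γ D (L v) (L w) := by
  have key : ∀ (Γ : E n →L[ℝ] E n →L[ℝ] E n) (D : E n →L[ℝ] E n →L[ℝ] E n →L[ℝ] E n) (v w : E n)
      (T : E n →L[ℝ] E n), (∀ u, T u = curv Γ D u v w) → ric Γ D v w = (mat T).trace := by
    intro Γ D v w T hT
    simp [ric, Matrix.trace, mat_apply, hT]
  let mk : (E n →L[ℝ] E n →L[ℝ] E n) → (E n →L[ℝ] E n →L[ℝ] E n →L[ℝ] E n) → E n → E n →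
      E n →L[ℝ] E n := fun Γ D v w => LinearMap.toContinuousLinearMap
    { toFun := fun u => curv Γ D u v w
      map_add' := by intros; simp [curv]; abel
      map_smul' := by intros; simp [curv, smul_sub, smul_add] }
  rw [key Γ' D' v w (mk Γ' D' v w) fun u => rfl, key Γ D _ _ (mk Γ D (L v) (L w)) fun u => rfl]
  have hmul : ∀ S T : E n →L[ℝ] E n, mat (S.comp T) = mat S * mat T := fun S T => by
    simp [mat, ← LinearMap.toMatrix_comp]
  have hcomp : L.comp (mk Γ' D' v w) = (mk Γ D (L v) (L w)).comp L := by
    ext1 u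
    exact h u v w
  have hm := congrArg mat hcomp
  rw [hmul, hmul] at hm
  have hu : IsUnit (mat L).det := by rw [det_mat]; exact hL.isUnit
  have : mat (mk Γ' D' v w) = (mat L)⁻¹ * (mat (mk Γ D (L v) (L w)) * mat L) := by
    rw [← hm, ← Matrix.mul_assoc, Matrix.nonsing_inv_mul _ hu, Matrix.one_mul]
  rw [this, Matrix.trace_mul_comm, Matrix.mul_assoc, Matrix.mul_nonsing_inv _ hu, Matrix.mul_one]

end Curvature

/-! ### Independence of the scalar curvature from the coordinates. -/

section Invariance

variable {n : ℕ} {B B' : E n → E n →L[ℝ] E n →L[ℝ] ℝ} {ψ : E n → E n} {x : E n}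

lemma surjective_of_det_ne_zero {L : E n →L[ℝ] E n} (h : L.det ≠ 0) : Function.Surjective L := by
  have : IsUnit L.toLinearMap := LinearMap.isUnit_iff_isUnit_det _ |>.2 h.isUnit
  exact ((Module.End.isUnit_iff _).1 this).2

lemma injective_of_det_ne_zero {L : E n →L[ℝ] E n} (h : L.det ≠ 0) : Function.Injective L := by
  have : IsUnit L.toLinearMap := LinearMap.isUnit_iff_isUnit_det _ |>.2 h.isUnit
  exact ((Module.End.isUnit_iff _).1 this).1

lemma IsInner.eq_of_forall {b : E n →L[ℝ] E n →L[ℝ] ℝ} (hb : IsInner b) {p q : E n}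
    (h : ∀ w, b p w = b q w) : p = q := by
  by_contra hne
  have := hb.pos (p - q) (sub_ne_zero.2 hne)
  simp only [map_sub, _root_.sub_apply, h] at this
  simp at this

lemma fderiv_symm_form (hB : DifferentiableAt ℝ B x) (hs : ∀ᶠ z in 𝓝 x, ∀ v w, B z v w = B z w v)
    (u v w : E n) : fderiv ℝ B x u v w = fderiv ℝ B x u w v := by
  have h := fun v w : E n => (hB.hasFDerivAt.clm_apply (hasFDerivAt_const v x)).clm_apply
    (hasFDerivAt_const w x)
  have heq : (fun z => B z v w) =ᶠ[𝓝 x] fun z => B z w v := hs.mono fun z hz => hz v w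
  have := heq.fderiv_eq (𝕜 := ℝ)
  rw [(h v w).fderiv, (h w v).fderiv] at this
  simpa using congrArg (fun L : E n →L[ℝ] ℝ => L u) this

/-- The transformation law of the Christoffel symbols. -/
lemma chr_transform (hB : DifferentiableAt ℝ B (ψ x)) (hBi : ∀ᶠ z in 𝓝 (ψ x), IsInner (B z))
    (hψ : ContDiffAt ℝ 2 ψ x) (hdet : (fderiv ℝ ψ x).det ≠ 0)
    (hB' : B' =ᶠ[𝓝 x] fun z => (B (ψ z)).bilinearComp (fderiv ℝ ψ z) (fderiv ℝ ψ z)) (u v : E n) :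
    fderiv ℝ ψ x (chr B' x u v) = chr B (ψ x) (fderiv ℝ ψ x u) (fderiv ℝ ψ x v) +
      fderiv ℝ (fderiv ℝ ψ) x u v := by
  have hψd : HasFDerivAt ψ (fderiv ℝ ψ x) x := (hψ.differentiableAt (by simp)).hasFDerivAt
  have hJ : DifferentiableAt ℝ (fderiv ℝ ψ) x :=
    (hψ.fderiv_right (m := 1) (by norm_num)).differentiableAt one_ne_zero
  have hsym : ∀ u v, fderiv ℝ (fderiv ℝ ψ) x u v = fderiv ℝ (fderiv ℝ ψ) x v u := fun u v =>
    (hψ.isSymmSndFDerivAt (by simp)).eq u v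
  have hbx := hBi.self_of_nhds
  have hsymB := fderiv_symm_form hB (hBi.mono fun z hz => hz.symm)
  have hcomp := hB.hasFDerivAt.comp x hψd
  have hdiff : DifferentiableAt ℝ B' x := by
    refine DifferentiableAt.congr_of_eventuallyEq ?_ hB'
    have h1 : DifferentiableAt ℝ (fun z => B (ψ z)) x := hcomp.differentiableAt
    have h2 : DifferentiableAt ℝ (fun z => (B (ψ z)).comp (fderiv ℝ ψ z)) x := h1.clm_comp hJ
    have h3 := ((ContinuousLinearMap.flipₗᵢ ℝ (E n) (E n) ℝ).toContinuousLinearEquiv :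
      (E n →L[ℝ] E n →L[ℝ] ℝ) ≃L[ℝ] (E n →L[ℝ] E n →L[ℝ] ℝ)).differentiableAt.comp x h2
    have h4 := ((ContinuousLinearMap.flipₗᵢ ℝ (E n) (E n) ℝ).toContinuousLinearEquiv :
      (E n →L[ℝ] E n →L[ℝ] ℝ) ≃L[ℝ] (E n →L[ℝ] E n →L[ℝ] ℝ)).differentiableAt.comp x
      (h3.clm_comp hJ)
    exact h4
  have hder : ∀ u v w, fderiv ℝ B' x u v w =
      fderiv ℝ B (ψ x) (fderiv ℝ ψ x u) (fderiv ℝ ψ x v) (fderiv ℝ ψ x w) +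
      B (ψ x) (fderiv ℝ (fderiv ℝ ψ) x u v) (fderiv ℝ ψ x w) +
      B (ψ x) (fderiv ℝ ψ x v) (fderiv ℝ (fderiv ℝ ψ) x u w) := by
    intro u v w
    have h1 := ((hdiff.hasFDerivAt.clm_apply (hasFDerivAt_const v x)).clm_apply
      (hasFDerivAt_const w x)).fderiv
    have h2 := ((hcomp.clm_apply (hJ.hasFDerivAt.clm_apply (hasFDerivAt_const v x))).clm_apply
      (hJ.hasFDerivAt.clm_apply (hasFDerivAt_const w x))).fderiv
    have heq : (fun z => B' z v w) =ᶠ[𝓝 x]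
        fun z => B (ψ z) (fderiv ℝ ψ z v) (fderiv ℝ ψ z w) :=
      hB'.mono fun z hz => by simp only [hz]; rfl
    have h3 := heq.fderiv_eq (𝕜 := ℝ)
    rw [h1] at h3
    rw [show (fun z => B (ψ z) (fderiv ℝ ψ z v) (fderiv ℝ ψ z w)) = fun z =>
      ((B ∘ ψ) z) (fderiv ℝ ψ z v) (fderiv ℝ ψ z w) from rfl, h2] at h3
    have h4 := congrArg (fun L : E n →L[ℝ] ℝ => L u) h3
    simp at h4
    rw [h4]; ring
  have hB'x := hB'.self_of_nhds
  have hB'i : IsInner (B' x) := by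
    rw [hB'x]
    exact hbx.comp (injective_of_det_ne_zero hdet)
  -- By nondegeneracy it suffices to pair with vectors in the image of dψ, where Koszul's formula
  -- applies on both sides. Of the six second-derivative terms in the Koszul combination, four
  -- cancel by symmetry of the Hessian and the other two combine into B(∂²ψ(u, v), dψ w).
  refine hbx.eq_of_forall fun w => ?_
  obtain ⟨w, rfl⟩ := surjective_of_det_ne_zero hdet w
  have h1 : B (ψ x) (fderiv ℝ ψ x (chr B' x u v)) (fderiv ℝ ψ x w) = B' x (chr B' x u v) w := by
    rw [hB'x]; rfl
  rw [h1, apply_chr hdiff hB'i, map_add, _root_.add_apply, apply_chr hB hbx]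
  simp only [koszul, hder]
  rw [hsym v u, hsym w u, hsym w v, hbx.symm (fderiv ℝ ψ x v) (fderiv ℝ (fderiv ℝ ψ) x u w),
    hbx.symm (fderiv ℝ ψ x u)]
  ring

lemma chr_symm (hB : DifferentiableAt ℝ B x) (hBi : ∀ᶠ z in 𝓝 x, IsInner (B z)) (u v : E n) :
    chr B x u v = chr B x v u := by
  have hbx := hBi.self_of_nhds
  have hsymB := fderiv_symm_form hB (hBi.mono fun z hz => hz.symm)
  refine hbx.eq_of_forall fun w => ?_
  rw [apply_chr hB hbx, apply_chr hB hbx, koszul, koszul, hsymB w u v]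
  ring

/-- The transformation law of the curvature. -/
lemma curv_transform (hB : ContDiffAt ℝ 2 B (ψ x)) (hBi : ∀ᶠ z in 𝓝 (ψ x), IsInner (B z))
    (hψ : ContDiffAt ℝ 3 ψ x) (hdet : (fderiv ℝ ψ x).det ≠ 0)
    (hB' : B' =ᶠ[𝓝 x] fun z => (B (ψ z)).bilinearComp (fderiv ℝ ψ z) (fderiv ℝ ψ z))
    (hB'd : ContDiffAt ℝ 2 B' x) (hB'i : IsInner (B' x)) (u v w : E n) :
    fderiv ℝ ψ x (curv (chr B' x) (fderiv ℝ (chr B') x) u v w) =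
      curv (chr B (ψ x)) (fderiv ℝ (chr B) (ψ x)) (fderiv ℝ ψ x u) (fderiv ℝ ψ x v)
        (fderiv ℝ ψ x w) := by
  have hψd : HasFDerivAt ψ (fderiv ℝ ψ x) x := (hψ.differentiableAt (by simp)).hasFDerivAt
  have hJc : ContDiffAt ℝ 2 (fderiv ℝ ψ) x := hψ.fderiv_right (m := 2) (by norm_num)
  have hJ : DifferentiableAt ℝ (fderiv ℝ ψ) x := hJc.differentiableAt (by simp)
  have hH : DifferentiableAt ℝ (fderiv ℝ (fderiv ℝ ψ)) x :=
    (hJc.fderiv_right (m := 1) (by norm_num)).differentiableAt one_ne_zero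
  have hdet' : ∀ᶠ z in 𝓝 x, (fderiv ℝ ψ z).det ≠ 0 :=
    (ContinuousLinearMap.continuous_det.continuousAt.comp hJ.continuousAt).eventually_ne hdet
  -- The transformation law is needed on a neighbourhood because it is differentiated next.
  have hlaw : ∀ᶠ z in 𝓝 x, ∀ u v, fderiv ℝ ψ z (chr B' z u v) =
      chr B (ψ z) (fderiv ℝ ψ z u) (fderiv ℝ ψ z v) + fderiv ℝ (fderiv ℝ ψ) z u v := by
    filter_upwards [hdet', hψ.continuousAt.eventually (hB.eventually (by simp)),
      hψ.continuousAt.eventually hBi.eventually_nhds, hψ.eventually (by simp),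
      hB'.eventually_nhds] with z h1 h2 h3 h4 h5
    exact chr_transform (h2.differentiableAt (by simp)) h3 (h4.of_le (by norm_num)) h1 h5
  have hsym : ∀ u v, fderiv ℝ (fderiv ℝ ψ) x u v = fderiv ℝ (fderiv ℝ ψ) x v u := fun u v =>
    ((hψ.of_le (by norm_num)).isSymmSndFDerivAt (n := 2) (by simp)).eq u v
  have hsym3 : ∀ u v w, fderiv ℝ (fderiv ℝ (fderiv ℝ ψ)) x u v w =
      fderiv ℝ (fderiv ℝ (fderiv ℝ ψ)) x w u v := by
    have hs1 : ∀ u v w, fderiv ℝ (fderiv ℝ (fderiv ℝ ψ)) x u v w =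
        fderiv ℝ (fderiv ℝ (fderiv ℝ ψ)) x v u w := fun u v w =>
      congrArg (fun L : E n →L[ℝ] E n => L w) ((hJc.isSymmSndFDerivAt (by simp)).eq u v)
    have hs2 : ∀ u v w, fderiv ℝ (fderiv ℝ (fderiv ℝ ψ)) x u v w =
        fderiv ℝ (fderiv ℝ (fderiv ℝ ψ)) x u w v := by
      intro u v w
      have h := fun v w : E n => (hH.hasFDerivAt.clm_apply (hasFDerivAt_const v x)).clm_apply
        (hasFDerivAt_const w x)
      have heq : (fun z => fderiv ℝ (fderiv ℝ ψ) z v w) =ᶠ[𝓝 x]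
          fun z => fderiv ℝ (fderiv ℝ ψ) z w v := by
        filter_upwards [hψ.eventually (by simp)] with z hz
        exact ((hz.of_le (by norm_num)).isSymmSndFDerivAt (n := 2) (by simp)).eq v w
      have := heq.fderiv_eq (𝕜 := ℝ)
      rw [(h v w).fderiv, (h w v).fderiv] at this
      simpa using congrArg (fun L : E n →L[ℝ] E n => L u) this
    intro u v w
    rw [hs2, hs1]
  have hΓ := (contDiffAt_chr hB hBi.self_of_nhds).differentiableAt one_ne_zero
  have hΓ' := (contDiffAt_chr hB'd hB'i).differentiableAt one_ne_zero
  have hder : ∀ u v w, fderiv ℝ ψ x (fderiv ℝ (chr B') x u v w) =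
      fderiv ℝ (chr B) (ψ x) (fderiv ℝ ψ x u) (fderiv ℝ ψ x v) (fderiv ℝ ψ x w) +
      chr B (ψ x) (fderiv ℝ (fderiv ℝ ψ) x u v) (fderiv ℝ ψ x w) +
      chr B (ψ x) (fderiv ℝ ψ x v) (fderiv ℝ (fderiv ℝ ψ) x u w) +
      fderiv ℝ (fderiv ℝ (fderiv ℝ ψ)) x u v w -
      fderiv ℝ (fderiv ℝ ψ) x u (chr B' x v w) := by
    intro u v w
    have h1 := hJ.hasFDerivAt.clm_apply
      ((hΓ'.hasFDerivAt.clm_apply (hasFDerivAt_const v x)).clm_apply (hasFDerivAt_const w x))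
    have h2 := (((hΓ.hasFDerivAt.comp x hψd).clm_apply
      (hJ.hasFDerivAt.clm_apply (hasFDerivAt_const v x))).clm_apply
      (hJ.hasFDerivAt.clm_apply (hasFDerivAt_const w x))).add
      ((hH.hasFDerivAt.clm_apply (hasFDerivAt_const v x)).clm_apply (hasFDerivAt_const w x))
    have heq : (fun z => fderiv ℝ ψ z (chr B' z v w)) =ᶠ[𝓝 x]
        (fun z => ((chr B ∘ ψ) z) (fderiv ℝ ψ z v) (fderiv ℝ ψ z w)) +
          fun z => fderiv ℝ (fderiv ℝ ψ) z v w := hlaw.mono fun z hz => hz v w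
    have h3 := heq.fderiv_eq (𝕜 := ℝ)
    rw [h1.fderiv, h2.fderiv] at h3
    have h4 := congrArg (fun L : E n →L[ℝ] E n => L u) h3
    simp at h4
    rw [eq_sub_iff_add_eq, h4]
    abel
  have hlawx := hlaw.self_of_nhds
  have hs := chr_symm (hB.differentiableAt (by simp)) hBi
  -- The third derivatives of ψ cancel between the two derivative terms of the curvature, being
  -- totally symmetric. The Hessian terms cancel by symmetry of the Hessian and of the Christoffel
  -- map.
  simp only [curv, map_add, map_sub, hder, hlawx]
  rw [hsym3 u v w, hsym w u, hsym w v, hs (fderiv ℝ ψ x w) (fderiv ℝ (fderiv ℝ ψ) x u v),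
    hs (fderiv ℝ ψ x v) (fderiv ℝ (fderiv ℝ ψ) x u w)]
  abel

/-- Scalar curvature does not depend on the coordinates. -/
theorem coordScal_transform (hB : ContDiffAt ℝ 2 B (ψ x)) (hBi : ∀ᶠ z in 𝓝 (ψ x), IsInner (B z))
    (hψ : ContDiffAt ℝ 3 ψ x) (hdet : (fderiv ℝ ψ x).det ≠ 0)
    (hB' : B' =ᶠ[𝓝 x] fun z => (B (ψ z)).bilinearComp (fderiv ℝ ψ z) (fderiv ℝ ψ z))
    (hB'd : ContDiffAt ℝ 2 B' x) :
    coordScal (fun z => gram (B' z)) x = coordScal (fun z => gram (B z)) (ψ x) := by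
  have hB'x := hB'.self_of_nhds
  have hbx := hBi.self_of_nhds
  have hB'i : IsInner (B' x) := by
    rw [hB'x]
    exact hbx.comp (injective_of_det_ne_zero hdet)
  rw [coordScal_gram hB'd hB'i, coordScal_gram hB hbx, hB'x]
  exact contr_comp _ _ _ _ hdet
    (ric_comp hdet (curv_transform hB hBi hψ hdet hB' hB'd hB'i))

end Invariance

/-! ### The scalar curvature of r⁻²G up to the set where r = 0. -/

section BoundaryCurvature

variable {n : ℕ}

/-- The algebraic part of the Ricci tensor of `ρ⁻² g`, for a metric `g` and a covector `p = dρ`. -/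
lemma ricci_model_eq {g gi : Matrix (Fin n) (Fin n) ℝ} (h : gi * g = 1) (hg : g.transpose = g)
    (p : Fin n → ℝ) (T : Fin n → Fin n → Fin n → ℝ)
    (hT : ∀ k i j, T k i j = ∑ l, gi k l * -(p i * g j l + p j * g i l - p l * g i j)) (j k : Fin n) :
    ∑ i, (-(p i * T i j k) + p k * T i i j + ∑ l, (T i i l * T l j k - T i k l * T l i j)) =
      (1 - n) * (∑ a, ∑ b, gi a b * p a * p b) * g j k := by
  set N : Fin n → ℝ := fun i => ∑ l, gi i l * p l with hN
  set q : ℝ := ∑ i, p i * N i with hq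
  have hgs : ∀ a b, g a b = g b a := fun a b => by
    conv_lhs => rw [← hg]
    rfl
  have hδ : ∀ k j, ∑ l, gi k l * g l j = if k = j then 1 else 0 := fun k j => by
    rw [← Matrix.mul_apply, h, Matrix.one_apply]
  have hgi : g * gi = 1 := mul_eq_one_comm.1 h
  have hNg : ∀ j, ∑ i, N i * g i j = p j := by
    intro j
    have hgit : gi.transpose = gi := by
      have h1 : gi.transpose * g = 1 := by
        have := congrArg Matrix.transpose hgi
        rwa [Matrix.transpose_mul, hg, Matrix.transpose_one] at this
      calc gi.transpose = gi.transpose * (g * gi) := by rw [hgi, Matrix.mul_one]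
        _ = gi := by rw [← Matrix.mul_assoc, h1, Matrix.one_mul]
    have hgis : ∀ a b, gi a b = gi b a := fun a b => by
      conv_lhs => rw [← hgit]
      rfl
    calc ∑ i, N i * g i j = ∑ i, ∑ l, p l * (gi l i * g i j) := by
          refine Finset.sum_congr rfl fun i _ => ?_
          rw [hN, Finset.sum_mul]
          exact Finset.sum_congr rfl fun l _ => by rw [hgis]; ring
      _ = ∑ l, p l * ∑ i, gi l i * g i j := by
          rw [Finset.sum_comm]
          exact Finset.sum_congr rfl fun l _ => by rw [Finset.mul_sum]
      _ = p j := by simp [hδ]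
  have hq' : ∑ a, ∑ b, gi a b * p a * p b = q := by
    rw [hq]
    refine Finset.sum_congr rfl fun a _ => ?_
    rw [hN, Finset.mul_sum]
    exact Finset.sum_congr rfl fun b _ => by ring
  -- With N the vector dual to p, T^k_{ij} = N^k g_{ij} - p_i δ^k_j - p_j δ^k_i, and every
  -- contraction below reduces to N·p = q, to g(N, ·) = p and to the trace n of δ.
  have hT' : ∀ k i j, T k i j = N k * g i j - p i * (if k = j then 1 else 0) -
      p j * (if k = i then 1 else 0) := by
    intro k i j
    rw [hT, ← hδ, ← hδ, hN, Finset.sum_mul, Finset.mul_sum, Finset.mul_sum, ← Finset.sum_sub_distrib,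
      ← Finset.sum_sub_distrib]
    refine Finset.sum_congr rfl fun l _ => ?_
    rw [hgs l j, hgs l i]; ring
  have h1 : ∀ j k, ∑ i, p i * T i j k = q * g j k - 2 * p j * p k := by
    intro j k
    simp only [hT', mul_sub, Finset.sum_sub_distrib, hq, Finset.sum_mul, mul_ite, mul_one, mul_zero,
      Finset.sum_ite_eq', Finset.mem_univ, if_true]
    rw [sub_sub]
    congr 1
    · exact Finset.sum_congr rfl fun i _ => by ring
    · ring
  have h2 : ∀ j, ∑ i, T i i j = -(n * p j) := by
    intro j
    simp only [hT', Finset.sum_sub_distrib, hNg, mul_ite, mul_one, mul_zero, if_true,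
      Finset.sum_ite_eq', Finset.mem_univ, Finset.sum_const, Finset.card_univ,
      Fintype.card_fin, nsmul_eq_mul]
    ring
  have h3 : ∑ i, ∑ l, T i i l * T l j k = -(n * (q * g j k - 2 * p j * p k)) := by
    rw [Finset.sum_comm]
    simp only [← Finset.sum_mul, h2]
    rw [← h1, Finset.mul_sum, ← Finset.sum_neg_distrib]
    exact Finset.sum_congr rfl fun i _ => by ring
  have h4 : ∑ i, ∑ l, T i k l * T l i j = (n + 2) * p j * p k - 2 * q * g j k := by
    have e1 : ∀ i, ∑ l, T i k l * T l i j =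
        N i * ∑ l, T l i j * g l k - p k * T i i j - (if i = k then 1 else 0) * ∑ l, p l * T l i j := by
      intro i
      calc ∑ l, T i k l * T l i j = ∑ l, (N i * (T l i j * g l k) -
            p k * (if i = l then T l i j else 0) - (if i = k then 1 else 0) * (p l * T l i j)) := by
            refine Finset.sum_congr rfl fun l _ => ?_
            rw [hT' i k l, hgs k l]
            split_ifs <;> ring
        _ = _ := by
            simp only [Finset.sum_sub_distrib, ← Finset.mul_sum, Finset.sum_ite_eq,
              Finset.mem_univ, if_true]
    have e2 : ∀ i, ∑ l, T l i j * g l k = p k * g i j - p i * g j k - p j * g i k := by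
      intro i
      calc ∑ l, T l i j * g l k = ∑ l, ((N l * g l k) * g i j - p i * (if l = j then g l k else 0) -
            p j * (if l = i then g l k else 0)) := by
            refine Finset.sum_congr rfl fun l _ => ?_
            rw [hT' l i j]
            split_ifs <;> ring
        _ = _ := by
            simp only [Finset.sum_sub_distrib, ← Finset.mul_sum, ← Finset.sum_mul, hNg,
              Finset.sum_ite_eq', Finset.mem_univ, if_true]
    calc ∑ i, ∑ l, T i k l * T l i j = ∑ i, (p k * (N i * g i j) - (p i * N i) * g j k -
          p j * (N i * g i k) - p k * T i i j -
          (if i = k then (q * g i j - 2 * p i * p j) else 0)) := by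
          refine Finset.sum_congr rfl fun i _ => ?_
          rw [e1, e2, h1]
          split_ifs <;> ring
      _ = p k * p j - q * g j k - p j * p k + p k * (n * p j) - (q * g k j - 2 * p k * p j) := by
          simp only [Finset.sum_sub_distrib, ← Finset.mul_sum, ← Finset.sum_mul, hNg, h2,
              Finset.sum_ite_eq', Finset.mem_univ, if_true, ← hq]
          ring
      _ = _ := by rw [hgs k j]; ring
  -- The coefficients of p_j p_k add up to 2 - n + 2n - (n + 2) = 0 and those of q g_{jk} to -1 - n
  -- + 2 = 1 - n.
  rw [hq']
  simp only [Finset.sum_add_distrib, Finset.sum_sub_distrib, Finset.sum_neg_distrib,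
    ← Finset.mul_sum, h1, h2, h3, h4]
  ring

variable {Ω : Set (E n)} {G B : E n → E n →L[ℝ] E n →L[ℝ] ℝ} {r : E n → ℝ}

variable (Ω G r) in
/-- The Christoffel symbols of `r⁻² G`, multiplied by `r`. -/
def christoffelT (k i j : Fin n) (y : E n) : ℝ :=
  ∑ l, (gram (G y))⁻¹ k l * (r y * koszul (fderivWithin ℝ G Ω y) (stdVec i) (stdVec j) (stdVec l) -
    (fderivWithin ℝ r Ω y (stdVec i) * gram (G y) j l +
      fderivWithin ℝ r Ω y (stdVec j) * gram (G y) i l -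
      fderivWithin ℝ r Ω y (stdVec l) * gram (G y) i j))

variable (Ω G r) in
/-- The scalar curvature of `r⁻² G`, in a form that makes sense where `r = 0`. -/
def scalT (y : E n) : ℝ :=
  ∑ j, ∑ k, (gram (G y))⁻¹ j k * ∑ i,
    (-(fderivWithin ℝ r Ω y (stdVec i) * christoffelT Ω G r i j k y) +
      fderivWithin ℝ r Ω y (stdVec k) * christoffelT Ω G r i i j y +
      r y * (fderivWithin ℝ (christoffelT Ω G r i j k) Ω y (stdVec i) -
        fderivWithin ℝ (christoffelT Ω G r i i j) Ω y (stdVec k)) +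
      ∑ l, (christoffelT Ω G r i i l y * christoffelT Ω G r l j k y -
        christoffelT Ω G r i k l y * christoffelT Ω G r l i j y))

lemma contDiffOn_christoffelT (hΩ : UniqueDiffOn ℝ Ω) (hG : ContDiffOn ℝ 2 G Ω)
    (hr : ContDiffOn ℝ 2 r Ω) (hi : ∀ y ∈ Ω, IsInner (G y)) (k i j : Fin n) :
    ContDiffOn ℝ 1 (christoffelT Ω G r k i j) Ω := by
  intro y hy
  have h1 : ContDiffWithinAt ℝ 1 G Ω y := (hG y hy).of_le (by norm_num)
  have h2 : ContDiffWithinAt ℝ 1 r Ω y := (hr y hy).of_le (by norm_num)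
  have h3 : ContDiffWithinAt ℝ 1 (fderivWithin ℝ G Ω) Ω y :=
    (hG y hy).fderivWithin_right hΩ (by norm_num) hy
  have h4 : ContDiffWithinAt ℝ 1 (fderivWithin ℝ r Ω) Ω y :=
    (hr y hy).fderivWithin_right hΩ (by norm_num) hy
  have h5 := fun i j => contDiffWithinAt_gram h1 i j
  have h6 := fun i j => contDiffWithinAt_inv h5 (hi y hy).isUnit_det.ne_zero i j
  refine ContDiffWithinAt.sum fun l _ => (h6 k l).mul ?_
  simp only [koszul]
  fun_prop

lemma continuousOn_scalT (hΩ : UniqueDiffOn ℝ Ω) (hG : ContDiffOn ℝ 2 G Ω)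
    (hr : ContDiffOn ℝ 2 r Ω) (hi : ∀ y ∈ Ω, IsInner (G y)) : ContinuousOn (scalT Ω G r) Ω := by
  have h1 := contDiffOn_christoffelT hΩ hG hr hi
  have h2 := fun k i j => (h1 k i j).continuousOn
  have h3 := fun k i j => (h1 k i j).continuousOn_fderivWithin hΩ le_rfl
  have h4 := hr.continuousOn_fderivWithin hΩ (by norm_num)
  have h5 := hr.continuousOn
  have h6 : ∀ i j, ContinuousOn (fun y => (gram (G y))⁻¹ i j) Ω := fun i j y hy =>
    (contDiffWithinAt_inv (k := 2) (fun i j => contDiffWithinAt_gram (hG y hy) i j)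
      (hi y hy).isUnit_det.ne_zero i j).continuousWithinAt
  have h7 : ∀ u, ContinuousOn (fun y => fderivWithin ℝ r Ω y u) Ω := fun u =>
    h4.clm_apply continuousOn_const
  have h8 : ∀ k i j u, ContinuousOn (fun y => fderivWithin ℝ (christoffelT Ω G r k i j) Ω y u) Ω :=
    fun k i j u => (h3 k i j).clm_apply continuousOn_const
  refine continuousOn_finsetSum _ fun j _ => continuousOn_finsetSum _ fun k _ =>
    (h6 j k).mul (continuousOn_finsetSum _ fun i _ => ?_)
  refine (((((h7 _).mul (h2 i j k)).neg).add ((h7 _).mul (h2 i i j))).add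
    (h5.mul ((h8 i j k _).sub (h8 i i j _)))).add (continuousOn_finsetSum _ fun l _ => ?_)
  exact ((h2 i i l).mul (h2 l j k)).sub ((h2 i k l).mul (h2 l i j))

/-- Where r = 0 all derivatives of G and second derivatives of r drop out. The Ricci expression
becomes (1 - n)|dr|²G, whose trace contributes a further factor n. -/
lemma scalT_of_eq_zero {y : E n} (hi : IsInner (G y)) (hr : r y = 0) :
    scalT Ω G r y = -(n * (n - 1)) *
      covectorNormSq (G y) (fderivWithin ℝ r Ω y) := by
  set p : Fin n → ℝ := fun i => fderivWithin ℝ r Ω y (stdVec i) with hp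
  have hsymm : (gram (G y)).transpose = gram (G y) := by
    ext i j
    simp [gram, hi.symm (stdVec j)]
  have hinv : (gram (G y))⁻¹ * gram (G y) = 1 := Matrix.nonsing_inv_mul _ hi.isUnit_det
  have key := ricci_model_eq hinv hsymm p (fun k i j => christoffelT Ω G r k i j y)
    (fun k i j => by simp [christoffelT, hr, hp])
  have h1 : scalT Ω G r y = ∑ j, ∑ k, (gram (G y))⁻¹ j k *
      ((1 - n) * covectorNormSq (G y) (fderivWithin ℝ r Ω y) * gram (G y) j k) := by
    unfold scalT
    refine Finset.sum_congr rfl fun j _ => Finset.sum_congr rfl fun k _ => ?_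
    rw [show covectorNormSq (G y) (fderivWithin ℝ r Ω y) =
      ∑ a, ∑ b, (gram (G y))⁻¹ a b * p a * p b from rfl, ← key j k, hr]
    simp only [zero_mul, add_zero, hp]
  have h2 : ∑ j, ∑ k, (gram (G y))⁻¹ j k * gram (G y) j k = n := by
    have := congrArg Matrix.trace hinv
    simp only [Matrix.trace_one, Fintype.card_fin] at this
    rw [← this]
    simp only [Matrix.trace, Matrix.diag, Matrix.mul_apply]
    refine Finset.sum_congr rfl fun j _ => Finset.sum_congr rfl fun k _ => ?_
    rw [show gram (G y) k j = gram (G y) j k from congrFun₂ hsymm j k]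
  calc scalT Ω G r y = ∑ j, ∑ k, ((1 - n) * covectorNormSq (G y) (fderivWithin ℝ r Ω y)) *
      ((gram (G y))⁻¹ j k * gram (G y) j k) := by
        rw [h1]
        exact Finset.sum_congr rfl fun j _ => Finset.sum_congr rfl fun k _ => by ring
    _ = _ := by
        simp only [← Finset.mul_sum, h2]
        ring

lemma gram_smul_inv {c : ℝ} (hc : c ≠ 0) {b : E n →L[ℝ] E n →L[ℝ] ℝ} (hb : IsInner b) :
    (gram (c • b))⁻¹ = c⁻¹ • (gram b)⁻¹ := by
  rw [gram_smul]
  apply Matrix.inv_eq_left_inv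
  rw [Matrix.smul_mul, Matrix.mul_smul, smul_smul, inv_mul_cancel₀ hc, one_smul,
    Matrix.nonsing_inv_mul _ hb.isUnit_det]

/-- Count powers of r. The Christoffel symbols are r⁻¹T, so their derivatives are r⁻¹∂T - r⁻²(∂r)T
and their products r⁻²TT. The inverse metric r²G⁻¹ absorbs all negative powers. -/
lemma coordScal_conformal (hΩ : UniqueDiffOn ℝ Ω) (hG : ContDiffOn ℝ 2 G Ω)
    (hr : ContDiffOn ℝ 2 r Ω) (hi : ∀ y ∈ Ω, IsInner (G y)) (hpos : ∀ y ∈ interior Ω, 0 < r y)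
    (hB : ∀ y ∈ interior Ω, B y = (r y ^ 2)⁻¹ • G y) {y : E n} (hy : y ∈ interior Ω) :
    coordScal (fun z => gram (B z)) y = scalT Ω G r y := by
  have hnhds : ∀ z ∈ interior Ω, Ω ∈ 𝓝 z := fun z hz => mem_interior_iff_mem_nhds.1 hz
  have hGd : ∀ z ∈ interior Ω, HasFDerivAt G (fderivWithin ℝ G Ω z) z := fun z hz =>
    ((hG.differentiableOn (by simp) z (interior_subset hz)).hasFDerivWithinAt).hasFDerivAt
      (hnhds z hz)
  have hrd : ∀ z ∈ interior Ω, HasFDerivAt r (fderivWithin ℝ r Ω z) z := fun z hz =>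
    ((hr.differentiableOn (by simp) z (interior_subset hz)).hasFDerivWithinAt).hasFDerivAt
      (hnhds z hz)
  have hTd : ∀ k i j, ∀ z ∈ interior Ω, HasFDerivAt (christoffelT Ω G r k i j)
      (fderivWithin ℝ (christoffelT Ω G r k i j) Ω z) z := fun k i j z hz =>
    (((contDiffOn_christoffelT hΩ hG hr hi k i j).differentiableOn (by simp) z
      (interior_subset hz)).hasFDerivWithinAt).hasFDerivAt (hnhds z hz)
  have hinv : ∀ z ∈ interior Ω, (gram (B z))⁻¹ = (r z ^ 2) • (gram (G z))⁻¹ := by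
    intro z hz
    rw [hB z hz, gram_smul_inv (inv_ne_zero (pow_ne_zero 2 (hpos z hz).ne'))
      (hi z (interior_subset hz)), inv_inv]
  have hchr : ∀ k i j, ∀ z ∈ interior Ω, christoffel (fun z => gram (B z)) k i j z =
      (r z)⁻¹ * christoffelT Ω G r k i j z := by
    intro k i j z hz
    have hrz := (hpos z hz).ne'
    -- The factor 2 from differentiating r⁻² cancels the ½ in Koszul's formula; hence `christoffelT`
    -- has coefficient 1 in front of its dr terms.
    have hder : HasFDerivAt B ((r z ^ 2)⁻¹ • fderivWithin ℝ G Ω z +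
        ((-(2 * r z) / (r z ^ 2) ^ 2) • fderivWithin ℝ r Ω z).smulRight (G z)) z := by
      have hinv' : HasDerivAt (fun t : ℝ => (t ^ 2)⁻¹) (-(2 * r z) / (r z ^ 2) ^ 2) (r z) := by
        simpa using (hasDerivAt_pow 2 (r z)).fun_inv (pow_ne_zero 2 hrz)
      have h1 := (hinv'.comp_hasFDerivAt z (hrd z hz)).smul (hGd z hz)
      refine h1.congr_of_eventuallyEq ?_
      filter_upwards [isOpen_interior.mem_nhds hz] with x hx
      exact hB x hx
    rw [christoffel_gram hder.differentiableAt, hder.fderiv, christoffelT, Finset.mul_sum, hinv z hz]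
    refine Finset.sum_congr rfl fun l _ => ?_
    simp only [koszul, _root_.add_apply, _root_.smul_apply, smul_eq_mul,
      ContinuousLinearMap.smulRight_apply, Matrix.smul_apply, gram, Matrix.of_apply]
    field_simp
    ring
  have hpd : ∀ m k i j, pderiv m (christoffel (fun z => gram (B z)) k i j) y =
      (r y)⁻¹ * fderivWithin ℝ (christoffelT Ω G r k i j) Ω y (stdVec m) -
        (r y ^ 2)⁻¹ * fderivWithin ℝ r Ω y (stdVec m) * christoffelT Ω G r k i j y := by
    intro m k i j
    have heq : christoffel (fun z => gram (B z)) k i j =ᶠ[𝓝 y]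
        fun z => (r z)⁻¹ * christoffelT Ω G r k i j z := by
      filter_upwards [isOpen_interior.mem_nhds hy] with z hz
      exact hchr k i j z hz
    have h1 := ((hasDerivAt_inv (hpos y hy).ne').comp_hasFDerivAt y (hrd y hy)).mul (hTd k i j y hy)
    rw [pderiv, heq.fderiv_eq]
    erw [h1.fderiv]
    simp
    ring
  have hry := (hpos y hy).ne'
  unfold coordScal scalT
  refine Finset.sum_congr rfl fun j _ => Finset.sum_congr rfl fun k _ => ?_
  rw [hinv y hy, Matrix.smul_apply, smul_eq_mul, mul_comm (r y ^ 2), mul_assoc, ricci,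
    Finset.mul_sum]
  congr 1
  refine Finset.sum_congr rfl fun i _ => ?_
  simp only [hpd, hchr _ _ _ y hy]
  have : ∑ l, ((r y)⁻¹ * christoffelT Ω G r i i l y * ((r y)⁻¹ * christoffelT Ω G r l j k y) -
      (r y)⁻¹ * christoffelT Ω G r i k l y * ((r y)⁻¹ * christoffelT Ω G r l i j y)) =
      (r y ^ 2)⁻¹ * ∑ l, (christoffelT Ω G r i i l y * christoffelT Ω G r l j k y -
        christoffelT Ω G r i k l y * christoffelT Ω G r l i j y) := by
    rw [Finset.mul_sum]
    exact Finset.sum_congr rfl fun l _ => by field_simp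
  rw [this]
  field_simp
  ring

end BoundaryCurvature

/-! ### The divergence of r∇r and integration by parts in coordinates. -/

section Divergence

variable {n : ℕ} {Ω : Set (E n)} {G B : E n → E n →L[ℝ] E n →L[ℝ] ℝ} {r : E n → ℝ}

/-- The Riemannian volume density. -/
def density (b : E n →L[ℝ] E n →L[ℝ] ℝ) : ℝ := √(gram b).det

lemma IsInner.density_pos {b : E n →L[ℝ] E n →L[ℝ] ℝ} (hb : IsInner b) : 0 < density b :=
  Real.sqrt_pos.2 hb.posDef.det_pos

lemma density_smul {c : ℝ} (hc : 0 < c) (b : E n →L[ℝ] E n →L[ℝ] ℝ) :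
    density ((c ^ 2)⁻¹ • b) = (c ^ n)⁻¹ * density b := by
  have h : ((c ^ 2)⁻¹) ^ n = ((c ^ n)⁻¹) ^ 2 := by
    rw [inv_pow, inv_pow, ← pow_mul, ← pow_mul, mul_comm]
  rw [density, gram_smul, Matrix.det_smul, Fintype.card_fin, h, Real.sqrt_mul (by positivity),
    Real.sqrt_sq (by positivity), density]

lemma contDiffWithinAt_density {k : ℕ∞ω} {s : Set (E n)} {y : E n}
    (h : ContDiffWithinAt ℝ k G s y) (hi : IsInner (G y)) :
    ContDiffWithinAt ℝ k (fun z => density (G z)) s y :=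
  (contDiffWithinAt_det fun i j => contDiffWithinAt_gram h i j).sqrt hi.isUnit_det.ne_zero

variable (Ω G r) in
/-- The components of the gradient of `r`, multiplied by the volume density of `G`. -/
def flux (i : Fin n) (y : E n) : ℝ :=
  sharp (G y) (fderivWithin ℝ r Ω y) i * density (G y)

variable (Ω G r) in
/-- The divergence of the vector field `r ∇r` with respect to the metric `r⁻² G`, in a form that
makes sense where `r = 0`. Here `∇r` is the gradient with respect to `G`. -/
def divT (y : E n) : ℝ :=
  (1 - n) * covectorNormSq (G y) (fderivWithin ℝ r Ω y) +
    r y * (∑ i, fderivWithin ℝ (flux Ω G r i) Ω y (stdVec i)) / density (G y)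

lemma contDiffOn_sharp {k : ℕ∞ω} {θ : E n → E n →L[ℝ] ℝ} (hG : ContDiffOn ℝ k G Ω)
    (hθ : ContDiffOn ℝ k θ Ω) (hi : ∀ y ∈ Ω, IsInner (G y)) :
    ContDiffOn ℝ k (fun y => sharp (G y) (θ y)) Ω := by
  intro y hy
  refine ContDiffWithinAt.sum fun i _ => ContDiffWithinAt.smul_const ?_ _
  exact ContDiffWithinAt.sum fun j _ =>
    (contDiffWithinAt_inv (fun i j => contDiffWithinAt_gram (hG y hy) i j)
      (hi y hy).isUnit_det.ne_zero i j).mul ((hθ y hy).clm_apply contDiffWithinAt_const)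

lemma contDiffOn_flux (hΩ : UniqueDiffOn ℝ Ω) (hG : ContDiffOn ℝ 1 G Ω)
    (hr : ContDiffOn ℝ 2 r Ω) (hi : ∀ y ∈ Ω, IsInner (G y)) (i : Fin n) :
    ContDiffOn ℝ 1 (flux Ω G r i) Ω := by
  have h1 : ContDiffOn ℝ 1 (fderivWithin ℝ r Ω) Ω := hr.fderivWithin hΩ (by norm_num)
  have h2 := contDiffOn_sharp hG h1 hi
  intro y hy
  exact (((EuclideanSpace.proj i : E n →L[ℝ] ℝ).contDiff.contDiffAt).comp_contDiffWithinAt y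
    (h2 y hy)).mul (contDiffWithinAt_density (hG y hy) (hi y hy))

lemma continuousOn_coPair {θ η : E n → E n →L[ℝ] ℝ} (hG : ContinuousOn G Ω)
    (hθ : ContinuousOn θ Ω) (hη : ContinuousOn η Ω) (hi : ∀ y ∈ Ω, IsInner (G y)) :
    ContinuousOn (fun y => coPair (G y) (θ y) (η y)) Ω := by
  have := (contDiffOn_sharp (contDiffOn_zero.2 hG) (contDiffOn_zero.2 hη) hi).continuousOn
  simp only [coPair_eq_apply_sharp]
  exact hθ.clm_apply this

lemma continuousOn_divT (hΩ : UniqueDiffOn ℝ Ω) (hG : ContDiffOn ℝ 1 G Ω)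
    (hr : ContDiffOn ℝ 2 r Ω) (hi : ∀ y ∈ Ω, IsInner (G y)) : ContinuousOn (divT Ω G r) Ω := by
  have h1 := hr.continuousOn_fderivWithin hΩ (by norm_num)
  have h2 : ContinuousOn (fun y => density (G y)) Ω := fun y hy =>
    (contDiffWithinAt_density (hG y hy) (hi y hy)).continuousWithinAt
  refine (continuousOn_const.mul (continuousOn_coPair hG.continuousOn h1 h1 hi)).add
    ((hr.continuousOn.mul (continuousOn_finsetSum _ fun i _ => ?_)).div h2
      fun y hy => (hi y hy).density_pos.ne')
  exact ((contDiffOn_flux hΩ hG hr hi i).continuousOn_fderivWithin hΩ le_rfl).clm_apply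
    continuousOn_const

lemma divT_of_eq_zero {y : E n} (hr : r y = 0) :
    divT Ω G r y = (1 - n) * covectorNormSq (G y) (fderivWithin ℝ r Ω y) := by
  simp [divT, hr]

/-- Extension by zero: it turns the coordinate expressions, meaningful only on U, into test
functions on ℝⁿ. -/
lemma contDiff_indicator {k : ℕ∞ω} {U K : Set (E n)} (hU : IsOpen U) (hK : IsCompact K)
    (hKU : K ⊆ U) {f : E n → ℝ} (hf : ContDiffOn ℝ k f U) (h0 : ∀ y ∈ U, y ∉ K → f y = 0) :
    ContDiff ℝ k (U.indicator f) ∧ tsupport (U.indicator f) ⊆ K := by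
  constructor
  · rw [contDiff_iff_contDiffAt]
    intro y
    by_cases hy : y ∈ U
    · refine (hf.contDiffAt (hU.mem_nhds hy)).congr_of_eventuallyEq ?_
      filter_upwards [hU.mem_nhds hy] with z hz
      exact indicator_of_mem hz f
    · have hyK : y ∉ K := fun h => hy (hKU h)
      refine (contDiffAt_const (c := (0 : ℝ))).congr_of_eventuallyEq ?_
      filter_upwards [hK.isClosed.isOpen_compl.mem_nhds hyK] with z hz
      by_cases hzU : z ∈ U
      · rw [indicator_of_mem hzU, h0 z hzU hz]
      · rw [indicator_of_notMem hzU]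
  · refine closure_minimal (fun y hy => ?_) hK.isClosed
    by_contra hyK
    apply hy
    by_cases hyU : y ∈ U
    · rw [indicator_of_mem hyU, h0 y hyU hyK]
    · rw [indicator_of_notMem hyU]

/-- Integration by parts against the vector field `ζ r ∇r`, in coordinates. -/
theorem integral_chart_parts (hΩ : UniqueDiffOn ℝ Ω) (hG : ContDiffOn ℝ 1 G Ω)
    (hr : ContDiffOn ℝ 2 r Ω) (hi : ∀ y ∈ Ω, IsInner (G y)) (hpos : ∀ y ∈ interior Ω, 0 < r y)
    (hB : ∀ y ∈ interior Ω, B y = (r y ^ 2)⁻¹ • G y)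
    {a : E n → ℝ} {θ : E n → E n →L[ℝ] ℝ}
    (ham : AEStronglyMeasurable a (volume.restrict (interior Ω)))
    (hθm : AEStronglyMeasurable θ (volume.restrict (interior Ω)))
    (ha : IntegrableOn (fun y => a y ^ 2 * density (B y)) (interior Ω))
    (hθ : IntegrableOn (fun y => covectorNormSq (B y) (θ y) * density (B y)) (interior Ω))
    (hweak : ∀ φ : E n → ℝ, ContDiff ℝ ∞ φ → HasCompactSupport φ → tsupport φ ⊆ interior Ω →
      ∀ v : E n, ∫ y, a y * fderiv ℝ φ y v = - ∫ y, θ y v * φ y)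
    {ζ : E n → ℝ} (hζ : ContDiffOn ℝ 1 ζ (interior Ω)) {K : Set (E n)} (hK : IsCompact K)
    (hKΩ : K ⊆ interior Ω) (h0 : ∀ y ∈ interior Ω, y ∉ K → ζ y = 0) :
    ∫ y in interior Ω, 2 * (a y * (ζ y * (r y * coPair (G y) (θ y) (fderivWithin ℝ r Ω y)))) *
        density (B y) =
      -∫ y in interior Ω, a y ^ 2 * (r y * coPair (G y) (fderiv ℝ ζ y) (fderivWithin ℝ r Ω y) +
        ζ y * divT Ω G r y) * density (B y) := by
  set U := interior Ω with hUdef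
  have hU : IsOpen U := isOpen_interior
  have hUΩ : U ⊆ Ω := interior_subset
  have hnhds : ∀ z ∈ U, Ω ∈ 𝓝 z := fun z hz => mem_interior_iff_mem_nhds.1 hz
  have hBi : ∀ y ∈ U, IsInner (B y) := fun y hy => by
    rw [hB y hy]
    exact (hi y (hUΩ hy)).smul (inv_pos.2 (pow_pos (hpos y hy) 2))
  have hBc : ContinuousOn B U := by
    refine ContinuousOn.congr (f := fun y => (r y ^ 2)⁻¹ • G y) ?_ hB
    exact (((hr.continuousOn.mono hUΩ).pow 2).inv₀ fun y hy =>
      pow_ne_zero 2 (hpos y hy).ne').smul (hG.continuousOn.mono hUΩ)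
  have hwc : ContinuousOn (fun y => density (B y)) U := fun y hy =>
    (contDiffWithinAt_density (contDiffOn_zero.2 hBc y hy) (hBi y hy)).continuousWithinAt
  have hwinv : ContinuousOn (fun y => (density (B y))⁻¹) U :=
    hwc.inv₀ fun y hy => (hBi y hy).density_pos.ne'
  -- On compact subsets of U the volume density is bounded away from zero, so the weighted
  -- hypotheses imply plain local square integrability.
  have haK : ∀ K ⊆ U, IsCompact K → MemLp a 2 (volume.restrict K) := by
    intro K hKU hK
    rw [memLp_two_iff_integrable_sq (ham.mono_measure (Measure.restrict_mono hKU le_rfl))]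
    have h1 := (ha.mono_set hKU).mul_continuousOn (hwinv.mono hKU) hK
    refine IntegrableOn.congr_fun h1 (fun y hy => ?_) hK.measurableSet
    have := (hBi y (hKU hy)).density_pos.ne'
    field_simp
  have hθK : ∀ v, ∀ K ⊆ U, IsCompact K → MemLp (fun y => θ y v) 2 (volume.restrict K) := by
    intro v K hKU hK
    have hm : AEStronglyMeasurable (fun y => θ y v) (volume.restrict K) :=
      (hθm.mono_measure (Measure.restrict_mono hKU le_rfl)).apply_continuousLinearMap v
    rw [memLp_two_iff_integrable_sq hm]
    have h1 := ((hθ.mono_set hKU).mul_continuousOn (hwinv.mono hKU) hK).mul_continuousOn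
      (((hBc.mono hKU).clm_apply continuousOn_const).clm_apply continuousOn_const :
        ContinuousOn (fun y => B y v v) K) hK
    refine Integrable.mono' h1 (hm.pow 2) ?_
    refine (ae_restrict_iff' hK.measurableSet).2 (Eventually.of_forall fun y hy => ?_)
    have h2 := (hBi y (hKU hy)).density_pos.ne'
    have h3 := (hBi y (hKU hy)).sq_covector_le (θ y) v
    rw [Real.norm_of_nonneg (sq_nonneg _)]
    calc θ y v ^ 2 ≤ _ := h3
      _ = _ := by field_simp
  -- The volume density of r⁻²G contributes r⁻ⁿ and the vector field r∇r a factor r. The exponent 1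
  -- - n may be negative, hence an integer power. So F_i is the i-th component of ζ r∇r times the
  -- volume density of B.
  set p : ℝ → ℝ := fun t => t ^ (1 - (n : ℤ)) with hp
  set F : Fin n → E n → ℝ := fun i y => ζ y * flux Ω G r i y * p (r y) with hF
  have hrU : ∀ y ∈ U, HasFDerivAt r (fderivWithin ℝ r Ω y) y := fun y hy =>
    ((hr.differentiableOn (by simp) y (hUΩ hy)).hasFDerivWithinAt).hasFDerivAt (hnhds y hy)
  have hflux := contDiffOn_flux hΩ hG hr hi
  have hFc : ∀ i, ContDiffOn ℝ 1 (F i) U := by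
    intro i
    refine (hζ.mul ((hflux i).mono hUΩ)).mul fun y hy => ?_
    have h1 : ContDiffAt ℝ 1 p (r y) := by
      have h2 : ContDiffAt ℝ 1 (fun t : ℝ => (t ^ n)⁻¹ * t) (r y) :=
        ((contDiffAt_id.pow n).inv (pow_ne_zero n (hpos y hy).ne')).mul contDiffAt_id
      refine h2.congr_of_eventuallyEq ?_
      filter_upwards [eventually_ne_nhds (hpos y hy).ne'] with t ht
      rw [hp]
      simp only
      rw [sub_eq_add_neg, add_comm, zpow_add₀ ht, zpow_neg, zpow_natCast, zpow_one]
    exact h1.comp_contDiffWithinAt y ((hr.mono hUΩ y hy).of_le (by norm_num))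
  have hind := fun i => contDiff_indicator hU hK hKΩ (hFc i) fun y hy hyK => by
    simp [hF, h0 y hy hyK]
  have hcs : ∀ i, HasCompactSupport (U.indicator (F i)) := fun i =>
    hK.of_isClosed_subset (isClosed_tsupport _) (hind i).2
  have hmain := fun i => integral_sq_mul_fderiv hU haK (hθK (stdVec i))
    (fun φ h1 h2 h3 => hweak φ h1 h2 h3 (stdVec i)) (hind i).1 (hcs i) ((hind i).2.trans hKΩ)
  have hout : ∀ i, ∀ y ∉ U, fderiv ℝ (U.indicator (F i)) y = 0 := by
    intro i y hy
    have : y ∉ tsupport (fderiv ℝ (U.indicator (F i))) := fun h =>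
      hy (hKΩ ((hind i).2 (tsupport_fderiv_subset ℝ h)))
    exact image_eq_zero_of_notMem_tsupport this
  have hlhs : ∀ i, Integrable fun y => a y ^ 2 * fderiv ℝ (U.indicator (F i)) y (stdVec i) := by
    intro i
    have h1 := (haK K hKΩ hK).integrable_sq
    have h2 : Continuous fun y => fderiv ℝ (U.indicator (F i)) y (stdVec i) :=
      ((hind i).1.continuous_fderiv one_ne_zero).clm_apply continuous_const
    have h3 : IntegrableOn (fun y => a y ^ 2 * fderiv ℝ (U.indicator (F i)) y (stdVec i)) K :=
      IntegrableOn.mul_continuousOn h1 h2.continuousOn hK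
    refine (integrableOn_iff_integrable_of_support_subset fun y hy => ?_).1 h3
    by_contra hyK
    have h4 : y ∉ tsupport (fderiv ℝ (U.indicator (F i))) := fun h =>
      hyK ((hind i).2 (tsupport_fderiv_subset ℝ h))
    exact hy (by simp [image_eq_zero_of_notMem_tsupport h4])
  have hrhs : ∀ i, Integrable fun y => 2 * (a y * θ y (stdVec i) * U.indicator (F i) y) := by
    intro i
    have h1 := (haK K hKΩ hK).integrable_mul (hθK (stdVec i) K hKΩ hK)
    have h3 : IntegrableOn (fun y => a y * θ y (stdVec i) * U.indicator (F i) y) K :=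
      IntegrableOn.mul_continuousOn h1 (hind i).1.continuous.continuousOn hK
    refine Integrable.const_mul
      ((integrableOn_iff_integrable_of_support_subset fun y hy => ?_).1 h3) 2
    by_contra hyK
    exact hy (by simp [image_eq_zero_of_notMem_tsupport fun h => hyK ((hind i).2 h)])
  -- Summing the product rule over the coordinate directions produces the divergence of ζ r∇r on one
  -- side and its pairing with θ on the other.
  have hsum := Finset.sum_congr rfl fun i (_ : i ∈ Finset.univ) => hmain i
  rw [Finset.sum_neg_distrib, ← integral_finsetSum _ fun i _ => hlhs i,
    ← integral_finsetSum _ fun i _ => hrhs i] at hsum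
  have e1 : ∫ y, ∑ i, a y ^ 2 * fderiv ℝ (U.indicator (F i)) y (stdVec i) =
      ∫ y in U, ∑ i, a y ^ 2 * fderiv ℝ (U.indicator (F i)) y (stdVec i) :=
    (setIntegral_eq_integral_of_forall_compl_eq_zero fun y hy => by simp [hout _ y hy]).symm
  have e2 : ∫ y, ∑ i, 2 * (a y * θ y (stdVec i) * U.indicator (F i) y) =
      ∫ y in U, ∑ i, 2 * (a y * θ y (stdVec i) * U.indicator (F i) y) :=
    (setIntegral_eq_integral_of_forall_compl_eq_zero fun y hy => by simp [hy]).symm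
  rw [e1, e2, eq_neg_iff_add_eq_zero, add_comm, ← eq_neg_iff_add_eq_zero] at hsum
  have hdens : ∀ y ∈ U, density (B y) = (r y ^ n)⁻¹ * density (G y) := fun y hy => by
    rw [hB y hy, density_smul (hpos y hy)]
  have hpr : ∀ y ∈ U, p (r y) = (r y ^ n)⁻¹ * r y := fun y hy => by
    rw [hp]
    simp only
    rw [sub_eq_add_neg, add_comm, zpow_add₀ (hpos y hy).ne', zpow_neg, zpow_natCast, zpow_one]
  have f1 : ∫ y in U, ∑ i, a y ^ 2 * fderiv ℝ (U.indicator (F i)) y (stdVec i) =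
      ∫ y in U, a y ^ 2 * (r y * coPair (G y) (fderiv ℝ ζ y) (fderivWithin ℝ r Ω y) +
        ζ y * divT Ω G r y) * density (B y) := by
    refine setIntegral_congr_fun hU.measurableSet fun y hy => ?_
    -- The last summand comes from differentiating r^{1-n}; it is the source of the term (1 -
    -- n)|dr|² in `divT`.
    have hder : ∀ i, fderiv ℝ (U.indicator (F i)) y (stdVec i) =
        fderiv ℝ ζ y (stdVec i) * flux Ω G r i y * p (r y) +
        ζ y * fderivWithin ℝ (flux Ω G r i) Ω y (stdVec i) * p (r y) +
        ζ y * (fderivWithin ℝ r Ω y (stdVec i) * flux Ω G r i y) * ((1 - n) * (r y ^ n)⁻¹) := by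
      intro i
      have h1 : U.indicator (F i) =ᶠ[𝓝 y] F i := by
        filter_upwards [hU.mem_nhds hy] with z hz
        exact indicator_of_mem hz _
      have h2 : HasFDerivAt ζ (fderiv ℝ ζ y) y :=
        ((hζ.contDiffAt (hU.mem_nhds hy)).differentiableAt one_ne_zero).hasFDerivAt
      have h3 : HasFDerivAt (flux Ω G r i) (fderivWithin ℝ (flux Ω G r i) Ω y) y :=
        (((hflux i).differentiableOn one_ne_zero y (hUΩ hy)).hasFDerivWithinAt).hasFDerivAt
          (hnhds y hy)
      have h4 : HasDerivAt p ((1 - n) * (r y ^ n)⁻¹) (r y) := by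
        have := hasDerivAt_zpow (1 - (n : ℤ)) (r y) (Or.inl (hpos y hy).ne')
        rw [show 1 - (n : ℤ) - 1 = -n by ring, zpow_neg, zpow_natCast] at this
        simpa using this
      have h5 := (h2.mul h3).mul (h4.comp_hasFDerivAt y (hrU y hy))
      rw [h1.fderiv_eq]
      erw [h5.fderiv]
      simp
      ring
    simp only [hder, ← Finset.mul_sum, Finset.sum_add_distrib, ← Finset.sum_mul]
    have hfl : ∀ η : E n →L[ℝ] ℝ, ∑ i, η (stdVec i) * flux Ω G r i y =
        coPair (G y) η (fderivWithin ℝ r Ω y) * density (G y) := by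
      intro η
      rw [coPair_eq_apply_sharp]
      conv_rhs => rw [← sum_smul_stdVec (sharp (G y) (fderivWithin ℝ r Ω y))]
      simp only [map_sum, map_smul, smul_eq_mul, Finset.sum_mul, flux]
      exact Finset.sum_congr rfl fun i _ => by ring
    rw [hfl, hfl, hdens y hy, hpr y hy, divT, covectorNormSq_eq_coPair]
    have := (hi y (hUΩ hy)).density_pos.ne'
    field_simp
    ring
  have f2 : ∫ y in U, ∑ i, 2 * (a y * θ y (stdVec i) * U.indicator (F i) y) =
      ∫ y in U, 2 * (a y * (ζ y * (r y * coPair (G y) (θ y) (fderivWithin ℝ r Ω y)))) *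
        density (B y) := by
    refine setIntegral_congr_fun hU.measurableSet fun y hy => ?_
    simp only [indicator_of_mem hy]
    rw [coPair_eq_apply_sharp]
    conv_rhs => rw [← sum_smul_stdVec (sharp (G y) (fderivWithin ℝ r Ω y))]
    rw [hdens y hy]
    simp only [map_sum, map_smul, smul_eq_mul, hF, hpr y hy, flux, Finset.mul_sum, Finset.sum_mul]
    exact Finset.sum_congr rfl fun i _ => by ring
  rw [f1, f2] at hsum
  exact hsum

end Divergence

/-! ### Changes of charts and coordinate expressions on a manifold with boundary. -/

section Charts

variable {n : ℕ} [NeZero n] {X : Type*} [TopologicalSpace X] [ChartedSpace (EuclideanHalfSpace n) X]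
  {e e' : OpenPartialHomeomorph X (EuclideanHalfSpace n)} {x : X} {y : E n}

/-- The change of coordinates from the chart `e` to the chart `e'`. -/
def coordChange (e e' : OpenPartialHomeomorph X (EuclideanHalfSpace n)) (y : E n) : E n :=
  e'.extend (𝓡∂ n) ((e.extend (𝓡∂ n)).symm y)

lemma symm_mem_source (hy : y ∈ (e.extend (𝓡∂ n)).target) : (e.extend (𝓡∂ n)).symm y ∈ e.source := by
  have := (e.extend (𝓡∂ n)).map_target hy
  rwa [e.extend_source] at this

lemma extend_mem_target (hx : x ∈ e.source) : e.extend (𝓡∂ n) x ∈ (e.extend (𝓡∂ n)).target :=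
  (e.extend (𝓡∂ n)).map_source (by rwa [e.extend_source])

lemma extend_symm_extend (hx : x ∈ e.source) : (e.extend (𝓡∂ n)).symm (e.extend (𝓡∂ n) x) = x :=
  (e.extend (𝓡∂ n)).left_inv (by rwa [e.extend_source])

lemma extend_extend_symm (hy : y ∈ (e.extend (𝓡∂ n)).target) :
    e.extend (𝓡∂ n) ((e.extend (𝓡∂ n)).symm y) = y :=
  (e.extend (𝓡∂ n)).right_inv hy

lemma coordChange_mem_target (hy' : (e.extend (𝓡∂ n)).symm y ∈ e'.source) :
    coordChange e e' y ∈ (e'.extend (𝓡∂ n)).target :=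
  extend_mem_target hy'

lemma symm_coordChange (hy' : (e.extend (𝓡∂ n)).symm y ∈ e'.source) :
    (e'.extend (𝓡∂ n)).symm (coordChange e e' y) = (e.extend (𝓡∂ n)).symm y :=
  extend_symm_extend hy'

lemma coordChange_coordChange (hy : y ∈ (e.extend (𝓡∂ n)).target)
    (hy' : (e.extend (𝓡∂ n)).symm y ∈ e'.source) : coordChange e' e (coordChange e e' y) = y := by
  rw [coordChange, symm_coordChange hy', extend_extend_symm hy]

lemma uniqueDiffOn_target : UniqueDiffOn ℝ (e.extend (𝓡∂ n)).target := by
  rw [e.extend_target]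
  exact (𝓡∂ n).uniqueDiffOn_preimage e.open_target

lemma target_mem_nhdsWithin_range (hy : y ∈ (e.extend (𝓡∂ n)).target) :
    (e.extend (𝓡∂ n)).target ∈ 𝓝[range (𝓡∂ n)] y := by
  have := e.extend_target_mem_nhdsWithin (I := 𝓡∂ n) (symm_mem_source hy)
  rwa [extend_extend_symm hy] at this

lemma eventually_symm_mem (hy : y ∈ chartDomain e)
    (hy' : (e.extend (𝓡∂ n)).symm y ∈ e'.source) :
    ∀ᶠ z in 𝓝 y, z ∈ chartDomain e ∧ (e.extend (𝓡∂ n)).symm z ∈ e'.source := by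
  have h1 : ContinuousAt (e.extend (𝓡∂ n)).symm y :=
    e.continuousAt_extend_symm' (interior_subset hy)
  exact Filter.Eventually.and (isOpen_interior.mem_nhds hy)
    (h1.eventually (e'.open_source.mem_nhds hy'))

section Smooth

variable [IsManifold (𝓡∂ n) ∞ X]

lemma contDiffWithinAt_coordChange (he : e ∈ smoothCharts n X) (he' : e' ∈ smoothCharts n X)
    (hy : y ∈ (e.extend (𝓡∂ n)).target) (hy' : (e.extend (𝓡∂ n)).symm y ∈ e'.source) :
    ContDiffWithinAt ℝ ∞ (coordChange e e') (range (𝓡∂ n)) y :=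
  (𝓡∂ n).contDiffWithinAt_extendCoordChange he he' (by
    rw [ModelWithCorners.extendCoordChange, PartialEquiv.trans_source, PartialEquiv.symm_source]
    exact ⟨hy, by rwa [mem_preimage, e'.extend_source]⟩)

lemma range_mem_nhds (hy : y ∈ chartDomain e) : range (𝓡∂ n) ∈ 𝓝 y :=
  mem_of_superset (mem_interior_iff_mem_nhds.1 hy) e.extend_target_subset_range

lemma contDiffAt_coordChange (he : e ∈ smoothCharts n X) (he' : e' ∈ smoothCharts n X)
    (hy : y ∈ chartDomain e) (hy' : (e.extend (𝓡∂ n)).symm y ∈ e'.source) :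
    ContDiffAt ℝ ∞ (coordChange e e') y :=
  (contDiffWithinAt_coordChange he he' (interior_subset hy) hy').contDiffAt (range_mem_nhds hy)

lemma mdifferentiableWithinAt_symm (he : e ∈ smoothCharts n X)
    (hy : y ∈ (e.extend (𝓡∂ n)).target) :
    MDifferentiableWithinAt 𝓘(ℝ, E n) (𝓡∂ n) (e.extend (𝓡∂ n)).symm (range (𝓡∂ n)) y := by
  have h1 := contMDiffOn_extend_symm he
  rw [← e.extend_target'] at h1
  exact ((h1 y hy).mdifferentiableWithinAt (by simp)).mono_of_mem_nhdsWithin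
    (target_mem_nhdsWithin_range hy)

lemma mem_range_of_mem_target (hy : y ∈ (e.extend (𝓡∂ n)).target) : y ∈ range (𝓡∂ n) :=
  e.extend_target_subset_range hy

/-- The chart composed with its inverse is the identity, so the differential of the chart is a left
inverse of the frame. Derivatives within the half-space make this valid at boundary points too. -/
lemma injective_frame (he : e ∈ smoothCharts n X) (hy : y ∈ (e.extend (𝓡∂ n)).target) :
    Function.Injective (frame e y) := by
  have h1 : MDifferentiableAt (𝓡∂ n) 𝓘(ℝ, E n) (e.extend (𝓡∂ n)) ((e.extend (𝓡∂ n)).symm y) :=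
    (e.contMDiffAt_extend he (symm_mem_source hy)).mdifferentiableAt (by simp)
  have U : UniqueMDiffWithinAt 𝓘(ℝ, E n) (range (𝓡∂ n)) y :=
    (𝓡∂ n).uniqueMDiffOn _ (mem_range_of_mem_target hy)
  have h2 := mfderiv_comp_mfderivWithin y h1 (mdifferentiableWithinAt_symm he hy) U
  have h3 : mfderivWithin 𝓘(ℝ, E n) 𝓘(ℝ, E n) (e.extend (𝓡∂ n) ∘ (e.extend (𝓡∂ n)).symm)
      (range (𝓡∂ n)) y = ContinuousLinearMap.id _ _ := by
    rw [← mfderivWithin_id U]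
    apply Filter.EventuallyEq.mfderivWithin_eq
    · filter_upwards [target_mem_nhdsWithin_range hy] with z hz
      exact extend_extend_symm hz
    · exact extend_extend_symm hy
  rw [h3] at h2
  intro u v huv
  have h4 : ∀ w : E n, mfderiv (𝓡∂ n) 𝓘(ℝ, E n) (e.extend (𝓡∂ n)) ((e.extend (𝓡∂ n)).symm y)
      (frame e y w) = w := fun w => (DFunLike.congr_fun h2 w).symm
  rw [← h4 u, ← h4 v, huv]

lemma det_frame_ne_zero (he : e ∈ smoothCharts n X) (hy : y ∈ (e.extend (𝓡∂ n)).target) :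
    (frame e y).det ≠ 0 := by
  have h : LinearMap.ker (frame e y).toLinearMap = ⊥ :=
    LinearMap.ker_eq_bot.2 (injective_frame he hy)
  have := (LinearMap.isUnit_iff_ker_eq_bot _).2 h
  exact ((LinearMap.isUnit_iff_isUnit_det _).1 this).ne_zero

lemma frame_coordChange (he : e ∈ smoothCharts n X) (he' : e' ∈ smoothCharts n X)
    (hy : y ∈ chartDomain e) (hy' : (e.extend (𝓡∂ n)).symm y ∈ e'.source) :
    frame e y = (frame e' (coordChange e e' y)).comp (fderiv ℝ (coordChange e e') y) := by
  have U : UniqueMDiffWithinAt 𝓘(ℝ, E n) (range (𝓡∂ n)) y :=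
    (𝓡∂ n).uniqueMDiffOn _ (mem_range_of_mem_target (interior_subset hy))
  have h1 : MDifferentiableWithinAt 𝓘(ℝ, E n) 𝓘(ℝ, E n) (coordChange e e') (range (𝓡∂ n)) y :=
    ((contDiffAt_coordChange he he' hy hy').differentiableAt
      (by simp)).mdifferentiableAt.mdifferentiableWithinAt
  have h2 := mfderivWithin_comp y
    (mdifferentiableWithinAt_symm he' (coordChange_mem_target hy')) h1
    (fun z _ => mem_range_self _) U
  have h3 : mfderivWithin 𝓘(ℝ, E n) 𝓘(ℝ, E n) (coordChange e e') (range (𝓡∂ n)) y =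
      fderiv ℝ (coordChange e e') y := by
    rw [mfderivWithin_eq_fderivWithin, fderivWithin_of_mem_nhds (range_mem_nhds hy)]
  have h4 : frame e y = mfderivWithin 𝓘(ℝ, E n) (𝓡∂ n)
      ((e'.extend (𝓡∂ n)).symm ∘ coordChange e e') (range (𝓡∂ n)) y := by
    apply Filter.EventuallyEq.mfderivWithin_eq
    · filter_upwards [nhdsWithin_le_nhds (eventually_symm_mem hy hy')] with z hz
      exact (symm_coordChange hz.2).symm
    · exact (symm_coordChange hy').symm
  rw [h4, h2, h3]
  rfl

lemma det_coordChange_ne_zero (he : e ∈ smoothCharts n X) (he' : e' ∈ smoothCharts n X)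
    (hy : y ∈ chartDomain e) (hy' : (e.extend (𝓡∂ n)).symm y ∈ e'.source) :
    (fderiv ℝ (coordChange e e') y).det ≠ 0 := by
  intro h
  apply det_frame_ne_zero he (interior_subset hy)
  rw [frame_coordChange he he' hy hy']
  change LinearMap.det ((frame e' (coordChange e e' y)).toLinearMap ∘ₗ
    (fderiv ℝ (coordChange e e') y).toLinearMap) = 0
  rw [LinearMap.det_comp]
  change _ * (fderiv ℝ (coordChange e e') y).det = 0
  rw [h, mul_zero]

/-- The coordinate change takes values in the half-space, a closed convex set. A map into such a set
with surjective derivative at an interior point of its domain cannot hit the boundary there. -/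
lemma coordChange_mem_chartDomain (he : e ∈ smoothCharts n X) (he' : e' ∈ smoothCharts n X)
    (hy : y ∈ chartDomain e) (hy' : (e.extend (𝓡∂ n)).symm y ∈ e'.source) :
    coordChange e e' y ∈ chartDomain e' := by
  have h1 : coordChange e e' y ∈ interior (range (𝓡∂ n)) :=
    ((contDiffAt_coordChange he he' hy hy').differentiableAt
      (by simp)).mem_interior_convex_of_surjective_fderiv (u := univ) univ_mem
      (𝓡∂ n).convex_range (𝓡∂ n).isClosed_range (𝓡∂ n).nonempty_interior
      (fun z _ => mem_range_self _) (surjective_of_det_ne_zero (det_coordChange_ne_zero he he' hy hy'))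
  exact e'.mem_interior_extend_target (e'.map_source hy') h1

lemma symm_mem_interior (he : e ∈ smoothCharts n X) (hy : y ∈ chartDomain e) :
    (e.extend (𝓡∂ n)).symm y ∈ (𝓡∂ n).interior X := by
  have h := coordChange_mem_chartDomain he
    (IsManifold.chart_mem_maximalAtlas ((e.extend (𝓡∂ n)).symm y)) hy (mem_chart_source _ _)
  exact ((𝓡∂ n).isInteriorPoint_iff_of_mem_atlas (n := ∞) (by simp) (chart_mem_atlas _ _)
    (mem_chart_source _ _)).2 h

lemma extend_mem_chartDomain (he : e ∈ smoothCharts n X) (hx : x ∈ e.source)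
    (hxi : x ∈ (𝓡∂ n).interior X) : e.extend (𝓡∂ n) x ∈ chartDomain e := by
  have h1 := ((𝓡∂ n).isInteriorPoint_iff_of_mem_atlas (n := ∞) (by simp)
    (chart_mem_atlas _ x) (mem_chart_source _ x)).1 hxi
  have h2 := coordChange_mem_chartDomain (IsManifold.chart_mem_maximalAtlas x) he h1
    (by rwa [extend_symm_extend (mem_chart_source _ x)])
  rwa [coordChange, extend_symm_extend (mem_chart_source _ x)] at h2

lemma coordBilin_coordChange (b : BilinField n X) (he : e ∈ smoothCharts n X)
    (he' : e' ∈ smoothCharts n X) (hy : y ∈ chartDomain e)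
    (hy' : (e.extend (𝓡∂ n)).symm y ∈ e'.source) :
    coordBilin b e y = (coordBilin b e' (coordChange e e' y)).bilinearComp
      (fderiv ℝ (coordChange e e') y) (fderiv ℝ (coordChange e e') y) := by
  rw [coordBilin, coordBilin, symm_coordChange hy', frame_coordChange he he' hy hy']
  rfl

lemma isInner_coordBilin {b : BilinField n X} (he : e ∈ smoothCharts n X)
    (hy : y ∈ (e.extend (𝓡∂ n)).target)
    (hb : IsInner (n := n) (b ((e.extend (𝓡∂ n)).symm y))) : IsInner (coordBilin b e y) :=
  hb.comp (injective_frame he hy)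

/-- The pointwise inner product of two covector fields. -/
def pairAt (b : BilinField n X) (θ η : CovectorField n X) (x : X) : ℝ :=
  coPair (n := n) (b x) (θ x) (η x)

lemma pairAt_symm (b : BilinField n X) (θ η : CovectorField n X) (he : e ∈ smoothCharts n X)
    (hy : y ∈ (e.extend (𝓡∂ n)).target) :
    pairAt b θ η ((e.extend (𝓡∂ n)).symm y) =
      coPair (coordBilin b e y) (coordCovector θ e y) (coordCovector η e y) :=
  (coPair_comp (n := n) _ _ _ _ (det_frame_ne_zero he hy)).symm

lemma normSqAt_symm (b : BilinField n X) (θ : CovectorField n X) (he : e ∈ smoothCharts n X)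
    (hy : y ∈ (e.extend (𝓡∂ n)).target) :
    normSqAt b θ ((e.extend (𝓡∂ n)).symm y) =
      covectorNormSq (coordBilin b e y) (coordCovector θ e y) :=
  pairAt_symm b θ θ he hy

lemma coordCovector_differential {f : X → ℝ} (he : e ∈ smoothCharts n X)
    (hy : y ∈ (e.extend (𝓡∂ n)).target)
    (hf : MDifferentiableAt (𝓡∂ n) 𝓘(ℝ, ℝ) f ((e.extend (𝓡∂ n)).symm y)) :
    coordCovector (differential (n := n) f) e y =
      fderivWithin ℝ (fun z => f ((e.extend (𝓡∂ n)).symm z)) (e.extend (𝓡∂ n)).target y := by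
  have U : UniqueMDiffWithinAt 𝓘(ℝ, E n) (range (𝓡∂ n)) y :=
    (𝓡∂ n).uniqueMDiffOn _ (mem_range_of_mem_target hy)
  have h2 := mfderiv_comp_mfderivWithin y hf (mdifferentiableWithinAt_symm he hy) U
  rw [mfderivWithin_eq_fderivWithin] at h2
  have h3 : fderivWithin ℝ (fun z => f ((e.extend (𝓡∂ n)).symm z)) (e.extend (𝓡∂ n)).target y =
      fderivWithin ℝ (f ∘ (e.extend (𝓡∂ n)).symm) (range (𝓡∂ n)) y := by
    have := e.extend_target_eventuallyEq (I := 𝓡∂ n) (symm_mem_source hy)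
    rw [extend_extend_symm hy] at this
    exact fderivWithin_congr_set this
  rw [h3, h2]
  rfl

lemma contDiffOn_symm {f : X → ℝ} (he : e ∈ smoothCharts n X)
    (hf : ContMDiff (𝓡∂ n) 𝓘(ℝ, ℝ) ∞ f) :
    ContDiffOn ℝ ∞ (fun z => f ((e.extend (𝓡∂ n)).symm z)) (e.extend (𝓡∂ n)).target := by
  have h1 := contMDiffOn_extend_symm he
  rw [← e.extend_target'] at h1
  exact (hf.comp_contMDiffOn h1).contDiffOn

lemma continuous_of_forall_chart {f : X → ℝ} (h : ∀ e ∈ smoothCharts n X,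
    ContinuousOn (fun z => f ((e.extend (𝓡∂ n)).symm z)) (e.extend (𝓡∂ n)).target) :
    Continuous f := by
  rw [continuous_iff_continuousAt]
  intro x
  set e := chartAt (EuclideanHalfSpace n) x
  have hx : x ∈ e.source := mem_chart_source _ x
  have h1 := (h e (IsManifold.chart_mem_maximalAtlas x)).comp
    (e.continuousOn_extend (I := 𝓡∂ n)) (by rw [e.extend_source]; exact fun z hz => extend_mem_target hz)
  rw [e.extend_source] at h1
  refine (h1.congr fun z hz => ?_).continuousAt (e.open_source.mem_nhds hx)
  rw [Function.comp_apply, extend_symm_extend hz]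

end Smooth

end Charts

/-! ### Gluing compatible measures by a supremum. -/

section AbstractMeasure

variable {X ι : Type*} [MeasurableSpace X]

/-- A supremum of measures that agree on overlaps restricts to each of them. -/
lemma restrict_iSup_of_compatible {P : Set ι} {ν : ι → Measure X} {S : ι → Set X}
    (hS : ∀ e ∈ P, MeasurableSet (S e)) (h0 : ∀ e ∈ P, ν e (S e)ᶜ = 0)
    (hc : ∀ e ∈ P, ∀ e' ∈ P, ∀ A, MeasurableSet A → A ⊆ S e → A ⊆ S e' → ν e A = ν e' A)
    {m : ℕ} {c : Fin m → ι} (hcP : ∀ k, c k ∈ P) (hcov : ∀ e ∈ P, S e ⊆ ⋃ k, S (c k)) :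
    (∀ e ∈ P, (⨆ e ∈ P, ν e).restrict (S e) = ν e) ∧ (⨆ e ∈ P, ν e) (⋃ k, S (c k))ᶜ = 0 := by
  set A : Fin m → Set X := disjointed fun k => S (c k) with hA
  have hAm : ∀ k, MeasurableSet (A k) := fun k => by
    rw [hA, disjointed_eq_inter_compl]
    exact (hS _ (hcP k)).inter (MeasurableSet.biInter (to_countable _) fun j _ => (hS _ (hcP j)).compl)
  have hAd : Pairwise (Function.onFun Disjoint A) := disjoint_disjointed _
  have hAS : ∀ k, A k ⊆ S (c k) := fun k => disjointed_le _ k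
  have hAU : ⋃ k, A k = ⋃ k, S (c k) := iUnion_disjointed
  -- N glues the measures of a finite cover along disjoint pieces. It dominates every ν e, hence the
  -- supremum, and it equals ν e on S e; this determines the supremum there.
  set N : Measure X := ∑ k, (ν (c k)).restrict (A k) with hN
  have hNapp : ∀ B, MeasurableSet B → N B = ∑ k, ν (c k) (B ∩ A k) := fun B hB => by
    simp [hN, Measure.restrict_apply hB]
  have hsum : ∀ e ∈ P, ∀ B, MeasurableSet B → ν e B = ∑ k, ν e (B ∩ S e ∩ A k) := by
    intro e he B hB
    have h1 : ν e B = ν e (B ∩ S e) := by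
      rw [← measure_inter_add_sdiff B (hS e he)]
      have : ν e (B \ S e) = 0 := measure_mono_null (fun x hx => hx.2) (h0 e he)
      rw [this, add_zero]
    have h2 : B ∩ S e = ⋃ k, B ∩ S e ∩ A k := by
      rw [← inter_iUnion, hAU, inter_eq_left.2 (inter_subset_right.trans (hcov e he))]
    rw [h1]
    conv_lhs => rw [h2]
    rw [measure_iUnion (fun i j hij => ((hAd hij).mono inter_subset_right inter_subset_right))
      fun k => (hB.inter (hS e he)).inter (hAm k), tsum_fintype]
  have hsum' : ∀ e ∈ P, ∀ B, MeasurableSet B → ν e B = ∑ k, ν (c k) (B ∩ S e ∩ A k) := by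
    intro e he B hB
    rw [hsum e he B hB]
    exact Finset.sum_congr rfl fun k _ => hc e he _ (hcP k) _
      ((hB.inter (hS e he)).inter (hAm k)) (fun x hx => hx.1.2) (fun x hx => hAS k hx.2)
  have hle : (⨆ e ∈ P, ν e) ≤ N := by
    refine iSup₂_le fun e he => Measure.le_iff.2 fun B hB => ?_
    rw [hsum' e he B hB, hNapp B hB]
    exact Finset.sum_le_sum fun k _ => measure_mono fun x hx => ⟨hx.1.1, hx.2⟩
  refine ⟨fun e he => le_antisymm ?_ ?_, ?_⟩
  · refine Measure.le_iff.2 fun B hB => ?_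
    rw [Measure.restrict_apply hB]
    refine (hle _).trans ?_
    rw [hNapp _ (hB.inter (hS e he)), ← hsum' e he B hB]
  · refine Measure.le_iff.2 fun B hB => ?_
    rw [Measure.restrict_apply hB]
    have h1 : ν e ≤ ⨆ e ∈ P, ν e := le_iSup₂ (f := fun e (_ : e ∈ P) => ν e) e he
    refine le_trans ?_ (h1 _)
    rw [← measure_inter_add_sdiff B (hS e he)]
    have : ν e (B \ S e) = 0 := measure_mono_null (fun x hx => hx.2) (h0 e he)
    rw [this, add_zero]
  · refine le_antisymm ((hle _).trans ?_) bot_le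
    rw [hNapp _ (MeasurableSet.iUnion fun k => hS _ (hcP k)).compl]
    refine (Finset.sum_eq_zero fun k _ => ?_).le
    have : (⋃ k, S (c k))ᶜ ∩ A k = ∅ := by
      ext x
      simp only [mem_inter_iff, mem_compl_iff, mem_iUnion, not_exists, mem_empty_iff_false,
        iff_false, not_and]
      exact fun h hx => h k (hAS k hx)
    rw [this, measure_empty]

end AbstractMeasure

/-! ### The Riemannian measure and integration in charts. -/

section ChartMeasure

variable {n : ℕ} [NeZero n] {X : Type*} [TopologicalSpace X] [T2Space X]
  [ChartedSpace (EuclideanHalfSpace n) X] [IsManifold (𝓡∂ n) ∞ X]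
  [MeasurableSpace X] [BorelSpace X] {g : BilinField n X}
  {e e' : OpenPartialHomeomorph X (EuclideanHalfSpace n)}

lemma density_nonneg (b : E n →L[ℝ] E n →L[ℝ] ℝ) : 0 ≤ density b := Real.sqrt_nonneg _

lemma continuousOn_symm_chartDomain : ContinuousOn (e.extend (𝓡∂ n)).symm (chartDomain e) :=
  e.continuousOn_extend_symm.mono interior_subset

lemma injOn_symm_chartDomain : InjOn (e.extend (𝓡∂ n)).symm (chartDomain e) := by
  intro y hy z hz h
  rw [← extend_extend_symm (interior_subset hy), h, extend_extend_symm (interior_subset hz)]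

lemma measurableSet_chartDomain : MeasurableSet (chartDomain e) := isOpen_interior.measurableSet

lemma aemeasurable_symm :
    AEMeasurable (e.extend (𝓡∂ n)).symm ((volume : Measure (E n)).restrict (chartDomain e)) :=
  continuousOn_symm_chartDomain.aemeasurable measurableSet_chartDomain

variable (g e) in
/-- The measure `√(det g_{ij}) dy` on the domain of the coordinates. -/
def coordVolume : Measure (E n) :=
  ((volume : Measure (E n)).restrict (chartDomain e)).withDensity
    fun y => ENNReal.ofReal (density (coordBilin g e y))

lemma chartVolume_eq : chartVolume g e = (coordVolume g e).map (e.extend (𝓡∂ n)).symm := rfl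

lemma coordVolume_absolutelyContinuous :
    coordVolume g e ≪ (volume : Measure (E n)).restrict (chartDomain e) :=
  withDensity_absolutelyContinuous _ _

lemma chartVolume_apply {A : Set X} (hA : MeasurableSet A) :
    chartVolume g e A = ∫⁻ y in (e.extend (𝓡∂ n)).symm ⁻¹' A ∩ chartDomain e,
      ENNReal.ofReal (density (coordBilin g e y)) := by
  rw [chartVolume_eq, Measure.map_apply_of_aemeasurable
    (aemeasurable_symm.mono_ac coordVolume_absolutelyContinuous) hA, coordVolume,
    withDensity_apply', Measure.restrict_restrict' measurableSet_chartDomain]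

variable (e) in
/-- The part of the domain of a chart that lies in the interior of the manifold. -/
def interiorSource : Set X := e.source ∩ (𝓡∂ n).interior X

lemma isOpen_interior_manifold : IsOpen ((𝓡∂ n).interior X) :=
  (𝓡∂ n).isOpen_interior (n := ∞) (by simp)

lemma isOpen_interiorSource : IsOpen (interiorSource e) :=
  e.open_source.inter isOpen_interior_manifold

lemma symm_mem_interiorSource (he : e ∈ smoothCharts n X) {y : E n} (hy : y ∈ chartDomain e) :
    (e.extend (𝓡∂ n)).symm y ∈ interiorSource e :=
  ⟨symm_mem_source (interior_subset hy), symm_mem_interior he hy⟩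

lemma chartVolume_compl (he : e ∈ smoothCharts n X) : chartVolume g e (interiorSource e)ᶜ = 0 := by
  rw [chartVolume_apply isOpen_interiorSource.measurableSet.compl]
  have : (e.extend (𝓡∂ n)).symm ⁻¹' (interiorSource e)ᶜ ∩ chartDomain e = ∅ := by
    ext y
    simp only [mem_inter_iff, mem_preimage, mem_compl_iff, mem_empty_iff_false, iff_false, not_and]
    exact fun h hy => h (symm_mem_interiorSource he hy)
  rw [this]
  simp

/-- Change of variables: the Gram determinant is multiplied by the square of the Jacobian
determinant, so its root absorbs exactly the absolute value in the substitution formula. -/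
lemma chartVolume_compatible (he : e ∈ smoothCharts n X) (he' : e' ∈ smoothCharts n X) {A : Set X}
    (hA : MeasurableSet A) (hAe : A ⊆ interiorSource e) (hAe' : A ⊆ interiorSource e') :
    chartVolume g e A = chartVolume g e' A := by
  rw [chartVolume_apply hA, chartVolume_apply hA]
  set D := (e.extend (𝓡∂ n)).symm ⁻¹' A ∩ chartDomain e with hD
  have himage : (e'.extend (𝓡∂ n)).symm ⁻¹' A ∩ chartDomain e' = coordChange e e' '' D := by
    ext z
    constructor
    · rintro ⟨hz, hz'⟩
      have h1 : (e'.extend (𝓡∂ n)).symm z ∈ e.source := (hAe hz).1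
      refine ⟨coordChange e' e z, ⟨?_, coordChange_mem_chartDomain he' he hz' h1⟩,
        coordChange_coordChange (interior_subset hz') h1⟩
      rwa [mem_preimage, symm_coordChange h1]
    · rintro ⟨y, ⟨hy, hy'⟩, rfl⟩
      have h1 : (e.extend (𝓡∂ n)).symm y ∈ e'.source := (hAe' hy).1
      exact ⟨by rwa [mem_preimage, symm_coordChange h1], coordChange_mem_chartDomain he he' hy' h1⟩
  -- The inverse chart is continuous only on the chart domain, so measurability is obtained on that
  -- subtype and then pushed to ℝⁿ.
  have hDm : MeasurableSet D := by
    have h1 : D = Subtype.val '' ((chartDomain e).domRestrict (e.extend (𝓡∂ n)).symm ⁻¹' A) := by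
      ext y
      constructor
      · exact fun hy => ⟨⟨y, hy.2⟩, hy.1, rfl⟩
      · rintro ⟨z, hz, rfl⟩
        exact ⟨hz, z.2⟩
    rw [h1]
    exact measurableSet_chartDomain.subtype_image
      ((continuousOn_iff_continuous_domRestrict.1 continuousOn_symm_chartDomain).measurable hA)
  rw [himage, lintegral_image_eq_lintegral_abs_det_fderiv_mul volume hDm
    (f' := fderiv ℝ (coordChange e e')) ?_ ?_]
  · refine setLIntegral_congr_fun hDm fun y hy => ?_
    have h1 : (e.extend (𝓡∂ n)).symm y ∈ e'.source := (hAe' hy.1).1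
    rw [coordBilin_coordChange g he he' hy.2 h1, density, det_gram_comp,
      Real.sqrt_mul (sq_nonneg _), Real.sqrt_sq_eq_abs, ENNReal.ofReal_mul (abs_nonneg _)]
    rfl
  · intro y hy
    exact ((contDiffAt_coordChange he he' hy.2 (hAe' hy.1).1).differentiableAt
      (by simp)).hasFDerivAt.hasFDerivWithinAt
  · intro y hy z hz h
    rw [← coordChange_coordChange (interior_subset hy.2) (hAe' hy.1).1, h,
      coordChange_coordChange (interior_subset hz.2) (hAe' hz.1).1]

lemma exists_finite_charts [CompactSpace X] :
    ∃ (m : ℕ) (c : Fin m → X), ⋃ k, (chartAt (EuclideanHalfSpace n) (c k)).source = univ := by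
  obtain ⟨t, ht⟩ := isCompact_univ.elim_finite_subcover
    (fun x : X => (chartAt (EuclideanHalfSpace n) x).source) (fun x => (chartAt _ x).open_source)
    (fun x _ => mem_iUnion.2 ⟨x, mem_chart_source _ x⟩)
  refine ⟨t.card, fun k => (t.equivFin.symm k : X), eq_univ_of_forall fun x => ?_⟩
  obtain ⟨i, hi, hx⟩ := mem_iUnion₂.1 (ht (mem_univ x))
  exact mem_iUnion.2 ⟨t.equivFin ⟨i, hi⟩, by simpa using hx⟩

/-- Compactness provides the finite cover by charts that the gluing requires. -/
lemma riemVolume_restrict_and_compl [CompactSpace X] (g : BilinField n X) :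
    (∀ e ∈ smoothCharts n X, (riemVolume g).restrict (interiorSource e) = chartVolume g e) ∧
      riemVolume g ((𝓡∂ n).interior X)ᶜ = 0 := by
  obtain ⟨m, c, hc⟩ := exists_finite_charts (n := n) (X := X)
  have hcov : ⋃ k, interiorSource (chartAt (EuclideanHalfSpace n) (c k)) = (𝓡∂ n).interior X := by
    simp only [interiorSource]
    rw [← iUnion_inter, hc, univ_inter]
  have h := restrict_iSup_of_compatible (P := smoothCharts n X) (ν := chartVolume g)
    (S := interiorSource) (fun e _ => isOpen_interiorSource.measurableSet)
    (fun e he => chartVolume_compl he)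
    (fun e he e' he' A hA h1 h2 => chartVolume_compatible he he' hA h1 h2)
    (c := fun k => chartAt (EuclideanHalfSpace n) (c k))
    (fun k => IsManifold.chart_mem_maximalAtlas _) (fun e he => by rw [hcov]; exact inter_subset_right)
  rw [hcov] at h
  exact h

lemma riemVolume_restrict [CompactSpace X] (he : e ∈ smoothCharts n X) :
    (riemVolume g).restrict (interiorSource e) = chartVolume g e :=
  (riemVolume_restrict_and_compl g).1 e he

lemma ae_mem_interior [CompactSpace X] : ∀ᵐ x ∂(riemVolume g), x ∈ (𝓡∂ n).interior X :=
  (riemVolume_restrict_and_compl g).2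

/-- The inverse chart need not be measurable off the chart domain. On that subtype both it and the
inclusion are measurable embeddings, so integrals and measurability pass freely between X and ℝⁿ
through m. -/
lemma exists_measure_map_eq : ∃ m : Measure (chartDomain e),
    m.map Subtype.val = coordVolume g e ∧
    m.map ((chartDomain e).domRestrict (e.extend (𝓡∂ n)).symm) = chartVolume g e ∧
    MeasurableEmbedding ((chartDomain e).domRestrict (e.extend (𝓡∂ n)).symm) := by
  have hval : MeasurableEmbedding (Subtype.val : chartDomain e → E n) :=
    .subtype_coe measurableSet_chartDomain
  have h1 : ((coordVolume g e).comap (Subtype.val : chartDomain e → E n)).map Subtype.val = coordVolume g e := by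
    rw [hval.map_comap, Subtype.range_coe, coordVolume, restrict_withDensity measurableSet_chartDomain,
      Measure.restrict_restrict measurableSet_chartDomain, inter_self]
  refine ⟨(coordVolume g e).comap (Subtype.val : chartDomain e → E n), h1, ?_, ?_⟩
  · rw [chartVolume_eq]
    conv_rhs => rw [← h1]
    rw [AEMeasurable.map_map_of_aemeasurable _ hval.measurable.aemeasurable]
    · rfl
    · rw [h1]
      exact aemeasurable_symm.mono_ac coordVolume_absolutelyContinuous
  · exact continuousOn_symm_chartDomain.measurableEmbedding measurableSet_chartDomain
      injOn_symm_chartDomain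

lemma aestronglyMeasurable_chartVolume {F : X → ℝ}
    (h : AEStronglyMeasurable (fun y => F ((e.extend (𝓡∂ n)).symm y))
      ((volume : Measure (E n)).restrict (chartDomain e))) :
    AEStronglyMeasurable F (chartVolume g e) := by
  obtain ⟨m, h1, h2, h3⟩ := exists_measure_map_eq (g := g) (e := e)
  have hval : MeasurableEmbedding (Subtype.val : chartDomain e → E n) :=
    .subtype_coe measurableSet_chartDomain
  rw [← h2, h3.aestronglyMeasurable_map_iff]
  have h4 := h.mono_ac (coordVolume_absolutelyContinuous (g := g))
  rwa [← h1, hval.aestronglyMeasurable_map_iff] at h4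

lemma integral_chartVolume {F : X → ℝ}
    (hwc : ContinuousOn (fun y => density (coordBilin g e y)) (chartDomain e)) :
    ∫ x, F x ∂(chartVolume g e) =
      ∫ y in chartDomain e, F ((e.extend (𝓡∂ n)).symm y) * density (coordBilin g e y) := by
  obtain ⟨m, h1, h2, h3⟩ := exists_measure_map_eq (g := g) (e := e)
  have hval : MeasurableEmbedding (Subtype.val : chartDomain e → E n) :=
    .subtype_coe measurableSet_chartDomain
  rw [← h2, h3.integral_map]
  have h4 := hval.integral_map (μ := m) fun y => F ((e.extend (𝓡∂ n)).symm y)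
  rw [h1] at h4
  refine h4.symm.trans ?_
  rw [coordVolume, integral_withDensity_eq_integral_toReal_smul₀
    (hwc.aemeasurable measurableSet_chartDomain).ennreal_ofReal (by simp)]
  refine integral_congr_ae (Eventually.of_forall fun y => ?_)
  simp only [smul_eq_mul]
  rw [ENNReal.toReal_ofReal (density_nonneg _), mul_comm]

lemma integrable_chartVolume_iff {F : X → ℝ}
    (hwc : ContinuousOn (fun y => density (coordBilin g e y)) (chartDomain e)) :
    Integrable F (chartVolume g e) ↔
      IntegrableOn (fun y => F ((e.extend (𝓡∂ n)).symm y) * density (coordBilin g e y))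
        (chartDomain e) := by
  obtain ⟨m, h1, h2, h3⟩ := exists_measure_map_eq (g := g) (e := e)
  have hval : MeasurableEmbedding (Subtype.val : chartDomain e → E n) :=
    .subtype_coe measurableSet_chartDomain
  rw [← h2, h3.integrable_map_iff]
  have h4 := hval.integrable_map_iff (μ := m) (g := fun y => F ((e.extend (𝓡∂ n)).symm y))
  rw [h1] at h4
  refine h4.symm.trans ?_
  rw [coordVolume, integrable_withDensity_iff_integrable_smul₀'
    (hwc.aemeasurable measurableSet_chartDomain).ennreal_ofReal (by simp), IntegrableOn]
  refine integrable_congr (Eventually.of_forall fun y => ?_)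
  simp only [smul_eq_mul]
  rw [ENNReal.toReal_ofReal (density_nonneg _), mul_comm]

end ChartMeasure

/-! ### Metrics with a conformal compactification: curvature and divergence up to the boundary. -/

section Conformal

variable {n : ℕ} [NeZero n] {X : Type*} [TopologicalSpace X]
  [ChartedSpace (EuclideanHalfSpace n) X] [IsManifold (𝓡∂ n) ∞ X]

/-- The metric `g` on the interior is `ρ⁻² ḡ` for a metric `ḡ` of class `C²` up to the boundary and
a defining function `ρ` with `|dρ|_ḡ = 1` along the boundary. -/
structure IsCompactified (g gbar : BilinField n X) (ρ : X → ℝ) : Prop where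
  isDefiningFunction : IsDefiningFunction n ρ
  isInner : ∀ x, IsInner (n := n) (gbar x)
  contDiffOn : ∀ e ∈ smoothCharts n X, ContDiffOn ℝ 2 (coordBilin gbar e) (e.extend (𝓡∂ n)).target
  conformal : ∀ x ∈ (𝓡∂ n).interior X, ∀ v w : TangentSpace (𝓡∂ n) x,
    gbar x v w = ρ x ^ 2 * g x v w
  boundary : ∀ x ∈ (𝓡∂ n).boundary X, normSqAt gbar (differential ρ) x = 1

lemma IsAsymptoticallyHyperbolic.exists_isCompactified {l : ℕ} (hl : 2 ≤ l) {β : ℝ≥0}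
    {g : BilinField n X} (hg : IsAsymptoticallyHyperbolic l β g) :
    ∃ gbar ρ, IsCompactified g gbar ρ := by
  obtain ⟨ρ, gbar, h1, h2, h3, h4⟩ := hg
  exact ⟨gbar, ρ, h1, fun x => ⟨h2.symm x, h2.pos x⟩,
    fun e he => (h2.contDiffOn e he).of_le (by exact_mod_cast hl), h3, h4⟩

namespace IsCompactified

variable {g gbar : BilinField n X} {ρ : X → ℝ} (h : IsCompactified g gbar ρ)
  {e : OpenPartialHomeomorph X (EuclideanHalfSpace n)} {x : X} {y : E n}
include h

lemma pos (hx : x ∈ (𝓡∂ n).interior X) : 0 < ρ x := by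
  refine lt_of_le_of_ne (h.isDefiningFunction.nonneg x) fun h0 => ?_
  have := (h.isDefiningFunction.eq_zero_iff x).1 h0.symm
  exact disjoint_left.1 (𝓡∂ n).disjoint_interior_boundary hx this

lemma mem_interior (hx : 0 < ρ x) : x ∈ (𝓡∂ n).interior X := by
  by_contra hx'
  have h1 : x ∈ (𝓡∂ n).boundary X := by rw [← (𝓡∂ n).compl_interior]; exact hx'
  exact hx.ne' ((h.isDefiningFunction.eq_zero_iff x).2 h1)

lemma eq_smul (hx : x ∈ (𝓡∂ n).interior X) :
    (g x : E n →L[ℝ] E n →L[ℝ] ℝ) = (ρ x ^ 2)⁻¹ • (gbar x : E n →L[ℝ] E n →L[ℝ] ℝ) := by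
  ext v w
  have h1 := h.conformal x hx v w
  have h2 := (h.pos hx).ne'
  change g x v w = (ρ x ^ 2)⁻¹ * gbar x v w
  rw [h1]
  field_simp

lemma isInner_g (hx : x ∈ (𝓡∂ n).interior X) : IsInner (n := n) (g x) := by
  have := (h.isInner x).smul (inv_pos.2 (pow_pos (h.pos hx) 2))
  exact (h.eq_smul hx).symm ▸ this

lemma pairAt_eq (hx : x ∈ (𝓡∂ n).interior X) (θ η : CovectorField n X) :
    pairAt g θ η x = ρ x ^ 2 * pairAt gbar θ η x := by
  have h1 := coPair_smul_form (inv_ne_zero (pow_ne_zero 2 (h.pos hx).ne')) (h.isInner x)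
    (θ x) (η x)
  rw [inv_inv] at h1
  exact (congrArg (fun b => coPair (n := n) b (θ x) (η x)) (h.eq_smul hx)).trans h1

lemma isInner_coord (he : e ∈ smoothCharts n X) (hy : y ∈ (e.extend (𝓡∂ n)).target) :
    IsInner (coordBilin gbar e y) :=
  isInner_coordBilin he hy (h.isInner _)

lemma contDiffOn_rho (he : e ∈ smoothCharts n X) :
    ContDiffOn ℝ 2 (fun z => ρ ((e.extend (𝓡∂ n)).symm z)) (e.extend (𝓡∂ n)).target :=
  (contDiffOn_symm he h.isDefiningFunction.smooth).of_le (by norm_cast)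

lemma rho_pos_chart (he : e ∈ smoothCharts n X) (hy : y ∈ chartDomain e) :
    0 < ρ ((e.extend (𝓡∂ n)).symm y) :=
  h.pos (symm_mem_interior he hy)

lemma coordBilin_eq (he : e ∈ smoothCharts n X) (hy : y ∈ chartDomain e) :
    coordBilin g e y = (ρ ((e.extend (𝓡∂ n)).symm y) ^ 2)⁻¹ • coordBilin gbar e y := by
  rw [coordBilin, h.eq_smul (symm_mem_interior he hy)]
  rfl

lemma contDiffOn_coordBilin (he : e ∈ smoothCharts n X) :
    ContDiffOn ℝ 2 (coordBilin g e) (chartDomain e) := by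
  refine ContDiffOn.congr (f := fun y =>
    (ρ ((e.extend (𝓡∂ n)).symm y) ^ 2)⁻¹ • coordBilin gbar e y) ?_ fun y hy => h.coordBilin_eq he hy
  exact ((((h.contDiffOn_rho he).mono interior_subset).pow 2).inv
    fun y hy => pow_ne_zero 2 (h.rho_pos_chart he hy).ne').smul
    ((h.contDiffOn e he).mono interior_subset)

lemma isInner_coordBilin_g (he : e ∈ smoothCharts n X) (hy : y ∈ chartDomain e) :
    IsInner (coordBilin g e y) :=
  isInner_coordBilin he (interior_subset hy) (h.isInner_g (symm_mem_interior he hy))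

lemma continuousOn_density (he : e ∈ smoothCharts n X) :
    ContinuousOn (fun y => density (coordBilin g e y)) (chartDomain e) := fun y hy =>
  (contDiffWithinAt_density (h.contDiffOn_coordBilin he y hy)
    (h.isInner_coordBilin_g he hy)).continuousWithinAt

lemma mdifferentiableAt_rho : MDifferentiableAt (𝓡∂ n) 𝓘(ℝ, ℝ) ρ x :=
  (h.isDefiningFunction.smooth x).mdifferentiableAt (by simp)

lemma coordCovector_differential_rho (he : e ∈ smoothCharts n X)
    (hy : y ∈ (e.extend (𝓡∂ n)).target) : coordCovector (differential (n := n) ρ) e y =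
      fderivWithin ℝ (fun z => ρ ((e.extend (𝓡∂ n)).symm z)) (e.extend (𝓡∂ n)).target y :=
  coordCovector_differential he hy h.mdifferentiableAt_rho

lemma continuous_pairAt {f₁ f₂ : X → ℝ} (hf₁ : ContMDiff (𝓡∂ n) 𝓘(ℝ, ℝ) ∞ f₁)
    (hf₂ : ContMDiff (𝓡∂ n) 𝓘(ℝ, ℝ) ∞ f₂) :
    Continuous (pairAt gbar (differential f₁) (differential f₂)) := by
  refine continuous_of_forall_chart (n := n) fun e he => ?_
  have hd : ∀ f : X → ℝ, ContMDiff (𝓡∂ n) 𝓘(ℝ, ℝ) ∞ f →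
      ContinuousOn (coordCovector (differential (n := n) f) e) (e.extend (𝓡∂ n)).target := by
    intro f hf
    refine ContinuousOn.congr ((contDiffOn_symm he hf).continuousOn_fderivWithin
      uniqueDiffOn_target (by simp)) fun y hy => ?_
    exact coordCovector_differential he hy ((hf _).mdifferentiableAt (by simp))
  refine (continuousOn_coPair (h.contDiffOn e he).continuousOn (hd f₁ hf₁) (hd f₂ hf₂)
    fun y hy => h.isInner_coord he hy).congr fun y hy => pairAt_symm _ _ _ he hy

lemma continuous_normSqAt : Continuous (normSqAt gbar (differential ρ)) :=
  h.continuous_pairAt h.isDefiningFunction.smooth h.isDefiningFunction.smooth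

/-- The scalar curvature at a point is defined in the preferred chart of that point, which jumps
from point to point. Coordinate invariance replaces it by the fixed chart e, where continuity can be
discussed. -/
lemma scal_eq (he : e ∈ smoothCharts n X) (hy : y ∈ chartDomain e) :
    scal g ((e.extend (𝓡∂ n)).symm y) = scalT (e.extend (𝓡∂ n)).target (coordBilin gbar e)
      (fun z => ρ ((e.extend (𝓡∂ n)).symm z)) y := by
  rw [← coordScal_conformal uniqueDiffOn_target (h.contDiffOn e he) (h.contDiffOn_rho he)
    (fun z hz => h.isInner_coord he hz) (fun z hz => h.rho_pos_chart he hz)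
    (fun z hz => h.coordBilin_eq he hz) hy]
  set x := (e.extend (𝓡∂ n)).symm y
  have he' := IsManifold.chart_mem_maximalAtlas (I := 𝓡∂ n) (n := ∞) x
  have hx : x ∈ (chartAt (EuclideanHalfSpace n) x).source := mem_chart_source _ x
  have hy' := coordChange_mem_chartDomain he he' hy hx
  have hopen : ∀ᶠ z in 𝓝 (coordChange e (chartAt (EuclideanHalfSpace n) x) y),
      z ∈ chartDomain (chartAt (EuclideanHalfSpace n) x) := isOpen_interior.mem_nhds hy'
  symm
  refine coordScal_transform (ψ := coordChange e (chartAt (EuclideanHalfSpace n) x))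
    ((h.contDiffOn_coordBilin he').contDiffAt hopen)
    (hopen.mono fun z hz => h.isInner_coordBilin_g he' hz)
    ((contDiffAt_coordChange he he' hy hx).of_le (by norm_cast))
    (det_coordChange_ne_zero he he' hy hx) ?_
    ((h.contDiffOn_coordBilin he).contDiffAt (isOpen_interior.mem_nhds hy))
  filter_upwards [eventually_symm_mem hy hx] with z hz
  exact coordBilin_coordChange g he he' hz.1 hz.2

lemma mem_boundary_of_notMem_chartDomain (he : e ∈ smoothCharts n X)
    (hy : y ∈ (e.extend (𝓡∂ n)).target) (hy' : y ∉ chartDomain e) :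
    (e.extend (𝓡∂ n)).symm y ∈ (𝓡∂ n).boundary X := by
  rw [← (𝓡∂ n).compl_interior]
  intro hx
  apply hy'
  rw [← extend_extend_symm hy]
  exact extend_mem_chartDomain he (symm_mem_source hy) hx

lemma covectorNormSq_boundary (he : e ∈ smoothCharts n X)
    (hy : y ∈ (e.extend (𝓡∂ n)).target) (hx : (e.extend (𝓡∂ n)).symm y ∈ (𝓡∂ n).boundary X) :
    covectorNormSq (coordBilin gbar e y) (fderivWithin ℝ (fun z => ρ ((e.extend (𝓡∂ n)).symm z))
      (e.extend (𝓡∂ n)).target y) = 1 := by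
  rw [← h.coordCovector_differential_rho he hy, ← normSqAt_symm _ _ he hy, h.boundary _ hx]

omit h in
variable (g) in
open Classical in
/-- The scalar curvature, extended to the boundary by its limit. -/
def scalExt (x : X) : ℝ :=
  if x ∈ (𝓡∂ n).interior X then scal g x else -(n * (n - 1))

/-- In every chart this function is `scalT`, also at boundary points, since |dρ|_ḡ = 1 there. -/
lemma continuous_scalExt : Continuous (scalExt g) := by
  refine continuous_of_forall_chart (n := n) fun e he => ?_
  refine (continuousOn_scalT uniqueDiffOn_target (h.contDiffOn e he) (h.contDiffOn_rho he)
    (fun z hz => h.isInner_coord he hz)).congr fun y hy => ?_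
  by_cases hy' : y ∈ chartDomain e
  · rw [scalExt, if_pos (symm_mem_interior he hy'), h.scal_eq he hy']
  · have hb := h.mem_boundary_of_notMem_chartDomain he hy hy'
    have hni : (e.extend (𝓡∂ n)).symm y ∉ (𝓡∂ n).interior X := by
      rw [← (𝓡∂ n).compl_interior] at hb
      exact hb
    rw [scalExt, if_neg hni, scalT_of_eq_zero (h.isInner_coord he hy)
      ((h.isDefiningFunction.eq_zero_iff _).2 hb), h.covectorNormSq_boundary he hy hb, mul_one]

omit h in
variable (gbar ρ e) in
/-- The divergence of `ρ ∇ρ` computed in the chart `e`, as a function on the manifold. -/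
def chartDiv (x : X) : ℝ :=
  divT (e.extend (𝓡∂ n)).target (coordBilin gbar e) (fun z => ρ ((e.extend (𝓡∂ n)).symm z))
    (e.extend (𝓡∂ n) x)

lemma continuousOn_chartDiv (he : e ∈ smoothCharts n X) :
    ContinuousOn (chartDiv gbar ρ e) e.source := by
  have h1 := (continuousOn_divT uniqueDiffOn_target ((h.contDiffOn e he).of_le (by norm_num))
    (h.contDiffOn_rho he) (fun z hz => h.isInner_coord he hz)).comp
    (e.continuousOn_extend (I := 𝓡∂ n))
    (by rw [e.extend_source]; exact fun z hz => extend_mem_target hz)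
  rwa [e.extend_source] at h1

lemma chartDiv_boundary (he : e ∈ smoothCharts n X) (hx : x ∈ e.source)
    (hxb : x ∈ (𝓡∂ n).boundary X) : chartDiv gbar ρ e x = 1 - n := by
  have h1 : (e.extend (𝓡∂ n)).symm (e.extend (𝓡∂ n) x) ∈ (𝓡∂ n).boundary X := by
    rwa [extend_symm_extend hx]
  rw [chartDiv, divT_of_eq_zero ((h.isDefiningFunction.eq_zero_iff _).2 h1),
    h.covectorNormSq_boundary he (extend_mem_target hx) h1, mul_one]

end IsCompactified

end Conformal

/-! ### Leibniz and chain rules for differentials and their pairings. -/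

section Differential

variable {n : ℕ} [NeZero n] {X : Type*} [TopologicalSpace X]
  [ChartedSpace (EuclideanHalfSpace n) X] {x : X}

lemma differential_mul {f₁ f₂ : X → ℝ} (h₁ : MDifferentiableAt (𝓡∂ n) 𝓘(ℝ, ℝ) f₁ x)
    (h₂ : MDifferentiableAt (𝓡∂ n) 𝓘(ℝ, ℝ) f₂ x) :
    (differential (n := n) (fun x => f₁ x * f₂ x) x : E n →L[ℝ] ℝ) =
      f₁ x • (differential (n := n) f₂ x : E n →L[ℝ] ℝ) +
        f₂ x • (differential (n := n) f₁ x : E n →L[ℝ] ℝ) :=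
  (h₁.hasMFDerivAt.mul h₂.hasMFDerivAt).mfderiv

lemma differential_comp {f : X → ℝ} {H : ℝ → ℝ} (hH : DifferentiableAt ℝ H (f x))
    (hf : MDifferentiableAt (𝓡∂ n) 𝓘(ℝ, ℝ) f x) :
    (differential (n := n) (fun x => H (f x)) x : E n →L[ℝ] ℝ) =
      deriv H (f x) • (differential (n := n) f x : E n →L[ℝ] ℝ) := by
  have h1 : ∀ (A : ℝ →L[ℝ] ℝ) (L : E n →L[ℝ] ℝ), A.comp L = A 1 • L := fun A L => by
    ext v
    have := A.map_smul (L v) 1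
    simp only [smul_eq_mul, mul_one] at this
    simp [this, mul_comm]
  exact (hH.hasFDerivAt.hasMFDerivAt.comp x hf.hasMFDerivAt).mfderiv.trans (h1 _ _)

lemma differential_of_notMem_tsupport {f : X → ℝ} (hx : x ∉ tsupport f) :
    (differential (n := n) f x : E n →L[ℝ] ℝ) = 0 := by
  have h1 := (notMem_tsupport_iff_eventuallyEq.1 hx).mfderiv_eq (I := 𝓡∂ n) (I' := 𝓘(ℝ, ℝ))
  refine h1.trans ?_
  exact mfderiv_const

lemma pairAt_of_notMem_tsupport (b : BilinField n X) (η : CovectorField n X) {f : X → ℝ}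
    (hx : x ∉ tsupport f) : pairAt b (differential f) η x = 0 := by
  have h1 := coPair_smul_left (n := n) (b x) 0 0 (η x)
  rw [zero_smul, zero_mul] at h1
  exact (congrArg (fun θ => coPair (n := n) (b x) θ (η x))
    (differential_of_notMem_tsupport hx)).trans h1

lemma pairAt_differential_mul (b : BilinField n X) (η : CovectorField n X) {f₁ f₂ : X → ℝ}
    (h₁ : MDifferentiableAt (𝓡∂ n) 𝓘(ℝ, ℝ) f₁ x) (h₂ : MDifferentiableAt (𝓡∂ n) 𝓘(ℝ, ℝ) f₂ x) :
    pairAt b (differential fun x => f₁ x * f₂ x) η x =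
      f₁ x * pairAt b (differential f₂) η x + f₂ x * pairAt b (differential f₁) η x :=
  (congrArg (fun θ => coPair (n := n) (b x) θ (η x)) (differential_mul h₁ h₂)).trans
    ((coPair_add_left _ _ _ _).trans
      (congrArg₂ (· + ·) (coPair_smul_left _ _ _ _) (coPair_smul_left _ _ _ _)))

lemma pairAt_differential_comp (b : BilinField n X) (η : CovectorField n X) {f : X → ℝ}
    {H : ℝ → ℝ} (hH : DifferentiableAt ℝ H (f x))
    (hf : MDifferentiableAt (𝓡∂ n) 𝓘(ℝ, ℝ) f x) :
    pairAt b (differential fun x => H (f x)) η x =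
      deriv H (f x) * pairAt b (differential f) η x :=
  (congrArg (fun θ => coPair (n := n) (b x) θ (η x)) (differential_comp hH hf)).trans
    (coPair_smul_left _ _ _ _)

end Differential

/-! ### Integration by parts along ρ∇ρ with compactly supported test functions. -/

namespace IsCompactified

variable {n : ℕ} [NeZero n] {X : Type*} [TopologicalSpace X] [T2Space X] [CompactSpace X]
  [ChartedSpace (EuclideanHalfSpace n) X] [IsManifold (𝓡∂ n) ∞ X]
  [MeasurableSpace X] [BorelSpace X]
  {g gbar : BilinField n X} {ρ : X → ℝ} (h : IsCompactified g gbar ρ)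
  {e : OpenPartialHomeomorph X (EuclideanHalfSpace n)} {u : X → ℝ} {θ : CovectorField n X}

/-- The derivative of a function with differential `θ` along the vector field `ρ ∇ρ`. -/
def radial (gbar : BilinField n X) (ρ : X → ℝ) (θ : CovectorField n X) (x : X) : ℝ :=
  ρ x * pairAt gbar θ (differential ρ) x

include h

lemma continuous_radial {f : X → ℝ} (hf : ContMDiff (𝓡∂ n) 𝓘(ℝ, ℝ) ∞ f) :
    Continuous (radial gbar ρ (differential f)) :=
  h.isDefiningFunction.smooth.continuous.mul
    (h.continuous_pairAt hf h.isDefiningFunction.smooth)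

lemma continuous_mul_chartDiv (he : e ∈ smoothCharts n X) {f : X → ℝ} (hf : Continuous f)
    (hfe : tsupport f ⊆ e.source) : Continuous fun x => f x * chartDiv gbar ρ e x :=
  (hf.continuousOn.mul (h.continuousOn_chartDiv he)).continuous_of_tsupport_subset e.open_source
    (tsupport_mul_subset_left.trans hfe)

lemma integrable_chart_of_integrable {F : X → ℝ} (he : e ∈ smoothCharts n X)
    (hF : Integrable F (riemVolume g)) :
    IntegrableOn (fun y => F ((e.extend (𝓡∂ n)).symm y) * density (coordBilin g e y))
      (chartDomain e) := by
  rw [← integrable_chartVolume_iff (h.continuousOn_density he), ← riemVolume_restrict he]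
  exact hF.restrict

/-- A weak differential is measurable only through its chart expressions, so measurability is
checked on finitely many chart domains that carry the whole measure. -/
lemma aestronglyMeasurable_radial (hw : IsWeakDifferential u θ) :
    AEStronglyMeasurable (radial gbar ρ θ) (riemVolume g) := by
  obtain ⟨m, c, hc⟩ := exists_finite_charts (n := n) (X := X)
  have hcov : ⋃ k, interiorSource (chartAt (EuclideanHalfSpace n) (c k)) = (𝓡∂ n).interior X := by
    simp only [interiorSource]
    rw [← iUnion_inter, hc, univ_inter]
  have h1 := Measure.restrict_eq_self_of_ae_mem (ae_mem_interior (g := g))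
  rw [← h1, ← hcov, aestronglyMeasurable_iUnion_iff]
  intro k
  have he : chartAt (EuclideanHalfSpace n) (c k) ∈ smoothCharts n X :=
    IsManifold.chart_mem_maximalAtlas (c k)
  set e := chartAt (EuclideanHalfSpace n) (c k)
  rw [riemVolume_restrict he]
  refine aestronglyMeasurable_chartVolume ?_
  have h2 : ContinuousOn (fun y => sharp (coordBilin gbar e y)
      (coordCovector (differential (n := n) ρ) e y)) (chartDomain e) := by
    refine ((contDiffOn_sharp (k := 0) (contDiffOn_zero.2 (h.contDiffOn e he).continuousOn) ?_
      fun y hy => h.isInner_coord he hy).continuousOn).mono interior_subset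
    refine contDiffOn_zero.2 (((h.contDiffOn_rho he).continuousOn_fderivWithin
      uniqueDiffOn_target (by norm_num)).congr fun y hy => ?_)
    exact h.coordCovector_differential_rho he hy
  have h3 := (hw e he).2.1.aestronglyMeasurable
  have h4 : AEStronglyMeasurable (fun y => ρ ((e.extend (𝓡∂ n)).symm y) *
      coordCovector θ e y (sharp (coordBilin gbar e y)
        (coordCovector (differential (n := n) ρ) e y)))
      ((volume : Measure (E n)).restrict (chartDomain e)) :=
    (((h.contDiffOn_rho he).continuousOn.mono interior_subset).aestronglyMeasurable
      measurableSet_chartDomain).mul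
      (isBoundedBilinearMap_apply.continuous.comp_aestronglyMeasurable
        (h3.prodMk (h2.aestronglyMeasurable measurableSet_chartDomain)))
  refine h4.congr ?_
  refine (ae_restrict_iff' measurableSet_chartDomain).2 (Eventually.of_forall fun y hy => ?_)
  change _ = ρ _ * pairAt gbar θ (differential ρ) _
  rw [pairAt_symm _ _ _ he (interior_subset hy), coPair_eq_apply_sharp]

/-- Cauchy–Schwarz for ḡ; the factor ρ² turns |θ|²_ḡ into |θ|²_g. -/
lemma sq_radial_le {x : X} (hx : x ∈ (𝓡∂ n).interior X) :
    radial gbar ρ θ x ^ 2 ≤ normSqAt g θ x * normSqAt gbar (differential ρ) x := by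
  have h1 := (h.isInner x).sq_coPair_le (θ x) (differential (n := n) ρ x)
  have h2 := h.pairAt_eq hx θ θ
  change normSqAt g θ x = ρ x ^ 2 * normSqAt gbar θ x at h2
  rw [h2, radial, mul_pow, mul_assoc]
  exact mul_le_mul_of_nonneg_left h1 (sq_nonneg _)

lemma memLp_radial (hw : IsWeakDifferential u θ) (hθ : Integrable (normSqAt g θ) (riemVolume g)) :
    MemLp (radial gbar ρ θ) 2 (riemVolume g) := by
  have hm := h.aestronglyMeasurable_radial hw
  rw [memLp_two_iff_integrable_sq hm]
  obtain ⟨C, hC⟩ := isCompact_univ.exists_bound_of_continuousOn h.continuous_normSqAt.continuousOn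
  refine (hθ.mul_bdd (c := C) h.continuous_normSqAt.aestronglyMeasurable
    (Eventually.of_forall fun x => hC x (mem_univ x))).mono' (hm.pow 2) ?_
  filter_upwards [ae_mem_interior] with x hx
  rw [Real.norm_eq_abs, abs_of_nonneg (sq_nonneg _)]
  exact h.sq_radial_le hx

lemma integral_radial_chart (he : e ∈ smoothCharts n X) (hw : IsWeakDifferential u θ)
    (hu : MemLp u 2 (riemVolume g)) (hθ : Integrable (normSqAt g θ) (riemVolume g))
    {ζ : X → ℝ} (hζ : ContMDiff (𝓡∂ n) 𝓘(ℝ, ℝ) ∞ ζ) (hζe : tsupport ζ ⊆ interiorSource e) :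
    ∫ x, 2 * (u x * (ζ x * radial gbar ρ θ x)) ∂(riemVolume g) =
      -∫ x, u x ^ 2 * (radial gbar ρ (differential ζ) x + ζ x * chartDiv gbar ρ e x)
        ∂(riemVolume g) := by
  have hoff : ∀ x ∉ interiorSource e, ζ x = 0 := fun x hx =>
    image_eq_zero_of_notMem_tsupport fun h' => hx (hζe h')
  have hoff' : ∀ x ∉ interiorSource e, radial gbar ρ (differential ζ) x = 0 := fun x hx => by
    rw [radial, pairAt_of_notMem_tsupport _ _ fun h' => hx (hζe h'), mul_zero]
  rw [← setIntegral_eq_integral_of_forall_compl_eq_zero (s := interiorSource e)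
      fun x hx => by rw [hoff x hx]; ring,
    ← setIntegral_eq_integral_of_forall_compl_eq_zero (s := interiorSource e)
      (f := fun x => u x ^ 2 * (radial gbar ρ (differential ζ) x + ζ x * chartDiv gbar ρ e x))
      fun x hx => by rw [hoff x hx, hoff' x hx]; ring,
    riemVolume_restrict he, integral_chartVolume (h.continuousOn_density he),
    integral_chartVolume (h.continuousOn_density he)]
  have hts : tsupport ζ ⊆ e.source := fun x hx => (hζe hx).1
  have hK : IsCompact (e.extend (𝓡∂ n) '' tsupport ζ) :=
    (isClosed_tsupport ζ).isCompact.image_of_continuousOn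
      (e.continuousOn_extend.mono (by rwa [e.extend_source]))
  have key := integral_chart_parts (Ω := (e.extend (𝓡∂ n)).target) (G := coordBilin gbar e)
    (r := fun z => ρ ((e.extend (𝓡∂ n)).symm z)) (B := coordBilin g e) uniqueDiffOn_target
    ((h.contDiffOn e he).of_le (by norm_num)) (h.contDiffOn_rho he)
    (fun y hy => h.isInner_coord he hy) (fun y hy => h.rho_pos_chart he hy)
    (fun y hy => h.coordBilin_eq he hy) (a := fun y => u ((e.extend (𝓡∂ n)).symm y))
    (θ := coordCovector θ e) (hw e he).1.aestronglyMeasurable (hw e he).2.1.aestronglyMeasurable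
    (h.integrable_chart_of_integrable he hu.integrable_sq)
    ((h.integrable_chart_of_integrable he hθ).congr_fun (fun y hy => by
      change normSqAt g θ _ * _ = _
      rw [normSqAt_symm g θ he (interior_subset hy)]) measurableSet_chartDomain)
    (hw e he).2.2 (ζ := fun y => ζ ((e.extend (𝓡∂ n)).symm y))
    (((contDiffOn_symm he hζ).mono interior_subset).of_le (by norm_cast)) hK
    (by
      rintro _ ⟨x, hx, rfl⟩
      exact extend_mem_chartDomain he (hts hx) (hζe hx).2)
    fun y hy hyK => image_eq_zero_of_notMem_tsupport fun h' =>
      hyK ⟨_, h', extend_extend_symm (interior_subset hy)⟩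
  refine Eq.trans (setIntegral_congr_fun measurableSet_chartDomain fun y hy => ?_)
    (key.trans (congrArg Neg.neg (setIntegral_congr_fun measurableSet_chartDomain fun y hy => ?_)))
  · have hy' := interior_subset hy
    simp only [radial]
    rw [pairAt_symm _ _ _ he hy', h.coordCovector_differential_rho he hy']
  · have hy' := interior_subset hy
    simp only [radial]
    rw [pairAt_symm _ _ _ he hy', h.coordCovector_differential_rho he hy',
      coordCovector_differential he hy' ((hζ _).mdifferentiableAt (by simp)),
      fderivWithin_of_mem_nhds (f := fun z => ζ _) (mem_interior_iff_mem_nhds.1 hy), chartDiv, extend_extend_symm hy']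

/-- D is the sum over a partition of unity of V(χ_k) + χ_k div_k, with V = ρ∇ρ and div_k its
divergence computed in the k-th chart. Keeping the terms V(χ_k) makes it unnecessary to show that
the div_k agree. On the boundary they vanish because ρ does, leaving 1 - n. D is fixed before u, so
ε will not depend on u. -/
lemma exists_divergence : ∃ D : X → ℝ, Continuous D ∧ (∀ x ∈ (𝓡∂ n).boundary X, D x = 1 - n) ∧
    ∀ (u : X → ℝ) (θ : CovectorField n X), IsWeakDifferential u θ → MemLp u 2 (riemVolume g) →
      Integrable (normSqAt g θ) (riemVolume g) → ∀ ζ : X → ℝ, ContMDiff (𝓡∂ n) 𝓘(ℝ, ℝ) ∞ ζ →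
      tsupport ζ ⊆ (𝓡∂ n).interior X →
      ∫ x, 2 * (u x * (ζ x * radial gbar ρ θ x)) ∂(riemVolume g) =
        -∫ x, u x ^ 2 * (radial gbar ρ (differential ζ) x + ζ x * D x) ∂(riemVolume g) := by
  obtain ⟨m, c, hc⟩ := exists_finite_charts (n := n) (X := X)
  set e : Fin m → OpenPartialHomeomorph X (EuclideanHalfSpace n) := fun k => chartAt _ (c k)
  have he : ∀ k, e k ∈ smoothCharts n X := fun k => IsManifold.chart_mem_maximalAtlas (c k)
  obtain ⟨χ, hχ⟩ := SmoothPartitionOfUnity.exists_isSubordinate (𝓡∂ n) (isClosed_univ (X := X))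
    (fun k => (e k).source) (fun k => (e k).open_source) hc.ge
  have hsum : ∀ x, ∑ k, χ k x = 1 := fun x => by
    rw [← finsum_eq_sum_of_fintype]
    exact χ.sum_eq_one (mem_univ x)
  have hs : ∀ k, ContMDiff (𝓡∂ n) 𝓘(ℝ, ℝ) ∞ (χ k) := fun k => (χ k).contMDiff
  have hcd : ∀ k, Continuous fun x => χ k x * chartDiv gbar ρ (e k) x := fun k =>
    h.continuous_mul_chartDiv (he k) (hs k).continuous (hχ k)
  refine ⟨fun x => ∑ k, (radial gbar ρ (differential (χ k)) x + χ k x * chartDiv gbar ρ (e k) x),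
    continuous_finsetSum _ fun k _ => (h.continuous_radial (hs k)).add (hcd k), ?_, ?_⟩
  · intro x hx
    have h1 : ∀ k, radial gbar ρ (differential (χ k)) x + χ k x * chartDiv gbar ρ (e k) x =
        χ k x * (1 - n) := fun k => by
      rw [radial, (h.isDefiningFunction.eq_zero_iff x).2 hx, zero_mul, zero_add]
      by_cases hxk : x ∈ tsupport (χ k)
      · rw [h.chartDiv_boundary (he k) (hχ k hxk) hx]
      · rw [image_eq_zero_of_notMem_tsupport hxk, zero_mul, zero_mul]
    dsimp only
    rw [Finset.sum_congr rfl fun k _ => h1 k, ← Finset.sum_mul, hsum, one_mul]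
  · intro u θ hw hu hθ ζ hζ hζi
    have hbdd : ∀ {F f : X → ℝ}, Integrable F (riemVolume g) → Continuous f →
        Integrable (fun x => F x * f x) (riemVolume g) := by
      intro F f hF hf
      obtain ⟨C, hC⟩ := isCompact_univ.exists_bound_of_continuousOn hf.continuousOn
      exact hF.mul_bdd (c := C) hf.aestronglyMeasurable
        (Eventually.of_forall fun x => hC x (mem_univ x))
    have hp : ∀ k, ContMDiff (𝓡∂ n) 𝓘(ℝ, ℝ) ∞ fun x => χ k x * ζ x := fun k => (hs k).mul hζ
    have hchart := fun k => h.integral_radial_chart (he k) hw hu hθ (hp k) fun x hx =>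
      ⟨hχ k (tsupport_mul_subset_left hx), hζi (tsupport_mul_subset_right hx)⟩
    have hl : ∀ k, Integrable (fun x => 2 * (u x * (χ k x * ζ x * radial gbar ρ θ x)))
        (riemVolume g) := fun k => by
      refine (hbdd (hu.integrable_mul (h.memLp_radial hw hθ))
        ((hp k).continuous.const_mul 2)).congr (Eventually.of_forall fun x => ?_)
      simp only [Pi.mul_apply]
      ring
    have hr : ∀ k, Integrable (fun x => u x ^ 2 * (radial gbar ρ (differential fun x =>
        χ k x * ζ x) x + χ k x * ζ x * chartDiv gbar ρ (e k) x)) (riemVolume g) := fun k => by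
      refine hbdd hu.integrable_sq ((h.continuous_radial (hp k)).add ?_)
      refine ((hcd k).mul hζ.continuous).congr fun x => by simp only [Pi.mul_apply]; ring
    have e1 : ∀ x, 2 * (u x * (ζ x * radial gbar ρ θ x)) =
        ∑ k, 2 * (u x * (χ k x * ζ x * radial gbar ρ θ x)) := fun x => by
      rw [← Finset.mul_sum, ← Finset.mul_sum, ← Finset.sum_mul, ← Finset.sum_mul, hsum, one_mul]
    have e2 : ∀ x, u x ^ 2 * (radial gbar ρ (differential ζ) x + ζ x *
          ∑ k, (radial gbar ρ (differential (χ k)) x + χ k x * chartDiv gbar ρ (e k) x)) =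
        ∑ k, u x ^ 2 * (radial gbar ρ (differential fun x => χ k x * ζ x) x +
          χ k x * ζ x * chartDiv gbar ρ (e k) x) := fun x => by
      -- Leibniz for V(χ_k ζ): summed over k, the terms χ_k V(ζ) give V(ζ) and the rest is ζD.
      have h3 : ∀ k, radial gbar ρ (differential fun x => χ k x * ζ x) x +
          χ k x * ζ x * chartDiv gbar ρ (e k) x = χ k x * radial gbar ρ (differential ζ) x +
          ζ x * (radial gbar ρ (differential (χ k)) x + χ k x * chartDiv gbar ρ (e k) x) := by
        intro k
        rw [radial, pairAt_differential_mul _ _ ((hs k x).mdifferentiableAt (by simp))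
          ((hζ x).mdifferentiableAt (by simp)), radial, radial]
        ring
      rw [← Finset.mul_sum, Finset.sum_congr rfl fun k _ => h3 k,
        Finset.sum_add_distrib (f := fun k => χ k x * radial gbar ρ (differential ζ) x),
        ← Finset.sum_mul, ← Finset.mul_sum, hsum, one_mul]
    rw [integral_congr_ae (Eventually.of_forall e1), integral_congr_ae (Eventually.of_forall e2),
      integral_finsetSum _ fun k _ => hl k, integral_finsetSum _ fun k _ => hr k,
      ← Finset.sum_neg_distrib]
    exact Finset.sum_congr rfl fun k _ => hchart k

end IsCompactified

/-! ### A cutoff function on the line. -/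

section Cutoff

/-- A smooth function on the line that vanishes on `(-∞, 1]` and equals `1` on `[2, ∞)`. -/
def cutoff (t : ℝ) : ℝ := Real.smoothTransition (t - 1)

lemma contDiff_cutoff : ContDiff ℝ ∞ cutoff :=
  Real.smoothTransition.contDiff.comp (contDiff_id.sub contDiff_const)

lemma cutoff_of_le {t : ℝ} (ht : t ≤ 1) : cutoff t = 0 :=
  Real.smoothTransition.zero_of_nonpos (by linarith)

lemma cutoff_of_ge {t : ℝ} (ht : 2 ≤ t) : cutoff t = 1 :=
  Real.smoothTransition.one_of_one_le (by linarith)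

lemma abs_cutoff_le (t : ℝ) : |cutoff t| ≤ 1 := by
  rw [cutoff, abs_of_nonneg (Real.smoothTransition.nonneg _)]
  exact Real.smoothTransition.le_one _

lemma deriv_cutoff_of_gt {t : ℝ} (ht : 2 < t) : deriv cutoff t = 0 := by
  have : cutoff =ᶠ[𝓝 t] fun _ => 1 :=
    (eventually_gt_nhds ht).mono fun s hs => cutoff_of_ge hs.le
  rw [this.deriv_eq, deriv_const]

/-- The derivative of cutoff(jρ) along ρ∇ρ is t·cutoff'(t)|dρ|² with t = jρ. This scale-invariant
bound therefore controls it uniformly in j. -/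
lemma exists_bound_mul_deriv_cutoff : ∃ C, 0 ≤ C ∧ ∀ t, 0 ≤ t → |t * deriv cutoff t| ≤ C := by
  obtain ⟨C, hC⟩ := (isCompact_Icc (a := (0 : ℝ)) (b := 2)).exists_bound_of_continuousOn
    (f := fun t => t * deriv cutoff t)
    (continuous_id.mul (contDiff_cutoff.continuous_deriv (by simp))).continuousOn
  have h0 : 0 ≤ C := (norm_nonneg _).trans (hC 0 (by simp))
  refine ⟨C, h0, fun t ht => ?_⟩
  rcases le_or_gt t 2 with h2 | h2
  · exact hC t ⟨ht, h2⟩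
  · rwa [deriv_cutoff_of_gt h2, mul_zero, abs_zero]

end Cutoff

/-! ### Removing the cutoff, and the integrated lower bound for |du|². -/

namespace IsCompactified

variable {n : ℕ} [NeZero n] {X : Type*} [TopologicalSpace X] [T2Space X] [CompactSpace X]
  [ChartedSpace (EuclideanHalfSpace n) X] [IsManifold (𝓡∂ n) ∞ X]
  [MeasurableSpace X] [BorelSpace X]
  {g gbar : BilinField n X} {ρ : X → ℝ} (h : IsCompactified g gbar ρ)
  {u : X → ℝ} {θ : CovectorField n X}

omit [T2Space X] [CompactSpace X] [MeasurableSpace X] [BorelSpace X] in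
lemma contMDiff_cutoff (hρ : ContMDiff (𝓡∂ n) 𝓘(ℝ, ℝ) ∞ ρ) (j : ℝ) :
    ContMDiff (𝓡∂ n) 𝓘(ℝ, ℝ) ∞ fun x => cutoff (j * ρ x) :=
  (contDiff_cutoff.comp (contDiff_const.mul contDiff_id)).contMDiff.comp hρ

include h

lemma tsupport_cutoff_subset (j : ℝ) : tsupport (fun x => cutoff (j * ρ x)) ⊆
    (𝓡∂ n).interior X := by
  have hc : IsClosed {x | 1 ≤ j * ρ x} :=
    isClosed_le continuous_const (h.isDefiningFunction.smooth.continuous.const_mul j)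
  intro x hx
  have h1 : 1 ≤ j * ρ x := by
    refine closure_minimal (fun z hz => ?_) hc hx
    by_contra h2
    exact hz (cutoff_of_le (not_le.1 h2).le)
  refine h.mem_interior (lt_of_le_of_ne (h.isDefiningFunction.nonneg x) fun h0 => ?_)
  rw [← h0, mul_zero] at h1
  linarith

lemma radial_cutoff (j : ℝ) (x : X) : radial gbar ρ (differential fun x => cutoff (j * ρ x)) x =
    j * ρ x * deriv cutoff (j * ρ x) * normSqAt gbar (differential ρ) x := by
  have hd : DifferentiableAt ℝ cutoff (j * ρ x) :=
    contDiff_cutoff.contDiffAt.differentiableAt (by simp)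
  have h1 : HasDerivAt (fun t => cutoff (j * t)) (deriv cutoff (j * ρ x) * j) (ρ x) :=
    hd.hasDerivAt.comp (ρ x) (hasDerivAt_const_mul j)
  have h2 := pairAt_differential_comp gbar (differential ρ) h1.differentiableAt
    (h.mdifferentiableAt_rho (x := x))
  rw [radial, h2, h1.deriv]
  change _ = _ * pairAt gbar (differential ρ) (differential ρ) x
  ring

lemma eventually_lt_mul_rho {x : X} (hx : x ∈ (𝓡∂ n).interior X) :
    ∀ᶠ j : ℕ in atTop, 2 < (j : ℝ) * ρ x :=
  (tendsto_natCast_atTop_atTop.atTop_mul_const (h.pos hx)).eventually_gt_atTop 2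

/-- Take ζ = cutoff(jρ) and let j tend to infinity. At each interior point ζ is eventually 1 with
zero derivative, and both integrands are dominated uniformly in j, so no boundary term survives. -/
lemma integral_radial {D : X → ℝ} (hD : Continuous D)
    (hw : IsWeakDifferential u θ) (hu : MemLp u 2 (riemVolume g))
    (hθ : Integrable (normSqAt g θ) (riemVolume g))
    (hparts : ∀ ζ : X → ℝ, ContMDiff (𝓡∂ n) 𝓘(ℝ, ℝ) ∞ ζ → tsupport ζ ⊆ (𝓡∂ n).interior X →
      ∫ x, 2 * (u x * (ζ x * radial gbar ρ θ x)) ∂(riemVolume g) =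
        -∫ x, u x ^ 2 * (radial gbar ρ (differential ζ) x + ζ x * D x) ∂(riemVolume g)) :
    ∫ x, 2 * (u x * radial gbar ρ θ x) ∂(riemVolume g) =
      -∫ x, u x ^ 2 * D x ∂(riemVolume g) := by
  have hρ := h.isDefiningFunction.smooth
  have hR := h.memLp_radial hw hθ
  have huR : Integrable (fun x => u x * radial gbar ρ θ x) (riemVolume g) := hu.integrable_mul hR
  have hcut : ∀ j : ℕ, Continuous fun x => cutoff (j * ρ x) := fun j =>
    (contMDiff_cutoff hρ j).continuous
  have hlim : ∀ x ∈ (𝓡∂ n).interior X,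
      ∀ᶠ j : ℕ in atTop, cutoff (j * ρ x) = 1 ∧ deriv cutoff (j * ρ x) = 0 := fun x hx =>
    (h.eventually_lt_mul_rho hx).mono fun j hj => ⟨cutoff_of_ge hj.le, deriv_cutoff_of_gt hj⟩
  have l1 : Tendsto (fun j : ℕ => ∫ x, 2 * (u x * (cutoff (j * ρ x) * radial gbar ρ θ x))
      ∂(riemVolume g)) atTop (𝓝 (∫ x, 2 * (u x * radial gbar ρ θ x) ∂(riemVolume g))) := by
    refine tendsto_integral_of_dominated_convergence (fun x => ‖2 * (u x * radial gbar ρ θ x)‖)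
      (fun j => ?_) (huR.const_mul 2).norm (fun j => Eventually.of_forall fun x => ?_) ?_
    · exact (hu.1.mul ((hcut j).aestronglyMeasurable.mul hR.1)).const_mul 2
    · have h1 := abs_cutoff_le (j * ρ x)
      have h2 : 2 * (u x * (cutoff (j * ρ x) * radial gbar ρ θ x)) =
        cutoff (j * ρ x) * (2 * (u x * radial gbar ρ θ x)) := by ring
      rw [h2, norm_mul]
      exact mul_le_of_le_one_left (norm_nonneg _) h1
    · filter_upwards [ae_mem_interior] with x hx
      refine tendsto_const_nhds.congr' ?_
      filter_upwards [hlim x hx] with j hj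
      rw [hj.1, one_mul]
  obtain ⟨C₁, hC₁, hC₁'⟩ := exists_bound_mul_deriv_cutoff
  obtain ⟨C₂, hC₂⟩ := isCompact_univ.exists_bound_of_continuousOn h.continuous_normSqAt.continuousOn
  obtain ⟨C₃, hC₃⟩ := isCompact_univ.exists_bound_of_continuousOn hD.continuousOn
  have l2 : Tendsto (fun j : ℕ => ∫ x, u x ^ 2 * (radial gbar ρ (differential fun x =>
      cutoff (j * ρ x)) x + cutoff (j * ρ x) * D x) ∂(riemVolume g)) atTop
      (𝓝 (∫ x, u x ^ 2 * D x ∂(riemVolume g))) := by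
    refine tendsto_integral_of_dominated_convergence (fun x => u x ^ 2 * (C₁ * C₂ + C₃))
      (fun j => ?_) (hu.integrable_sq.mul_const _) (fun j => Eventually.of_forall fun x => ?_) ?_
    · exact (hu.1.pow 2).mul (((h.continuous_radial (contMDiff_cutoff hρ j)).add
        ((hcut j).mul hD)).aestronglyMeasurable)
    · rw [norm_mul, Real.norm_of_nonneg (sq_nonneg (u x)), h.radial_cutoff]
      refine mul_le_mul_of_nonneg_left ((norm_add_le _ _).trans (add_le_add ?_ ?_)) (sq_nonneg _)
      · rw [norm_mul]
        exact mul_le_mul (hC₁' _ (mul_nonneg j.cast_nonneg (h.isDefiningFunction.nonneg x)))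
          (hC₂ x (mem_univ x)) (norm_nonneg _) hC₁
      · rw [norm_mul]
        exact (mul_le_of_le_one_left (norm_nonneg _) (abs_cutoff_le _)).trans (hC₃ x (mem_univ x))
    · filter_upwards [ae_mem_interior] with x hx
      refine tendsto_const_nhds.congr' ?_
      filter_upwards [hlim x hx] with j hj
      rw [h.radial_cutoff, hj.1, hj.2, mul_zero, zero_mul, zero_add, one_mul]
  refine tendsto_nhds_unique l1 (l2.neg.congr fun j => ?_)
  exact (hparts _ (contMDiff_cutoff hρ j) (h.tsupport_cutoff_subset j)).symm

/-- The square |θ - (su/ρ)dρ|²_g is nonnegative. The division by ρ is compensated by the ρ² that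
relates the two metrics on covectors. -/
lemma radial_le (s : ℝ) {x : X} (hx : x ∈ (𝓡∂ n).interior X) :
    s * (2 * (u x * radial gbar ρ θ x)) - s ^ 2 * (u x ^ 2 * normSqAt gbar (differential ρ) x) ≤
      normSqAt g θ x := by
  have h0 := (h.pos hx).ne'
  have h1 := (h.isInner_g hx).two_mul_coPair_le (θ x) (differential (n := n) ρ x) (s * u x / ρ x)
  change 2 * (s * u x / ρ x) * pairAt g θ (differential ρ) x ≤ normSqAt g θ x +
    (s * u x / ρ x) ^ 2 * pairAt g (differential ρ) (differential ρ) x at h1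
  rw [h.pairAt_eq hx, h.pairAt_eq hx] at h1
  have h2 : 2 * (s * u x / ρ x) * (ρ x ^ 2 * pairAt gbar θ (differential ρ) x) =
      s * (2 * (u x * radial gbar ρ θ x)) := by
    rw [radial]
    field_simp
  have h3 : (s * u x / ρ x) ^ 2 * (ρ x ^ 2 * pairAt gbar (differential ρ) (differential ρ) x) =
      s ^ 2 * (u x ^ 2 * normSqAt gbar (differential ρ) x) := by
    change _ = s ^ 2 * (u x ^ 2 * pairAt gbar (differential ρ) (differential ρ) x)
    field_simp
  rw [h2, h3] at h1
  linarith

omit h in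
lemma integrable_sq_mul (hu : MemLp u 2 (riemVolume g)) {f : X → ℝ} (hf : Continuous f) :
    Integrable (fun x => u x ^ 2 * f x) (riemVolume g) := by
  obtain ⟨C, hC⟩ := isCompact_univ.exists_bound_of_continuousOn hf.continuousOn
  exact hu.integrable_sq.mul_bdd (c := C) hf.aestronglyMeasurable
    (Eventually.of_forall fun x => hC x (mem_univ x))

lemma neg_integral_le_integral_normSq {D : X → ℝ} (hD : Continuous D)
    (hθ : Integrable (normSqAt g θ) (riemVolume g)) (hu : MemLp u 2 (riemVolume g))
    (hw : IsWeakDifferential u θ)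
    (hparts : ∫ x, 2 * (u x * radial gbar ρ θ x) ∂(riemVolume g) =
      -∫ x, u x ^ 2 * D x ∂(riemVolume g)) (s : ℝ) :
    -∫ x, u x ^ 2 * (s * D x + s ^ 2 * normSqAt gbar (differential ρ) x) ∂(riemVolume g) ≤
      ∫ x, normSqAt g θ x ∂(riemVolume g) := by
  have i1 : Integrable (fun x => s * (2 * (u x * radial gbar ρ θ x))) (riemVolume g) :=
    ((hu.integrable_mul (h.memLp_radial hw hθ)).const_mul 2).const_mul s
  have i2 := (integrable_sq_mul hu h.continuous_normSqAt).const_mul (s ^ 2)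
  have i3 := (integrable_sq_mul hu hD).const_mul s
  have h1 : ∫ x, (s * (2 * (u x * radial gbar ρ θ x)) -
      s ^ 2 * (u x ^ 2 * normSqAt gbar (differential ρ) x)) ∂(riemVolume g) ≤
      ∫ x, normSqAt g θ x ∂(riemVolume g) :=
    integral_mono_ae (i1.sub i2) hθ (ae_mem_interior.mono fun x hx => h.radial_le s hx)
  have h2 : ∫ x, u x ^ 2 * (s * D x + s ^ 2 * normSqAt gbar (differential ρ) x) ∂(riemVolume g) =
      ∫ x, (s * (u x ^ 2 * D x) + s ^ 2 * (u x ^ 2 * normSqAt gbar (differential ρ) x))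
        ∂(riemVolume g) := by
    congr 1
    ext x
    ring
  rw [integral_sub i1 i2, integral_const_mul, hparts, integral_const_mul] at h1
  rw [h2, integral_add i3 i2, integral_const_mul, integral_const_mul]
  linarith

end IsCompactified

lemma MemW12.isWeakDifferential {n : ℕ} [NeZero n] {X : Type*} [TopologicalSpace X]
    [ChartedSpace (EuclideanHalfSpace n) X] [MeasurableSpace X] {g : BilinField n X} {u : X → ℝ}
    (hu : MemW12 g u) : IsWeakDifferential u (weakDifferential (n := n) u) := by
  rw [weakDifferential, dif_pos hu.exists_weakDifferential]
  exact hu.exists_weakDifferential.choose_spec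

/-- A continuous function vanishing on the complement of a set tends to zero at infinity on it. -/
lemma tendsto_domRestrict_cocompact {X : Type*} [TopologicalSpace X] [CompactSpace X] {ε : X → ℝ}
    (hε : Continuous ε) {U : Set X} (h0 : ∀ x ∉ U, ε x = 0) :
    Tendsto (U.domRestrict ε) (cocompact U) (𝓝 0) := by
  rw [Metric.tendsto_nhds]
  intro η hη
  have hK : IsCompact {x | η ≤ |ε x|} := (isClosed_le continuous_const hε.abs).isCompact
  refine mem_cocompact.2 ⟨Subtype.val ⁻¹' {x | η ≤ |ε x|}, ?_, fun x hx => ?_⟩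
  · rw [Subtype.isCompact_iff, Subtype.image_preimage_coe, inter_eq_right.2]
    · exact hK
    · intro x hx
      by_contra hxU
      have h1 : η ≤ |ε x| := hx
      rw [h0 x hxU, abs_zero] at h1
      linarith
  · have h1 : |ε x| < η := not_le.1 hx
    simpa [Real.dist_eq] using h1

end AH

end

/-! ### Choice of constants and of ε. -/

theorem lemma3p1 {n : ℕ} [NeZero n] (hn : 3 ≤ n)
    {X : Type*} [TopologicalSpace X] [T2Space X] [CompactSpace X]
    [ChartedSpace (EuclideanHalfSpace n) X] [IsManifold (𝓡∂ n) ∞ X]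
    [MeasurableSpace X] [BorelSpace X]
    (l : ℕ) (hl : 2 ≤ l) (β : ℝ≥0) (hβ : β < 1)
    (g : AH.BilinField n X) (hg : AH.IsAsymptoticallyHyperbolic l β g) :
    ∃ ε : X → ℝ,
      ContinuousOn ε ((𝓡∂ n).interior X) ∧
      Tendsto (((𝓡∂ n).interior X).domRestrict ε) (cocompact ((𝓡∂ n).interior X)) (𝓝 0) ∧
      ∀ u : X → ℝ, AH.MemW12 g u →
        Integrable (AH.energyDensity g u) (AH.riemVolume g) ∧
        Integrable (fun x => (((n : ℝ) - 1) / ((n : ℝ) - 2) + ε x) * u x ^ 2)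
          (AH.riemVolume g) ∧
        ∫ x, (((n : ℝ) - 1) / ((n : ℝ) - 2) + ε x) * u x ^ 2 ∂(AH.riemVolume g)
          ≤ AH.energy g u := by
  obtain ⟨gbar, ρ, h⟩ := hg.exists_isCompactified hl
  obtain ⟨D, hD, hDb, hparts⟩ := h.exists_divergence
  have hn' : (0 : ℝ) < (n : ℝ) - 2 := by
    have : (3 : ℝ) ≤ n := by exact_mod_cast hn
    linarith
  set c : ℝ := 4 * ((n : ℝ) - 1) / ((n : ℝ) - 2) with hc
  have hc0 : 0 ≤ c := div_nonneg (by linarith) hn'.le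
  -- This s maximises s(n - 1) - s², the boundary value of -W.
  set s : ℝ := ((n : ℝ) - 1) / 2 with hs
  set W : X → ℝ := fun x => s * D x + s ^ 2 * AH.normSqAt gbar (AH.differential ρ) x with hW
  have hWc : Continuous W := (hD.const_mul s).add (h.continuous_normSqAt.const_mul (s ^ 2))
  -- ε is exactly what makes (n-1)/(n-2) + ε equal to Scal - cW on the interior.
  set ε : X → ℝ := fun x =>
    AH.IsCompactified.scalExt g x - c * W x - ((n : ℝ) - 1) / ((n : ℝ) - 2) with hε
  have hεc : Continuous ε :=
    (h.continuous_scalExt.sub (hWc.const_mul c)).sub continuous_const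
  refine ⟨ε, hεc.continuousOn, AH.tendsto_domRestrict_cocompact hεc fun x hx => ?_, fun u hu => ?_⟩
  · have hxb : x ∈ (𝓡∂ n).boundary X := by
      rw [← (𝓡∂ n).compl_interior]
      exact hx
    simp only [hε, hW, AH.IsCompactified.scalExt]
    -- On the boundary W = -(n-1)²/4, and the claim is -n(n-1) + (n-1)³/(n-2) = (n-1)/(n-2).
    rw [if_neg hx, hDb x hxb, h.boundary x hxb, hc, hs]
    field_simp
    ring
  · have hw := hu.isWeakDifferential
    have i1 := hu.integrable_normSq
    have i2 := AH.IsCompactified.integrable_sq_mul hu.memLp h.continuous_scalExt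
    have i3 := AH.IsCompactified.integrable_sq_mul hu.memLp hWc
    -- Only almost everywhere: the extended scalar curvature may differ from `scal g` on the
    -- boundary, which has measure zero.
    have e1 : (fun x => c * AH.normSqAt g (AH.weakDifferential u) x +
        u x ^ 2 * AH.IsCompactified.scalExt g x) =ᵐ[AH.riemVolume g] AH.energyDensity g u := by
      filter_upwards [AH.ae_mem_interior] with x hx
      rw [AH.energyDensity, AH.IsCompactified.scalExt, if_pos hx]
      ring
    have e2 : (fun x => (((n : ℝ) - 1) / ((n : ℝ) - 2) + ε x) * u x ^ 2) =
        fun x => u x ^ 2 * AH.IsCompactified.scalExt g x - c * (u x ^ 2 * W x) := by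
      ext x
      simp only [hε]
      ring
    have key := h.neg_integral_le_integral_normSq hD i1 hu.memLp hw
      (h.integral_radial hD hw hu.memLp i1 (hparts u _ hw hu.memLp i1)) s
    refine ⟨((i1.const_mul c).add i2).congr e1, ?_, ?_⟩
    · rw [e2]
      exact i2.sub (i3.const_mul c)
    · rw [e2, AH.energy, ← integral_congr_ae e1, integral_sub i2 (i3.const_mul c),
        integral_add (i1.const_mul c) i2, integral_const_mul, integral_const_mul]
      have := mul_le_mul_of_nonneg_left key hc0
      linarith
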